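/- **Setting.** Let $(X_i,W_i,H_i,Y_i(0),Y_i(1))_{i\ge 1}$ be i.i.d., with covariates $X_i\in\mathbb R^d$ having finite second moments, treatment $W_i\in\{0,1\}$, study label $H_i\in\{1,\dots,K\}$, and observed outcome $Y_i=Y_i(W_i)$. Put $\rho_k=P(H_i=k)>0$, assume $0<P(W_i=1\mid H_i=k)<1$, and assume that within each study (conditionally on $H_i=k$) $W_i$ is independent of $(X_i,Y_i(0),Y_i(1))$. The law of $X_i$ given $H_i=k$ may depend on $k$ arbitrarily. With $X_i'=(1,X_i)$, assume $Y_i(w)=X_i'\theta^{(w)}+\varepsilon_i(w)$, $w\in\{0,1\}$, where $\varepsilon_i(w)\in L^2$ and, in every study, $E(\varepsilon_i(w)\mid X_i)=0$ and $V(\varepsilon_i(w)\mid X_i)=\sigma^2>0$. Let $\tau=E(Y(1)-Y(0))$ and $\tau_k=E(Y(1)-Y(0)\mid H=k)$. **Estimators** (from the first $n$ units). Let $n_k$, $n^{(w)}$, $n_k^{(w)}$ be the numbers of units in study $k$, in arm $w$, and in both; let $X'^{(w)},Y^{(w)}$ and $X_k'^{(w)},Y_k^{(w)}$ be the corresponding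 augmented design matrices and outcome vectors. Let $\hat\theta_{\rm pool}^{(w)}$ and $\hat\theta_k^{(w)}$ be the ordinary least squares estimators on $(X'^{(w)},Y^{(w)})$ and $(X_k'^{(w)},Y_k^{(w)})$, let $\Sigma_k^{(w)}=\sigma^2(X_k'^{(w)\top}X_k'^{(w)})^{-1}$, and $$\hat\theta_{\text{1S-SW}}^{(w)}=\sum_k\frac{n_k^{(w)}}{n^{(w)}}\hat\theta_k^{(w)},\qquad \hat\theta_{\text{1S-IVW}}^{(w)}=\Big(\sum_k(\Sigma_k^{(w)})^{-1}\Big)^{-1}\sum_k(\Sigma_k^{(w)})^{-1}\hat\theta_k^{(w)}.$$ $\hat\theta_{\rm GD}^{(w)}$ is the limit, as the number of rounds tends to infinity, of full-batch federated averaging on the mean squared error (weights $n_k^{(w)}/n^{(w)}$, one local step per round, arbitrary fixed initial value), with any measurable, possibly data-dependent, learning rate $0<\eta<2/L$, where $L$ is the largest eigenvalue of the Hessian $\frac{2}{n^{(w)}}X'^{(w)\top}X'^{(w)}$ of the pooled loss. Finally $\hat\tau_{\rm pool}=\frac1n\sum_i X_i'(\hat\theta_{\rm pool}^{(1)}-\hat\theta_{\rm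 pool}^{(0)})$, and for $a\in\{\text{GD},\text{1S-SW},\text{1S-IVW}\}$ $$\hat\tau_a=\sum_k\frac{n_k}{n}\cdot\frac1{n_k}\sum_{i:H_i=k}X_i'(\hat\theta_a^{(1)}-\hat\theta_a^{(0)}).$$ **Local Full Rank** ($\mathrm{LFR}_n$) is the event that $\operatorname{rank}(X_k'^{(w)\top}X_k'^{(w)})=d+1$ for all $k$ and $w$. Assume $P(\mathrm{LFR}_n)>0$ for some $n$. A *full rank design event* is an event $S$ with $P(S)>0$, determined by $(X_i,W_i,H_i)_{i\le n}$, on which $\mathrm{LFR}_n$ holds almost surely (for example $S=\mathrm{LFR}_n$). **Proposition.** One has $P(\mathrm{LFR}_n)\to1$, and the following hold. 1. *Unbiasedness.* Let $S$ be a full rank design event for the first $n$ units and let $a\in\{\text{1S-SW},\text{1S-IVW}\}$. - $E(\hat\theta_{a}^{(w)}\mid S)=\theta^{(w)}$, coordinate by coordinate, whenever the coordinate is integrable given $S$. - If $\hat\tau_a$ is integrable given $S$, then $E(\hat\tau_a\mid S)=E(m_n\mid S)$ with $m_n=\frac1n\sum_{i\le n}X_i'(\theta^{(1)}-\theta^{(0)})$;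 and, for $n\ge1$, $m_n$ is integrable with $E(m_n)=\tau$. - If $S$ is the event that the first $n$ units have a given allocation to studies and arms, and $\hat\tau_a$ is integrable given $S$, then $E(\hat\tau_a\mid S)=\sum_k\frac{n_k}{n}\tau_k$; and, for $n\ge1$, $E\big(\sum_k\frac{n_k}{n}\tau_k\big)=\tau$ over the unrestricted sampling of study labels. - If $S_n$ are full rank design events for all large $n$, $P(S_n)\to1$, and $\hat\tau_a$ is integrable given $S_n$ for all large $n$, then $E(\hat\tau_a\mid S_n)\to\tau$. 2. *Variance of the outcome parameters.* For $w\in\{0,1\}$ and every full rank design event $S$, with variances taken given $S$, $$V(\hat\theta^{(w)}_{\rm pool})=V(\hat\theta^{(w)}_{\rm GD})=V(\hat\theta^{(w)}_{\text{1S-IVW}})\preceq V(\hat\theta^{(w)}_{\text{1S-SW}})$$ in the Loewner order: for every vector $v$ the variances, in $[0,\infty]$, of $v^\top\hat\theta^{(w)}$ compare in this way; and if $\hat\theta^{(w)}_{\text{1S-SW}}$ has finite second moments given $S$, then so do the other three estimators, and the covariance matrices compare in this way. 3. *Asymptotic variance of the ATE estimators.* There are finite $V,V_{\rm SW}\ge0$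 with $V\le V_{\rm SW}$ such that $\sqrt n(\hat\tau-\tau)\to\mathcal N(0,V)$ in distribution for $\hat\tau=\hat\tau_{\rm pool},\hat\tau_{\rm GD},\hat\tau_{\text{1S-IVW}}$, and $\sqrt n(\hat\tau_{\text{1S-SW}}-\tau)\to\mathcal N(0,V_{\rm SW})$ in distribution. That is, $\mathbb V^\infty(\hat\tau_{\rm pool})=\mathbb V^\infty(\hat\tau_{\rm GD})=\mathbb V^\infty(\hat\tau_{\text{1S-IVW}})\le\mathbb V^\infty(\hat\tau_{\text{1S-SW}})$. -/

import Mathlib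

open MeasureTheory ProbabilityTheory Filter Topology Matrix
open scoped NNReal ENNReal

noncomputable section

/-- Covariate vector augmented with an intercept, `x' = (1, x)`. -/
def augment {d : ℕ} (x : Fin d → ℝ) : Fin (d + 1) → ℝ := Fin.cons 1 x

/-- A data set of `n` observed units: covariates, treatment arm, study, observed outcome. -/
structure Sample (n d K : ℕ) where
  x : Fin n → Fin d → ℝ
  arm : Fin n → Fin 2
  study : Fin n → Fin K
  y : Fin n → ℝ

/-- The two weightings used to federate the local outcome parameters. -/
inductive Federation where
  | SW
  | IVW

namespace Sample

variable {n d K : ℕ} (D : Sample n d K)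

/-- Units of study `k`; there are `n_k` of them. -/
def inStudy (k : Fin K) : Finset (Fin n) := {i | D.study i = k}

/-- Units in arm `w`; there are `n^(w)` of them. -/
def inArm (w : Fin 2) : Finset (Fin n) := {i | D.arm i = w}

/-- Units of study `k` in arm `w`; there are `n_k^(w)` of them. -/
def inCell (k : Fin K) (w : Fin 2) : Finset (Fin n) := {i | D.study i = k ∧ D.arm i = w}

/-- `X'ᵀ X'`, where `X'` is the augmented design matrix with rows indexed by `s`. -/
def gram (s : Finset (Fin n)) : Matrix (Fin (d + 1)) (Fin (d + 1)) ℝ :=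
  ∑ i ∈ s, vecMulVec (augment (D.x i)) (augment (D.x i))

/-- `X'ᵀ y` for the rows indexed by `s`. -/
def moment (s : Finset (Fin n)) : Fin (d + 1) → ℝ := ∑ i ∈ s, D.y i • augment (D.x i)

/-- Ordinary least squares on the rows indexed by `s`. -/
def ols (s : Finset (Fin n)) : Fin (d + 1) → ℝ := (D.gram s)⁻¹ *ᵥ D.moment s

/-- Every study and arm has an augmented design matrix of full column rank. -/
def LocalFullRank : Prop := ∀ k w, (D.gram (D.inCell k w)).rank = d + 1

def thetaPool (w : Fin 2) : Fin (d + 1) → ℝ := D.ols (D.inArm w)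

def thetaLocal (k : Fin K) (w : Fin 2) : Fin (d + 1) → ℝ := D.ols (D.inCell k w)

/-- Sampling covariance `σ² (X'ᵀ X')⁻¹` of the local estimate. -/
def localCov (σ : ℝ) (k : Fin K) (w : Fin 2) : Matrix (Fin (d + 1)) (Fin (d + 1)) ℝ :=
  σ ^ 2 • (D.gram (D.inCell k w))⁻¹

/-- One-shot federated outcome parameters. -/
def thetaOneShot (σ : ℝ) : Federation → Fin 2 → Fin (d + 1) → ℝ
  | .SW, w => ∑ k, (((D.inCell k w).card : ℝ) / (D.inArm w).card) • D.thetaLocal k w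
  | .IVW, w => (∑ k, (D.localCov σ k w)⁻¹)⁻¹ *ᵥ ∑ k, (D.localCov σ k w)⁻¹ *ᵥ D.thetaLocal k w

/-- Full-batch gradient `-(2/|s|) X'ᵀ (y - X' θ)` of the mean squared error on the rows `s`. -/
def mseGrad (s : Finset (Fin n)) (θ : Fin (d + 1) → ℝ) : Fin (d + 1) → ℝ :=
  -((2 / (s.card : ℝ)) • (D.moment s - D.gram s *ᵥ θ))

/-- `E` local gradient steps with learning rate `η` on the rows `s`. -/
def localUpdate (η : ℝ) (E : ℕ) (s : Finset (Fin n)) (θ : Fin (d + 1) → ℝ) : Fin (d + 1) → ℝ :=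
  (fun t => t - η • D.mseGrad s t)^[E] θ

/-- Federated averaging in arm `w`: `T` rounds of `E` local steps from the initial value `θ₀`. -/
def fedAvg (w : Fin 2) (η : ℝ) (E : ℕ) (θ₀ : Fin (d + 1) → ℝ) (T : ℕ) : Fin (d + 1) → ℝ :=
  (fun t => ∑ k, (((D.inCell k w).card : ℝ) / (D.inArm w).card) •
    D.localUpdate η E (D.inCell k w) t)^[T] θ₀

/-- `0 < η < 2 / L`, with `L` the smoothness constant of the pooled mean squared error in arm `w`,
that is, the largest eigenvalue of its Hessian `(2 / n^(w)) X'ᵀ X'`. -/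
def IsLearningRate (w : Fin 2) (η : ℝ) : Prop :=
  0 < η ∧ ∀ L : ℝ, Module.End.HasEigenvalue
    (Matrix.toLin' ((2 / ((D.inArm w).card : ℝ)) • D.gram (D.inArm w))) L → η * L < 2

/-- Output of federated averaging with one local step per round, as the number of rounds grows. -/
def thetaGD (η : Fin 2 → ℝ) (θ₀ : Fin (d + 1) → ℝ) (w : Fin 2) : Fin (d + 1) → ℝ :=
  limUnder atTop (D.fedAvg w (η w) 1 θ₀)

/-- Pooled G-formula estimate of the average treatment effect. -/
def tauPool : ℝ :=
  1 / (n : ℝ) * ∑ i, (augment (D.x i) ⬝ᵥ D.thetaPool 1 - augment (D.x i) ⬝ᵥ D.thetaPool 0)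

/-- Local treatment effect estimate in study `k` from given outcome parameters `t`. -/
def tauStudy (t : Fin 2 → Fin (d + 1) → ℝ) (k : Fin K) : ℝ :=
  1 / ((D.inStudy k).card : ℝ) *
    ∑ i ∈ D.inStudy k, (augment (D.x i) ⬝ᵥ t 1 - augment (D.x i) ⬝ᵥ t 0)

/-- Sample-size weighted aggregation of the local treatment effect estimates. -/
def tauFed (t : Fin 2 → Fin (d + 1) → ℝ) : ℝ :=
  ∑ k, ((D.inStudy k).card : ℝ) / n * D.tauStudy t k

def tauOneShot (σ : ℝ) (agg : Federation) : ℝ := D.tauFed (D.thetaOneShot σ agg)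

def tauGD (η : Fin 2 → ℝ) (θ₀ : Fin (d + 1) → ℝ) : ℝ := D.tauFed (D.thetaGD η θ₀)

end Sample

/-- The random variables of the trial: for unit `i`, covariates `X i`, treatment `W i`, study `H i`
and potential outcomes `Y i w` under the arms `w = 0, 1`. -/
structure Trial (Ω : Type*) (d K : ℕ) where
  X : ℕ → Ω → Fin d → ℝ
  W : ℕ → Ω → Fin 2
  H : ℕ → Ω → Fin K
  Y : ℕ → Fin 2 → Ω → ℝ

namespace Trial

variable {Ω : Type*} {d K : ℕ} (T : Trial Ω d K)

/-- Data set of the first `n` units; the observed outcome is the potential outcome under the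
treatment received. -/
def sample (n : ℕ) (ω : Ω) : Sample n d K where
  x i := T.X i ω
  arm i := T.W i ω
  study i := T.H i ω
  y i := T.Y i (T.W i ω) ω

/-- Noise of the linear model `Y(w) = c^(w) + X β^(w) + ε(w)`, `θ w = (c^(w), β^(w))`. -/
def noise (θ : Fin 2 → Fin (d + 1) → ℝ) (w : Fin 2) (ω : Ω) : ℝ :=
  T.Y 0 w ω - augment (T.X 0 ω) ⬝ᵥ θ w

variable [MeasurableSpace Ω]

/-- `K` Bernoulli trials whose covariate distributions may differ arbitrarily between studies, with
a common homoscedastic linear outcome model in each arm. Conditioning on study `k` means passing to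
the conditional probability given `H = k`. -/
structure IsCovariateShiftRCT (P : Measure Ω) (θ : Fin 2 → Fin (d + 1) → ℝ) (σ : ℝ) : Prop where
  measurable_X : ∀ i, Measurable (T.X i)
  measurable_W : ∀ i, Measurable (T.W i)
  measurable_H : ∀ i, Measurable (T.H i)
  measurable_Y : ∀ i w, Measurable (T.Y i w)
  indep : iIndepFun (fun i ω => (T.X i ω, T.W i ω, T.H i ω, fun w => T.Y i w ω)) P
  identDistrib : ∀ i, IdentDistrib
    (fun ω => (T.X i ω, T.W i ω, T.H i ω, fun w => T.Y i w ω))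
    (fun ω => (T.X 0 ω, T.W 0 ω, T.H 0 ω, fun w => T.Y 0 w ω)) P P
  study_pos : ∀ k, 0 < P (T.H 0 ⁻¹' {k})
  /-- Positivity: `0 < P(W = w | H = k)` for both arms. -/
  arm_pos : ∀ k w, 0 < P[|T.H 0 ⁻¹' {k}] (T.W 0 ⁻¹' {w})
  /-- Randomization within each study. -/
  randomized : ∀ k, IndepFun (T.W 0) (fun ω => (T.X 0 ω, fun w => T.Y 0 w ω)) P[|T.H 0 ⁻¹' {k}]
  memLp_X : MemLp (T.X 0) 2 P
  sigma_pos : 0 < σ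
  memLp_noise : ∀ w, MemLp (T.noise θ w) 2 P
  /-- `E(ε(w) | X) = 0` in every study. -/
  noise_mean : ∀ k w, (P[|T.H 0 ⁻¹' {k}])[T.noise θ w | MeasurableSpace.comap (T.X 0) inferInstance]
    =ᵐ[P[|T.H 0 ⁻¹' {k}]] fun _ => 0
  /-- `V(ε(w) | X) = σ²` in every study. -/
  noise_var : ∀ k w,
    (P[|T.H 0 ⁻¹' {k}])[fun ω => T.noise θ w ω ^ 2 | MeasurableSpace.comap (T.X 0) inferInstance]
    =ᵐ[P[|T.H 0 ⁻¹' {k}]] fun _ => σ ^ 2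

/-- Average treatment effect `E(Y(1) - Y(0))`. -/
def ate (P : Measure Ω) : ℝ := ∫ ω, (T.Y 0 1 ω - T.Y 0 0 ω) ∂P

/-- Average treatment effect `E(Y(1) - Y(0) | H = k)` of study `k`. -/
def studyATE (P : Measure Ω) (k : Fin K) : ℝ :=
  ∫ ω, (T.Y 0 1 ω - T.Y 0 0 ω) ∂(P[|T.H 0 ⁻¹' {k}])

/-- The event that local full rank holds for the first `n` units. -/
def fullRank (n : ℕ) : Set Ω := {ω | (T.sample n ω).LocalFullRank}

/-- The σ-algebra of the design `(X_i, W_i, H_i)`, `i < n`. -/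
abbrev design (n : ℕ) : MeasurableSpace Ω :=
  MeasurableSpace.comap (fun ω (i : Fin n) => (T.X i ω, T.W i ω, T.H i ω)) inferInstance

/-- An event of positive probability that is determined by the design of the first `n` units and on
which local full rank holds almost surely. -/
structure IsFullRankDesignEvent (P : Measure Ω) (n : ℕ) (S : Set Ω) : Prop where
  measurableSet : MeasurableSet[T.design n] S
  pos : P S ≠ 0
  fullRank : ∀ᵐ ω ∂P, ω ∈ S → ω ∈ T.fullRank n

/-- The event that the first `n` units are allocated to the studies `h` and the arms `a`. -/
def allocation (n : ℕ) (h : Fin n → Fin K) (a : Fin n → Fin 2) : Set Ω :=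
  {ω | ∀ i : Fin n, T.H i ω = h i ∧ T.W i ω = a i}

/-- Average over the first `n` units of the treatment effect `X'_i (θ 1 - θ 0)` given `X_i`. -/
def sampleATE (θ : Fin 2 → Fin (d + 1) → ℝ) (n : ℕ) (ω : Ω) : ℝ :=
  1 / (n : ℝ) * ∑ i : Fin n, augment (T.X i ω) ⬝ᵥ (θ 1 - θ 0)

end Trial

/-- Covariance matrix of a random vector. -/
def covMatrix {Ω : Type*} [MeasurableSpace Ω] {m : ℕ} (t : Ω → Fin m → ℝ) (Q : Measure Ω) :
    Matrix (Fin m) (Fin m) ℝ :=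
  Matrix.of fun i j => covariance (fun ω => t ω i) (fun ω => t ω j) Q

/-- `√n (t n - τ)` converges in distribution to the normal law with mean `0` and variance `V`. -/
def HasAsymptoticVariance {Ω : Type*} [MeasurableSpace Ω] (P : Measure Ω) [IsProbabilityMeasure P]
    (t : ℕ → Ω → ℝ) (τ : ℝ) (V : ℝ≥0) : Prop :=
  TendstoInDistribution (fun (n : ℕ) ω => Real.sqrt n * (t n ω - τ)) atTop (id : ℝ → ℝ)
    (fun _ => P) (gaussianReal 0 V)

end

/-!
On a full rank design the normal equations give `θ_pool = θ_GD = θ_IVW` pointwise: weighting the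
local estimates by their Gram matrices restores the pooled normal equations, and gradient descent
with a step size below `2 / L` contracts towards their unique solution.

In every direction each one-shot estimator equals the true parameter plus a linear combination of
residuals whose coefficients are functions of the design. Given the design the residuals are centred
and uncorrelated with variance `σ ^ 2`, within each study and hence also in the pooled sample, so
the combination has mean zero and variance `σ ^ 2` times the expected sum of the squared
coefficients. That sum is smallest for the pooled estimator, by Gauss–Markov.

Asymptotically, the law of large numbers makes the Gram matrices converge to positive definite
limits. After scaling by `n` the coefficients therefore converge almost surely, and since they enter
linearly they may be replaced by their limits at a cost that is negligible at the scale `√n`. The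
central limit theorem then applies to an i.i.d. sum of mean zero. Its variance is a term shared by
all estimators plus the limit of the sum of squares, to which Gauss–Markov applies once more.
-/

/-! ### Positive definite matrices and gradient descent -/

section LinearAlgebra

open scoped ComplexOrder

variable {m : Type*} [Fintype m]

/-- This is the Gauss–Markov theorem in coordinates: the common value `u` is optimal among all
families with the same `∑ k, M k *ᵥ a k`. -/
theorem sum_dotProduct_mulVec_le_of_sum_mulVec_eq {ι : Type*} [Fintype ι]
    {M : ι → Matrix m m ℝ} (hM : ∀ k, (M k).PosSemidef) {u : m → ℝ} {a : ι → m → ℝ}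
    (h : ∑ k, M k *ᵥ a k = (∑ k, M k) *ᵥ u) :
    ∑ k, u ⬝ᵥ M k *ᵥ u ≤ ∑ k, a k ⬝ᵥ M k *ᵥ a k := by
  have h_cross : ∑ k, u ⬝ᵥ M k *ᵥ a k = ∑ k, u ⬝ᵥ M k *ᵥ u := by
    rw [← dotProduct_sum, h, sum_mulVec, dotProduct_sum]
  have h_symm (k : ι) : a k ⬝ᵥ M k *ᵥ u = u ⬝ᵥ M k *ᵥ a k := by
    have hMk : (M k)ᵀ = M k := (hM k).isHermitian
    rw [dotProduct_mulVec, ← mulVec_transpose, hMk, dotProduct_comm]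
  have h_nonneg : 0 ≤ ∑ k, (a k - u) ⬝ᵥ M k *ᵥ (a k - u) :=
    Finset.sum_nonneg fun k _ => (hM k).dotProduct_mulVec_nonneg (a k - u)
  simp only [mulVec_sub, dotProduct_sub, sub_dotProduct, Finset.sum_sub_distrib, h_symm]
    at h_nonneg
  linarith

theorem posDef_of_posSemidef_of_rank_eq_card {𝕜 : Type*} [RCLike 𝕜] {A : Matrix m m 𝕜}
    (hA : A.PosSemidef) (h : A.rank = Fintype.card m) : A.PosDef := by
  classical
  have h_range : LinearMap.range A.mulVecLin = ⊤ :=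
    Submodule.eq_top_of_finrank_eq (by simpa [Matrix.rank] using h)
  rw [hA.posDef_iff_isUnit, ← mulVec_surjective_iff_isUnit]
  exact LinearMap.range_eq_top.1 h_range

variable [DecidableEq m]

theorem isUnit_det_of_posDef {𝕜 : Type*} [RCLike 𝕜] {A : Matrix m m 𝕜} (hA : A.PosDef) :
    IsUnit A.det :=
  A.isUnit_iff_isUnit_det.1 hA.isUnit

theorem inv_mulVec_dotProduct_of_isSymm {R : Type*} [CommRing R] {A : Matrix m m R}
    (hA : A.IsSymm) (u v : m → R) : (A⁻¹ *ᵥ u) ⬝ᵥ v = u ⬝ᵥ (A⁻¹ *ᵥ v) := by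
  rw [dotProduct_mulVec, ← mulVec_transpose, hA.inv.eq]

theorem mulVec_inv_mulVec {R : Type*} [CommRing R] {A : Matrix m m R} (hA : IsUnit A.det)
    (v : m → R) : A *ᵥ (A⁻¹ *ᵥ v) = v := by
  rw [mulVec_mulVec, mul_nonsing_inv _ hA, one_mulVec]

theorem inv_mulVec_mulVec {R : Type*} [CommRing R] {A : Matrix m m R} (hA : IsUnit A.det)
    (v : m → R) : A⁻¹ *ᵥ (A *ᵥ v) = v := by
  rw [mulVec_mulVec, nonsing_inv_mul _ hA, one_mulVec]

theorem inv_smul_matrix {F : Type*} [Field F] (c : F) (A : Matrix m m F) :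
    (c • A)⁻¹ = c⁻¹ • A⁻¹ := by
  rcases eq_or_ne c 0 with rfl | hc
  · simp
  by_cases hA : IsUnit A.det
  · exact inv_smul' A (Units.mk0 c hc) hA
  · have hcA : ¬IsUnit (c • A).det := by
      rwa [det_smul, IsUnit.mul_iff, not_and_or, or_iff_right (not_not.2 (hc.isUnit.pow _))]
    rw [nonsing_inv_apply_not_isUnit _ hcA, nonsing_inv_apply_not_isUnit _ hA, smul_zero]

theorem tendsto_pow_apply_zero_of_isSymmetric {𝕜 E : Type*} [RCLike 𝕜] [NormedAddCommGroup E]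
    [InnerProductSpace 𝕜 E] [FiniteDimensional 𝕜 E] {T : E →ₗ[𝕜] E} (hT : T.IsSymmetric)
    (h : ∀ μ : 𝕜, Module.End.HasEigenvalue T μ → ‖μ‖ < 1) (x : E) :
    Tendsto (fun N => (T ^ N) x) atTop (𝓝 0) := by
  let b := hT.eigenvectorBasis rfl
  have h_pow (N : ℕ) : (T ^ N) x =
      ∑ j, b.repr x j • ((hT.eigenvalues rfl j : 𝕜) ^ N • b j) := by
    conv_lhs => rw [← b.sum_repr x]
    simp only [map_sum, map_smul, b, (hT.hasEigenvector_eigenvectorBasis rfl _).pow_apply]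
  simp_rw [h_pow]
  have h_zero : ∑ j, b.repr x j • ((0 : 𝕜) • b j) = 0 := by simp
  rw [← h_zero]
  exact tendsto_finsetSum _ fun j _ => ((tendsto_pow_atTop_nhds_zero_of_norm_lt_one
    (h _ (hT.hasEigenvalue_eigenvalues rfl j))).smul_const _).const_smul _

theorem abs_eigenvalue_one_sub_smul_lt_one {A : Matrix m m ℝ} (hA : A.PosDef) {η : ℝ} (hη : 0 < η)
    (hlt : ∀ L : ℝ, Module.End.HasEigenvalue (toLin' A) L → η * L < 2) {μ : ℝ}
    (hμ : Module.End.HasEigenvalue (toEuclideanLin (1 - η • A)) μ) : |μ| < 1 := by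
  obtain ⟨x, hx⟩ := hμ.exists_hasEigenvector
  have hx0 : x.ofLp ≠ 0 := fun h => hx.2 (by ext i; simpa using congrFun h i)
  have hAx : A *ᵥ x.ofLp = (η⁻¹ * (1 - μ)) • x.ofLp := by
    have hμx : (1 - η • A) *ᵥ x.ofLp = μ • x.ofLp := congrArg WithLp.ofLp hx.apply_eq_smul
    rw [sub_mulVec, one_mulVec, smul_mulVec, sub_eq_iff_eq_add, ← sub_eq_iff_eq_add'] at hμx
    rw [mul_smul, sub_smul, one_smul, hμx, smul_smul, inv_mul_cancel₀ hη.ne', one_smul]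
  have h_upper : η * (η⁻¹ * (1 - μ)) < 2 := hlt _ <|
    Module.End.hasEigenvalue_of_hasEigenvector ⟨Module.End.mem_eigenspace_iff.2 hAx, hx0⟩
  have h_lower : 0 < η⁻¹ * (1 - μ) := by
    have h := hA.dotProduct_mulVec_pos hx0
    rw [hAx, dotProduct_smul] at h
    exact pos_of_mul_pos_left h (dotProduct_star_self_nonneg _)
  rw [mul_inv_cancel_left₀ hη.ne'] at h_upper
  have h_pos : 0 < 1 - μ := pos_of_mul_pos_right h_lower (inv_pos.2 hη).le
  rw [abs_lt]
  constructor <;> linarith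

theorem tendsto_iterate_sub_smul_mulVec {A : Matrix m m ℝ} (hA : A.PosDef) {η : ℝ} (hη : 0 < η)
    (hlt : ∀ L : ℝ, Module.End.HasEigenvalue (toLin' A) L → η * L < 2) (u : m → ℝ) :
    Tendsto (fun N => (fun t => t - η • A *ᵥ t)^[N] u) atTop (𝓝 0) := by
  have h_symm : (toEuclideanLin (1 - η • A)).IsSymmetric :=
    isSymmetric_toEuclideanLin_iff.2 (isHermitian_one.sub (hA.isHermitian.smul rfl))
  have h_iterate (N : ℕ) : ((toEuclideanLin (1 - η • A) ^ N) (WithLp.toLp 2 u)).ofLp =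
      (fun t => t - η • A *ᵥ t)^[N] u := by
    induction N with
    | zero => rfl
    | succ N ih =>
      rw [pow_succ', Module.End.mul_apply, Function.iterate_succ_apply', ← ih]
      simp
  have h_tendsto := tendsto_pow_apply_zero_of_isSymmetric h_symm
    (fun μ hμ => abs_eigenvalue_one_sub_smul_lt_one hA hη hlt hμ) (WithLp.toLp 2 u)
  simpa only [← h_iterate, WithLp.ofLp_zero, Function.comp_def] using
    ((PiLp.continuous_ofLp 2 _).tendsto _).comp h_tendsto

end LinearAlgebra

/-! ### Least squares on a fixed sample -/

namespace Sample

variable {n d K : ℕ} (D : Sample n d K)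

theorem gram_mulVec (s : Finset (Fin n)) (v : Fin (d + 1) → ℝ) :
    D.gram s *ᵥ v = ∑ i ∈ s, (augment (D.x i) ⬝ᵥ v) • augment (D.x i) := by
  simp [gram, sum_mulVec, vecMulVec_mulVec]

theorem dotProduct_gram_mulVec (s : Finset (Fin n)) (u v : Fin (d + 1) → ℝ) :
    u ⬝ᵥ D.gram s *ᵥ v = ∑ i ∈ s, (u ⬝ᵥ augment (D.x i)) * (v ⬝ᵥ augment (D.x i)) := by
  rw [gram_mulVec, dotProduct_sum]
  refine Finset.sum_congr rfl fun i _ => ?_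
  rw [dotProduct_smul, smul_eq_mul, dotProduct_comm v, mul_comm]

theorem gram_posSemidef (s : Finset (Fin n)) : (D.gram s).PosSemidef :=
  posSemidef_sum s fun i _ => posSemidef_vecMulVec_self_star (augment (D.x i))

theorem gram_isSymm (s : Finset (Fin n)) : (D.gram s).IsSymm :=
  (D.gram_posSemidef s).isHermitian

theorem sum_inArm {M : Type*} [AddCommMonoid M] (w : Fin 2) (f : Fin n → M) :
    ∑ i ∈ D.inArm w, f i = ∑ k, ∑ i ∈ D.inCell k w, f i := by
  rw [← Finset.sum_fiberwise (D.inArm w) D.study f]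
  refine Finset.sum_congr rfl fun k _ => Finset.sum_congr ?_ fun _ _ => rfl
  ext i
  simp [inArm, inCell, and_comm]

theorem study_of_mem_inCell {k : Fin K} {w : Fin 2} {i : Fin n} (hi : i ∈ D.inCell k w) :
    D.study i = k := by
  simp only [inCell, Finset.mem_filter] at hi
  exact hi.2.1

theorem gram_inArm (w : Fin 2) : D.gram (D.inArm w) = ∑ k, D.gram (D.inCell k w) :=
  D.sum_inArm w _

theorem moment_inArm (w : Fin 2) : D.moment (D.inArm w) = ∑ k, D.moment (D.inCell k w) :=
  D.sum_inArm w _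

theorem card_inArm (w : Fin 2) :
    ((D.inArm w).card : ℝ) = ∑ k, ((D.inCell k w).card : ℝ) := by
  simpa using D.sum_inArm w (fun _ => (1 : ℝ))

variable {D}

theorem sum_card_inCell_div_card_inArm {w : Fin 2} (hw : (D.inArm w).Nonempty) :
    ∑ k, ((D.inCell k w).card : ℝ) / (D.inArm w).card = 1 := by
  rw [← Finset.sum_div, ← card_inArm, div_self (Nat.cast_ne_zero.2 hw.card_ne_zero)]

variable (D)

/-- The coefficient vectors of the federated least squares estimates: as a linear form in the
outcomes, the estimate in direction `v` gives unit `i` of study `k` in arm `w` the coefficient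
`weight agg w k v ⬝ᵥ augment (x i)`. -/
noncomputable def weight : Federation → Fin 2 → Fin K → (Fin (d + 1) → ℝ) → Fin (d + 1) → ℝ
  | .SW, w, k, v => (((D.inCell k w).card : ℝ) / (D.inArm w).card) • (D.gram (D.inCell k w))⁻¹ *ᵥ v
  | .IVW, w, _, v => (D.gram (D.inArm w))⁻¹ *ᵥ v

theorem moment_eq_gram_mulVec_add (s : Finset (Fin n)) (t : Fin (d + 1) → ℝ) :
    D.moment s = D.gram s *ᵥ t + ∑ i ∈ s, (D.y i - augment (D.x i) ⬝ᵥ t) • augment (D.x i) := by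
  simp_rw [gram_mulVec, ← Finset.sum_add_distrib, ← add_smul, add_sub_cancel, moment]

variable {D}

theorem gram_mulVec_ols {s : Finset (Fin n)} (hs : IsUnit (D.gram s).det) :
    D.gram s *ᵥ D.ols s = D.moment s :=
  mulVec_inv_mulVec hs _

theorem dotProduct_ols {s : Finset (Fin n)} (hs : IsUnit (D.gram s).det)
    (v t : Fin (d + 1) → ℝ) :
    v ⬝ᵥ D.ols s = v ⬝ᵥ t + ∑ i ∈ s, (((D.gram s)⁻¹ *ᵥ v) ⬝ᵥ augment (D.x i)) *
      (D.y i - augment (D.x i) ⬝ᵥ t) := by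
  rw [ols, D.moment_eq_gram_mulVec_add s t, mulVec_add, inv_mulVec_mulVec hs, dotProduct_add,
    ← inv_mulVec_dotProduct_of_isSymm (D.gram_isSymm s), dotProduct_sum]
  congr! 2 with i
  rw [dotProduct_smul, smul_eq_mul, mul_comm]

theorem inv_localCov {σ : ℝ} {k : Fin K} {w : Fin 2} (h : IsUnit (D.gram (D.inCell k w)).det) :
    (D.localCov σ k w)⁻¹ = (σ ^ 2)⁻¹ • D.gram (D.inCell k w) := by
  rw [localCov, inv_smul_matrix, nonsing_inv_nonsing_inv _ h]

namespace LocalFullRank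

theorem posDef_inCell (h : D.LocalFullRank) (k : Fin K) (w : Fin 2) :
    (D.gram (D.inCell k w)).PosDef :=
  posDef_of_posSemidef_of_rank_eq_card (D.gram_posSemidef _) (by simpa using h k w)

theorem isUnit_det_inCell (h : D.LocalFullRank) (k : Fin K) (w : Fin 2) :
    IsUnit (D.gram (D.inCell k w)).det :=
  isUnit_det_of_posDef (h.posDef_inCell k w)

theorem inCell_nonempty (h : D.LocalFullRank) (k : Fin K) (w : Fin 2) :
    (D.inCell k w).Nonempty := by
  rw [Finset.nonempty_iff_ne_empty]
  intro h_empty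
  have h_rank := h k w
  simp [h_empty, gram] at h_rank

theorem thetaOneShot_IVW (h : D.LocalFullRank) {σ : ℝ} (hσ : σ ≠ 0) (w : Fin 2) :
    D.thetaOneShot σ .IVW w = D.thetaPool w := by
  have h_cell (k : Fin K) : (D.localCov σ k w)⁻¹ *ᵥ D.thetaLocal k w =
      (σ ^ 2)⁻¹ • D.moment (D.inCell k w) := by
    rw [inv_localCov (h.isUnit_det_inCell k w), smul_mulVec, thetaLocal,
      gram_mulVec_ols (h.isUnit_det_inCell k w)]
  have h_cov : (∑ k, (D.localCov σ k w)⁻¹)⁻¹ = σ ^ 2 • (D.gram (D.inArm w))⁻¹ := by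
    simp_rw [inv_localCov (h.isUnit_det_inCell _ w), ← Finset.smul_sum, ← gram_inArm,
      inv_smul_matrix, inv_inv]
  rw [thetaOneShot, h_cov, Finset.sum_congr rfl fun k _ => h_cell k, ← Finset.smul_sum,
    ← moment_inArm, smul_mulVec, mulVec_smul, smul_inv_smul₀ (pow_ne_zero 2 hσ), thetaPool, ols]

variable [NeZero K]

theorem posDef_inArm (h : D.LocalFullRank) (w : Fin 2) : (D.gram (D.inArm w)).PosDef := by
  rw [gram_inArm]
  exact posDef_sum Finset.univ_nonempty fun k _ => h.posDef_inCell k w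

theorem isUnit_det_inArm (h : D.LocalFullRank) (w : Fin 2) : IsUnit (D.gram (D.inArm w)).det :=
  isUnit_det_of_posDef (h.posDef_inArm w)

theorem inArm_nonempty (h : D.LocalFullRank) (w : Fin 2) : (D.inArm w).Nonempty :=
  (h.inCell_nonempty 0 w).mono fun i hi => by
    simp only [inCell, inArm, Finset.mem_filter] at hi ⊢
    exact ⟨hi.1, hi.2.2⟩

theorem dotProduct_thetaOneShot (h : D.LocalFullRank) {σ : ℝ} (hσ : σ ≠ 0) (agg : Federation)
    (w : Fin 2) (v t : Fin (d + 1) → ℝ) :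
    v ⬝ᵥ D.thetaOneShot σ agg w = v ⬝ᵥ t + ∑ i ∈ D.inArm w,
      (D.weight agg w (D.study i) v ⬝ᵥ augment (D.x i)) * (D.y i - augment (D.x i) ⬝ᵥ t) := by
  cases agg with
  | IVW =>
    rw [h.thetaOneShot_IVW hσ]
    exact dotProduct_ols (h.isUnit_det_inArm w) v t
  | SW =>
    have h_cell (k : Fin K) :
        v ⬝ᵥ (((D.inCell k w).card : ℝ) / (D.inArm w).card) • D.thetaLocal k w =
          ((D.inCell k w).card : ℝ) / (D.inArm w).card * v ⬝ᵥ t + ∑ i ∈ D.inCell k w,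
            (D.weight .SW w (D.study i) v ⬝ᵥ augment (D.x i)) *
              (D.y i - augment (D.x i) ⬝ᵥ t) := by
      rw [dotProduct_smul, thetaLocal, dotProduct_ols (h.isUnit_det_inCell k w) v t, smul_eq_mul,
        mul_add, Finset.mul_sum]
      congr 1
      refine Finset.sum_congr rfl fun i hi => ?_
      rw [weight, D.study_of_mem_inCell hi, smul_dotProduct, smul_eq_mul, mul_assoc]
    rw [thetaOneShot, dotProduct_sum, Finset.sum_congr rfl fun k _ => h_cell k,
      Finset.sum_add_distrib, ← Finset.sum_mul,
      sum_card_inCell_div_card_inArm (h.inArm_nonempty w), one_mul, sum_inArm]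

end LocalFullRank

variable (D)

theorem sum_sq_weight (agg : Federation) (w : Fin 2) (v : Fin (d + 1) → ℝ) :
    ∑ i ∈ D.inArm w, (D.weight agg w (D.study i) v ⬝ᵥ augment (D.x i)) ^ 2 =
      ∑ k, D.weight agg w k v ⬝ᵥ D.gram (D.inCell k w) *ᵥ D.weight agg w k v := by
  rw [sum_inArm]
  refine Finset.sum_congr rfl fun k _ => ?_
  rw [dotProduct_gram_mulVec]
  refine Finset.sum_congr rfl fun i hi => ?_
  rw [D.study_of_mem_inCell hi, sq]

variable {D}

theorem LocalFullRank.sum_gram_mulVec_weight [NeZero K] (h : D.LocalFullRank) (agg : Federation)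
    (w : Fin 2) (v : Fin (d + 1) → ℝ) :
    ∑ k, D.gram (D.inCell k w) *ᵥ D.weight agg w k v = v := by
  cases agg with
  | IVW =>
    simp only [weight]
    rw [← sum_mulVec, ← gram_inArm, mulVec_inv_mulVec (h.isUnit_det_inArm w)]
  | SW =>
    simp only [weight, mulVec_smul, mulVec_inv_mulVec (h.isUnit_det_inCell _ w)]
    rw [← Finset.sum_smul, sum_card_inCell_div_card_inArm (h.inArm_nonempty w), one_smul]

theorem LocalFullRank.sum_sq_weight_IVW_le [NeZero K] (h : D.LocalFullRank) (agg : Federation)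
    (w : Fin 2) (v : Fin (d + 1) → ℝ) :
    ∑ i ∈ D.inArm w, (D.weight .IVW w (D.study i) v ⬝ᵥ augment (D.x i)) ^ 2 ≤
      ∑ i ∈ D.inArm w, (D.weight agg w (D.study i) v ⬝ᵥ augment (D.x i)) ^ 2 := by
  rw [sum_sq_weight, sum_sq_weight]
  refine sum_dotProduct_mulVec_le_of_sum_mulVec_eq (u := (D.gram (D.inArm w))⁻¹ *ᵥ v)
    (fun k => D.gram_posSemidef _) ?_
  rw [h.sum_gram_mulVec_weight, ← gram_inArm, mulVec_inv_mulVec (h.isUnit_det_inArm w)]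

theorem sum_smul_localUpdate_one {w : Fin 2} (hw : (D.inArm w).Nonempty) (η : ℝ)
    (t : Fin (d + 1) → ℝ) :
    ∑ k, (((D.inCell k w).card : ℝ) / (D.inArm w).card) • D.localUpdate η 1 (D.inCell k w) t =
      t - η • D.mseGrad (D.inArm w) t := by
  have h_cell (k : Fin K) :
      (((D.inCell k w).card : ℝ) / (D.inArm w).card) • D.mseGrad (D.inCell k w) t =
        -((2 / ((D.inArm w).card : ℝ)) •
          (D.moment (D.inCell k w) - D.gram (D.inCell k w) *ᵥ t)) := by
    rcases (D.inCell k w).eq_empty_or_nonempty with h_empty | h_nonempty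
    · simp [h_empty, gram, moment]
    · have h_card : ((D.inCell k w).card : ℝ) ≠ 0 := Nat.cast_ne_zero.2 h_nonempty.card_ne_zero
      rw [mseGrad, smul_neg, smul_smul, div_mul_div_comm, mul_comm ((D.inCell k w).card : ℝ),
        mul_div_mul_right _ _ h_card]
  simp_rw [localUpdate, Function.iterate_one, smul_sub, smul_comm _ η, h_cell,
    Finset.sum_sub_distrib, ← Finset.sum_smul, sum_card_inCell_div_card_inArm hw, one_smul,
    ← Finset.smul_sum, Finset.sum_neg_distrib, ← Finset.smul_sum, Finset.sum_sub_distrib,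
    ← moment_inArm, ← sum_mulVec, ← gram_inArm, mseGrad]

theorem mseGrad_eq {s : Finset (Fin n)} (hs : IsUnit (D.gram s).det) (t : Fin (d + 1) → ℝ) :
    D.mseGrad s t = ((2 / (s.card : ℝ)) • D.gram s) *ᵥ (t - D.ols s) := by
  rw [mseGrad, ← gram_mulVec_ols hs, ← mulVec_sub, ← smul_neg, ← mulVec_neg, neg_sub, smul_mulVec]

theorem LocalFullRank.thetaGD_eq [NeZero K] (h : D.LocalFullRank) {η : Fin 2 → ℝ} {w : Fin 2}
    (hη : D.IsLearningRate w (η w)) (θ₀ : Fin (d + 1) → ℝ) :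
    D.thetaGD η θ₀ w = D.thetaPool w := by
  set A := (2 / ((D.inArm w).card : ℝ)) • D.gram (D.inArm w) with hA
  have hA_posDef : A.PosDef := (h.posDef_inArm w).smul
    (div_pos two_pos (Nat.cast_pos.2 (h.inArm_nonempty w).card_pos))
  have h_fedAvg (N : ℕ) : D.fedAvg w (η w) 1 θ₀ N = D.thetaPool w +
      (fun t => t - η w • A *ᵥ t)^[N] (θ₀ - D.thetaPool w) := by
    induction N with
    | zero => simp [fedAvg]
    | succ N ih =>
      rw [fedAvg, Function.iterate_succ_apply', ← fedAvg, ih,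
        sum_smul_localUpdate_one (h.inArm_nonempty w), mseGrad_eq (h.isUnit_det_inArm w), ← hA,
        Function.iterate_succ_apply', thetaPool, add_sub_cancel_left, add_sub_assoc]
  refine Tendsto.limUnder_eq ?_
  rw [funext h_fedAvg]
  simpa only [add_zero] using
    (tendsto_iterate_sub_smul_mulVec hA_posDef hη.1 hη.2 (θ₀ - D.thetaPool w)).const_add
      (D.thetaPool w)

variable (D)

theorem card_mul_tauStudy (t : Fin 2 → Fin (d + 1) → ℝ) (k : Fin K) :
    ((D.inStudy k).card : ℝ) * D.tauStudy t k =
      ∑ i ∈ D.inStudy k, augment (D.x i) ⬝ᵥ (t 1 - t 0) := by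
  simp_rw [tauStudy, dotProduct_sub]
  rcases (D.inStudy k).eq_empty_or_nonempty with h_empty | h_nonempty
  · simp [h_empty]
  · rw [one_div, mul_inv_cancel_left₀ (Nat.cast_ne_zero.2 h_nonempty.card_ne_zero)]

theorem tauFed_eq (t : Fin 2 → Fin (d + 1) → ℝ) :
    D.tauFed t = 1 / (n : ℝ) * ∑ i, augment (D.x i) ⬝ᵥ (t 1 - t 0) := by
  rw [one_div_mul_eq_div]
  simp_rw [tauFed, div_mul_eq_mul_div, card_mul_tauStudy]
  rw [← Finset.sum_div, ← Finset.sum_fiberwise Finset.univ D.study]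
  rfl

theorem tauPool_eq : D.tauPool = D.tauFed D.thetaPool := by
  simp_rw [tauFed_eq, tauPool, dotProduct_sub]

end Sample

/-! ### Measurability of the estimators -/

section MatrixMeasurability

variable {Ω m : Type*} [MeasurableSpace Ω] [Fintype m]

theorem measurable_dotProduct {R : Type*} [NonUnitalNonAssocSemiring R] [MeasurableSpace R]
    [MeasurableAdd₂ R] [MeasurableMul₂ R] {u v : Ω → m → R} (hu : Measurable u)
    (hv : Measurable v) : Measurable fun ω => u ω ⬝ᵥ v ω :=
  Finset.measurable_fun_sum _ fun i _ => (hu.eval (a := i)).mul hv.eval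

theorem measurable_matrix_mulVec {R : Type*} [NonUnitalNonAssocSemiring R] [MeasurableSpace R]
    [MeasurableAdd₂ R] [MeasurableMul₂ R] {A : Ω → Matrix m m R} {v : Ω → m → R}
    (hA : ∀ i j, Measurable fun ω => A ω i j) (hv : Measurable v) :
    Measurable fun ω => A ω *ᵥ v ω :=
  measurable_pi_lambda _ fun i => measurable_dotProduct (measurable_pi_lambda _ (hA i)) hv

variable [DecidableEq m]

theorem measurable_matrix_det {R : Type*} [CommRing R] [MeasurableSpace R] [MeasurableAdd₂ R]
    [MeasurableMul₂ R] {A : Ω → Matrix m m R} (hA : ∀ i j, Measurable fun ω => A ω i j) :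
    Measurable fun ω => (A ω).det := by
  simp_rw [det_apply']
  exact Finset.measurable_fun_sum _ fun p _ =>
    (Finset.measurable_fun_prod _ fun i _ => hA _ _).const_mul _

theorem measurable_matrix_inv_apply {F : Type*} [Field F] [MeasurableSpace F] [MeasurableAdd₂ F]
    [MeasurableMul₂ F] [MeasurableInv F] {A : Ω → Matrix m m F}
    (hA : ∀ i j, Measurable fun ω => A ω i j) (i j : m) : Measurable fun ω => (A ω)⁻¹ i j := by
  simp_rw [inv_def, Ring.inverse_eq_inv', Matrix.smul_apply, adjugate_apply]
  refine (measurable_matrix_det hA).inv.smul (measurable_matrix_det fun a b => ?_)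
  by_cases h : a = j
  · subst h
    simp
  · simpa [updateRow_ne h] using hA a b

end MatrixMeasurability

theorem measurable_apply_apply_of_countable {Ω α β : Type*} [MeasurableSpace Ω]
    [MeasurableSpace α] [Countable α] [MeasurableSingletonClass α] [MeasurableSpace β]
    {f : α → Ω → β} {g : Ω → α} (hf : ∀ a, Measurable (f a)) (hg : Measurable g) :
    Measurable fun ω => f (g ω) ω :=
  (measurable_from_prod_countable_right (f := fun p : α × Ω => f p.1 p.2) hf).comp
    (hg.prodMk measurable_id)

theorem measurable_augment {d : ℕ} : Measurable (augment : (Fin d → ℝ) → Fin (d + 1) → ℝ) := by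
  refine measurable_pi_lambda _ (Fin.cases ?_ fun j => ?_)
  · simp [augment]
  · simpa [augment] using measurable_pi_apply j

/-- Random samples whose covariates, arms and studies are measurable. The outcomes are left out, so
that the notion applies with the σ-algebra generated by the design. -/
structure MeasurableDesign {Ω : Type*} [MeasurableSpace Ω] {n d K : ℕ} (D : Ω → Sample n d K) :
    Prop where
  x : ∀ i, Measurable fun ω => (D ω).x i
  arm : ∀ i, Measurable fun ω => (D ω).arm i
  study : ∀ i, Measurable fun ω => (D ω).study i

namespace MeasurableDesign

variable {Ω : Type*} [MeasurableSpace Ω] {n d K : ℕ} {D : Ω → Sample n d K}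

theorem measurable_sum_inCell (hD : MeasurableDesign D) {M : Type*} [AddCommMonoid M]
    [MeasurableSpace M] [MeasurableAdd₂ M] (k : Fin K) (w : Fin 2) {f : Fin n → Ω → M}
    (hf : ∀ i, Measurable (f i)) : Measurable fun ω => ∑ i ∈ (D ω).inCell k w, f i ω := by
  simp_rw [Sample.inCell, Finset.sum_filter]
  refine Finset.measurable_fun_sum _ fun i _ => Measurable.ite ?_ (hf i) measurable_const
  exact (hD.study i (measurableSet_singleton k)).inter (hD.arm i (measurableSet_singleton w))

theorem measurable_sum_inArm (hD : MeasurableDesign D) {M : Type*} [AddCommMonoid M]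
    [MeasurableSpace M] [MeasurableAdd₂ M] (w : Fin 2) {f : Fin n → Ω → M}
    (hf : ∀ i, Measurable (f i)) : Measurable fun ω => ∑ i ∈ (D ω).inArm w, f i ω := by
  simp_rw [Sample.sum_inArm]
  exact Finset.measurable_fun_sum _ fun k _ => hD.measurable_sum_inCell k w hf

theorem measurable_card_inCell (hD : MeasurableDesign D) (k : Fin K) (w : Fin 2) :
    Measurable fun ω => (((D ω).inCell k w).card : ℝ) := by
  simpa using hD.measurable_sum_inCell k w (f := fun _ _ => (1 : ℝ)) fun _ => measurable_const

theorem measurable_card_inArm (hD : MeasurableDesign D) (w : Fin 2) :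
    Measurable fun ω => (((D ω).inArm w).card : ℝ) := by
  simpa using hD.measurable_sum_inArm w (f := fun _ _ => (1 : ℝ)) fun _ => measurable_const

theorem measurable_augment_x (hD : MeasurableDesign D) (i : Fin n) :
    Measurable fun ω => augment ((D ω).x i) :=
  measurable_augment.comp (hD.x i)

theorem measurable_gram_inCell_apply (hD : MeasurableDesign D) (k : Fin K) (w : Fin 2)
    (a b : Fin (d + 1)) : Measurable fun ω => (D ω).gram ((D ω).inCell k w) a b := by
  simp_rw [Sample.gram, Matrix.sum_apply, vecMulVec_apply]
  exact hD.measurable_sum_inCell k w fun i =>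
    (hD.measurable_augment_x i).eval.mul (hD.measurable_augment_x i).eval

theorem measurable_gram_inArm_apply (hD : MeasurableDesign D) (w : Fin 2)
    (a b : Fin (d + 1)) : Measurable fun ω => (D ω).gram ((D ω).inArm w) a b := by
  simp_rw [Sample.gram_inArm, Matrix.sum_apply]
  exact Finset.measurable_fun_sum _ fun k _ => hD.measurable_gram_inCell_apply k w a b

theorem measurable_weight (hD : MeasurableDesign D) (agg : Federation) (w : Fin 2) (k : Fin K)
    {v : Ω → Fin (d + 1) → ℝ} (hv : Measurable v) :
    Measurable fun ω => (D ω).weight agg w k (v ω) := by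
  cases agg with
  | SW =>
    exact ((hD.measurable_card_inCell k w).div (hD.measurable_card_inArm w)).smul
      (measurable_matrix_mulVec
        (measurable_matrix_inv_apply (hD.measurable_gram_inCell_apply k w)) hv)
  | IVW =>
    exact measurable_matrix_mulVec
      (measurable_matrix_inv_apply (hD.measurable_gram_inArm_apply w)) hv

theorem measurable_weight_study (hD : MeasurableDesign D) (agg : Federation) (w : Fin 2)
    (i : Fin n) {v : Ω → Fin (d + 1) → ℝ} (hv : Measurable v) :
    Measurable fun ω => (D ω).weight agg w ((D ω).study i) (v ω) :=
  measurable_apply_apply_of_countable (fun k => hD.measurable_weight agg w k hv) (hD.study i)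

theorem measurable_moment_inCell (hD : MeasurableDesign D)
    (hy : ∀ i, Measurable fun ω => (D ω).y i) (k : Fin K) (w : Fin 2) :
    Measurable fun ω => (D ω).moment ((D ω).inCell k w) :=
  hD.measurable_sum_inCell k w fun i => (hy i).smul (hD.measurable_augment_x i)

theorem measurable_thetaLocal (hD : MeasurableDesign D) (hy : ∀ i, Measurable fun ω => (D ω).y i)
    (k : Fin K) (w : Fin 2) : Measurable fun ω => (D ω).thetaLocal k w :=
  measurable_matrix_mulVec (measurable_matrix_inv_apply (hD.measurable_gram_inCell_apply k w))
    (hD.measurable_moment_inCell hy k w)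

theorem measurable_thetaPool (hD : MeasurableDesign D) (hy : ∀ i, Measurable fun ω => (D ω).y i)
    (w : Fin 2) : Measurable fun ω => (D ω).thetaPool w :=
  measurable_matrix_mulVec (measurable_matrix_inv_apply (hD.measurable_gram_inArm_apply w))
    (hD.measurable_sum_inArm w fun i => (hy i).smul (hD.measurable_augment_x i))

theorem measurable_thetaOneShot (hD : MeasurableDesign D)
    (hy : ∀ i, Measurable fun ω => (D ω).y i) (σ : ℝ) (agg : Federation) (w : Fin 2) :
    Measurable fun ω => (D ω).thetaOneShot σ agg w := by
  cases agg with
  | SW =>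
    exact Finset.measurable_fun_sum _ fun k _ =>
      ((hD.measurable_card_inCell k w).div (hD.measurable_card_inArm w)).smul
        (hD.measurable_thetaLocal hy k w)
  | IVW =>
    have h_precision (k : Fin K) (a b : Fin (d + 1)) :
        Measurable fun ω => ((D ω).localCov σ k w)⁻¹ a b :=
      measurable_matrix_inv_apply (fun a b => (measurable_matrix_inv_apply
        (hD.measurable_gram_inCell_apply k w) a b).const_smul (σ ^ 2)) a b
    refine measurable_matrix_mulVec (measurable_matrix_inv_apply fun a b => ?_) ?_
    · simp_rw [Matrix.sum_apply]
      exact Finset.measurable_fun_sum _ fun k _ => h_precision k a b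
    · exact Finset.measurable_fun_sum _ fun k _ =>
        measurable_matrix_mulVec (h_precision k) (hD.measurable_thetaLocal hy k w)

theorem measurable_thetaGD (hD : MeasurableDesign D) (hy : ∀ i, Measurable fun ω => (D ω).y i)
    {η : Ω → Fin 2 → ℝ} (hη : Measurable η) (θ₀ : Fin (d + 1) → ℝ) (w : Fin 2) :
    Measurable fun ω => (D ω).thetaGD (η ω) θ₀ w := by
  refine (StronglyMeasurable.limUnder fun N => Measurable.stronglyMeasurable ?_).measurable
  induction N with
  | zero => exact measurable_const
  | succ N ih =>
    simp_rw [Sample.fedAvg, Function.iterate_succ_apply'] at ih ⊢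
    refine Finset.measurable_fun_sum _ fun k _ =>
      ((hD.measurable_card_inCell k w).div (hD.measurable_card_inArm w)).smul ?_
    simp_rw [Sample.localUpdate, Function.iterate_one, Sample.mseGrad]
    have h_gram := measurable_matrix_mulVec (hD.measurable_gram_inCell_apply k w) ih
    exact ih.sub (hη.eval.smul ((measurable_const.div (hD.measurable_card_inCell k w)).smul
      ((hD.measurable_moment_inCell hy k w).sub h_gram)).neg)

theorem measurable_tauFed (hD : MeasurableDesign D) {t : Ω → Fin 2 → Fin (d + 1) → ℝ}
    (ht : ∀ w, Measurable fun ω => t ω w) : Measurable fun ω => (D ω).tauFed (t ω) := by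
  simp_rw [Sample.tauFed_eq]
  exact (Finset.measurable_fun_sum _ fun i _ =>
    measurable_dotProduct (hD.measurable_augment_x i) ((ht 1).sub (ht 0))).const_mul _

end MeasurableDesign

namespace Trial

variable {Ω : Type*} {d K : ℕ} {T : Trial Ω d K}

theorem measurableDesign_sample_design (n : ℕ) :
    @MeasurableDesign Ω (T.design n) n d K (T.sample n) := by
  let : MeasurableSpace Ω := T.design n
  have h_unit (i : Fin n) : Measurable fun ω => (T.X i ω, T.W i ω, T.H i ω) :=
    (measurable_pi_apply i).comp
      (comap_measurable fun ω (i : Fin n) => (T.X i ω, T.W i ω, T.H i ω))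
  exact ⟨fun i => (h_unit i).fst, fun i => (h_unit i).snd.fst, fun i => (h_unit i).snd.snd⟩

namespace IsCovariateShiftRCT

variable [MeasurableSpace Ω] {P : Measure Ω} {θ : Fin 2 → Fin (d + 1) → ℝ} {σ : ℝ}

theorem measurableDesign_sample (hT : T.IsCovariateShiftRCT P θ σ) (n : ℕ) :
    MeasurableDesign (T.sample n) :=
  ⟨fun i => hT.measurable_X i, fun i => hT.measurable_W i, fun i => hT.measurable_H i⟩

theorem measurable_observed (hT : T.IsCovariateShiftRCT P θ σ) (i : ℕ) :
    Measurable fun ω => T.Y i (T.W i ω) ω :=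
  measurable_apply_apply_of_countable (hT.measurable_Y i) (hT.measurable_W i)

theorem design_le (hT : T.IsCovariateShiftRCT P θ σ) (n : ℕ) : T.design n ≤ ‹MeasurableSpace Ω› :=
  (measurable_pi_lambda (fun ω (i : Fin n) => (T.X i ω, T.W i ω, T.H i ω)) fun i =>
    (hT.measurable_X i).prodMk ((hT.measurable_W i).prodMk (hT.measurable_H i))).comap_le

end IsCovariateShiftRCT

end Trial

/-! ### Conditioning and white noise -/

section Conditioning

variable {Ω : Type*} {mΩ : MeasurableSpace Ω} {P : Measure Ω} {S : Set Ω}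

theorem integrable_cond_of_ne_zero {f : Ω → ℝ} (hf : Integrable f P) (hS : P S ≠ 0) :
    Integrable f P[|S] :=
  hf.restrict.smul_measure (ENNReal.inv_ne_top.2 hS)

theorem integral_cond (f : Ω → ℝ) : ∫ ω, f ω ∂P[|S] = (P.real S)⁻¹ * ∫ ω in S, f ω ∂P := by
  rw [ProbabilityTheory.cond, integral_smul_measure, smul_eq_mul, ENNReal.toReal_inv]
  rfl

variable {m : MeasurableSpace Ω} [IsFiniteMeasure P] {f : Ω → ℝ} {c : ℝ}

theorem condExp_ae_eq_const_of_setIntegral_eq (hm : m ≤ mΩ) (hf : Integrable f P)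
    (h : ∀ A, MeasurableSet[m] A → ∫ ω in A, f ω ∂P = P.real A * c) :
    P[f | m] =ᵐ[P] fun _ => c := by
  refine (ae_eq_condExp_of_forall_setIntegral_eq hm hf (fun _ _ _ => integrableOn_const)
    (fun A hA _ => ?_) aestronglyMeasurable_const).symm
  rw [h A hA, setIntegral_const, smul_eq_mul]

theorem setIntegral_eq_of_condExp_ae_eq_const (hm : m ≤ mΩ) (hf : Integrable f P)
    (hc : P[f | m] =ᵐ[P] fun _ => c) {A : Set Ω} (hA : MeasurableSet[m] A) :
    ∫ ω in A, f ω ∂P = P.real A * c := by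
  rw [← setIntegral_condExp hm hf hA, setIntegral_congr_ae (hm A hA) (hc.mono fun ω h _ => h),
    setIntegral_const, smul_eq_mul]

theorem condExp_cond_ae_eq_const (hm : m ≤ mΩ) (hf : Integrable f P)
    (hc : P[f | m] =ᵐ[P] fun _ => c) (hS : MeasurableSet[m] S) (hS0 : P S ≠ 0) :
    (P[|S])[f | m] =ᵐ[P[|S]] fun _ => c := by
  refine condExp_ae_eq_const_of_setIntegral_eq hm (integrable_cond_of_ne_zero hf hS0)
    fun A hA => ?_
  rw [← integral_indicator (hm A hA), integral_cond, setIntegral_indicator (hm A hA),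
    setIntegral_eq_of_condExp_ae_eq_const hm hf hc (hS.inter hA),
    measureReal_def P[|S], cond_apply (hm S hS), ENNReal.toReal_mul, ENNReal.toReal_inv, mul_assoc]
  rfl

theorem integral_mul_eq_of_condExp_ae_eq_const (hm : m ≤ mΩ) (hf : Integrable f P)
    (hc : P[f | m] =ᵐ[P] fun _ => c) {b : Ω → ℝ} (hb : StronglyMeasurable[m] b)
    (hbf : Integrable (fun ω => b ω * f ω) P) :
    ∫ ω, b ω * f ω ∂P = c * ∫ ω, b ω ∂P := by
  calc ∫ ω, b ω * f ω ∂P = ∫ ω, (P[b * f | m]) ω ∂P := (integral_condExp hm).symm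
    _ = ∫ ω, b ω * c ∂P := integral_congr_ae
      ((condExp_mul_of_stronglyMeasurable_left hb hbf hf).trans (EventuallyEq.rfl.mul hc))
    _ = c * ∫ ω, b ω ∂P := by rw [integral_mul_const, mul_comm]

end Conditioning

section Independence

variable {Ω ι β γ : Type*} {mΩ : MeasurableSpace Ω} [MeasurableSpace β] {P : Measure Ω}

theorem setIntegral_eq_zero_of_forall_preimage_pi [Finite ι] {φ : Ω → ι → β} (hφ : Measurable φ)
    {f : Ω → ℝ} (hf : Integrable f P)
    (h : ∀ B : ι → Set β, (∀ i, MeasurableSet (B i)) → ∫ ω in φ ⁻¹' Set.univ.pi B, f ω ∂P = 0)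
    {A : Set Ω} (hA : MeasurableSet[MeasurableSpace.comap φ inferInstance] A) :
    ∫ ω in A, f ω ∂P = 0 := by
  obtain ⟨A, hA, rfl⟩ := hA
  refine MeasurableSpace.induction_on_inter (C := fun A _ => ∫ ω in φ ⁻¹' A, f ω ∂P = 0)
    generateFrom_pi.symm isPiSystem_pi ?_ ?_ ?_ ?_ A hA
  · rw [Set.preimage_empty, setIntegral_empty]
  · rintro _ ⟨B, hB, rfl⟩
    exact h B fun i => hB i (Set.mem_univ i)
  · intro A hA ih
    have h_univ := h (fun _ => Set.univ) fun _ => MeasurableSet.univ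
    rw [Set.pi_univ, Set.preimage_univ, setIntegral_univ] at h_univ
    rw [Set.preimage_compl, setIntegral_compl (hφ hA) hf, ih, h_univ, sub_zero]
  · intro A hd hA ih
    rw [Set.preimage_iUnion, integral_iUnion (fun i => hφ (hA i))
      (fun i j hij => (hd hij).preimage φ) hf.integrableOn]
    simp only [ih, tsum_zero]

variable [Fintype ι] [MeasurableSpace γ] {Z : ι → Ω → γ} {u : γ → β} {f : ι → γ → ℝ}

theorem setIntegral_prod_comp_eq_zero (hind : iIndepFun Z P) (hZ : ∀ l, Measurable (Z l))
    (hu : Measurable u) (hf : ∀ l, Measurable (f l))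
    (hint : Integrable (fun ω => ∏ l, f l (Z l ω)) P) (i : ι)
    (hi : ∀ B, MeasurableSet B → ∫ ω in Z i ⁻¹' (u ⁻¹' B), f i (Z i ω) ∂P = 0)
    {A : Set Ω} (hA : MeasurableSet[MeasurableSpace.comap (fun ω l => u (Z l ω)) inferInstance] A) :
    ∫ ω in A, ∏ l, f l (Z l ω) ∂P = 0 := by
  have hφ : Measurable fun ω l => u (Z l ω) := measurable_pi_lambda _ fun l => hu.comp (hZ l)
  refine setIntegral_eq_zero_of_forall_preimage_pi hφ hint (fun B hB => ?_) hA
  have h_indicator : ∀ ω, ((fun ω l => u (Z l ω)) ⁻¹' Set.univ.pi B).indicator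
      (fun ω => ∏ l, f l (Z l ω)) ω = ∏ l, (u ⁻¹' B l).indicator (f l) (Z l ω) := by
    intro ω
    by_cases h : ∀ l, u (Z l ω) ∈ B l
    · rw [Set.indicator_of_mem (by simpa using h)]
      exact Finset.prod_congr rfl fun l _ => (Set.indicator_of_mem (s := u ⁻¹' B l) (h l) _).symm
    · obtain ⟨l, hl⟩ := not_forall.1 h
      rw [Set.indicator_of_notMem (by simpa using h), Finset.prod_eq_zero (Finset.mem_univ l)
        (Set.indicator_of_notMem (s := u ⁻¹' B l) hl _)]
  rw [← integral_indicator (hφ (MeasurableSet.univ_pi hB)), integral_congr_ae (ae_of_all _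
      h_indicator), hind.integral_fun_prod_comp (fun l => (hZ l).aemeasurable)
    fun l => ((hf l).indicator (hu (hB l))).aestronglyMeasurable]
  refine Finset.prod_eq_zero (Finset.mem_univ i) ?_
  rw [← hi (B i) (hB i), ← integral_indicator (hZ i (hu (hB i)))]
  rfl

end Independence

section Fibers

variable {Ω α : Type*} {mΩ : MeasurableSpace Ω} {P : Measure Ω} {Z : Ω → α} {f : Ω → ℝ}

theorem integrable_of_forall_integrableOn_fiber [Finite α]
    (h : ∀ a, IntegrableOn f (Z ⁻¹' {a}) P) : Integrable f P := by
  rw [← integrableOn_univ, ← Set.preimage_univ (f := Z), ← Set.iUnion_of_singleton,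
    Set.preimage_iUnion, integrableOn_finite_iUnion]
  exact h

theorem setIntegral_eq_zero_of_forall_fiber [Countable α] [MeasurableSpace α]
    [MeasurableSingletonClass α] (hZ : Measurable Z) {A : Set Ω} (hA : MeasurableSet A)
    (hf : IntegrableOn f A P) (h : ∀ a, ∫ ω in A ∩ Z ⁻¹' {a}, f ω ∂P = 0) :
    ∫ ω in A, f ω ∂P = 0 := by
  have h_iUnion : A = ⋃ a, A ∩ Z ⁻¹' {a} := by
    rw [← Set.inter_iUnion, ← Set.preimage_iUnion, Set.iUnion_of_singleton, Set.preimage_univ,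
      Set.inter_univ]
  have h_disjoint : Pairwise (Function.onFun Disjoint fun a => A ∩ Z ⁻¹' {a}) := fun a b hab =>
    ((Set.disjoint_singleton.2 hab).preimage Z).mono Set.inter_subset_right Set.inter_subset_right
  rw [h_iUnion] at hf ⊢
  rw [integral_iUnion (fun a => hA.inter (hZ (measurableSet_singleton a))) h_disjoint hf]
  simp only [h, tsum_zero]

end Fibers

/-- Conditionally on `m`, the square integrable `e i` are centred and uncorrelated with variance
`σ²`: the error assumption under which generalized least squares is optimal. -/
structure IsWhiteNoise {Ω ι : Type*} (m : MeasurableSpace Ω)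
    {mΩ : MeasurableSpace Ω} (P : Measure Ω) (e : ι → Ω → ℝ) (σ : ℝ) : Prop where
  memLp : ∀ i, MemLp (e i) 2 P
  condExp_eq_zero : ∀ i, P[e i | m] =ᵐ[P] fun _ => 0
  condExp_mul : ∀ i j, i ≠ j → P[fun ω => e i ω * e j ω | m] =ᵐ[P] fun _ => 0
  condExp_sq : ∀ i, P[fun ω => e i ω ^ 2 | m] =ᵐ[P] fun _ => σ ^ 2

theorem exists_truncation {Ω ι : Type*} [Finite ι] {m : MeasurableSpace Ω} {c : ι → Ω → ℝ}
    (hc : ∀ i, Measurable (c i)) :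
    ∃ A : ℕ → Set Ω, (∀ N, MeasurableSet (A N)) ∧ Monotone A ∧ ⋃ N, A N = Set.univ ∧
      ∀ N i ω, |(A N).indicator (c i) ω| ≤ N := by
  have := Fintype.ofFinite ι
  refine ⟨fun N => {ω | ∑ i, |c i ω| ≤ N}, fun N => ?_, fun N M hNM ω h => ?_, ?_, ?_⟩
  · exact measurableSet_le (Finset.measurable_fun_sum _ fun i _ => (hc i).abs) measurable_const
  · exact le_trans (Set.mem_ofPred_eq.mp h) (Nat.cast_le.2 hNM)
  · exact Set.iUnion_eq_univ_iff.2 fun ω => exists_nat_ge (∑ i, |c i ω|)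
  · intro N i ω
    by_cases h : ω ∈ {ω | ∑ i, |c i ω| ≤ N}
    · rw [Set.indicator_of_mem h]
      exact (Finset.single_le_sum (f := fun i => |c i ω|) (fun j _ => abs_nonneg _)
        (Finset.mem_univ i)).trans h
    · rw [Set.indicator_of_notMem h, abs_zero]
      exact Nat.cast_nonneg N

namespace IsWhiteNoise

variable {Ω ι : Type*} {m mΩ : MeasurableSpace Ω} {P : Measure Ω} {e : ι → Ω → ℝ}
  {σ : ℝ}

theorem cond [IsFiniteMeasure P] (he : IsWhiteNoise m P e σ) (hm : m ≤ mΩ) {S : Set Ω}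
    (hS : MeasurableSet[m] S) (hS0 : P S ≠ 0) : IsWhiteNoise m P[|S] e σ where
  memLp i := ((he.memLp i).restrict S).smul_measure (ENNReal.inv_ne_top.2 hS0)
  condExp_eq_zero i := condExp_cond_ae_eq_const hm ((he.memLp i).integrable one_le_two)
    (he.condExp_eq_zero i) hS hS0
  condExp_mul i j hij := condExp_cond_ae_eq_const hm ((he.memLp i).integrable_mul (he.memLp j))
    (he.condExp_mul i j hij) hS hS0
  condExp_sq i := condExp_cond_ae_eq_const hm (he.memLp i).integrable_sq (he.condExp_sq i) hS hS0

theorem integral_mul_mul_eq_ite [IsFiniteMeasure P] [DecidableEq ι] (he : IsWhiteNoise m P e σ)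
    (hm : m ≤ mΩ) {b : Ω → ℝ} (hb : Measurable[m] b) {i j : ι}
    (hint : Integrable (fun ω => b ω * (e i ω * e j ω)) P) :
    ∫ ω, b ω * (e i ω * e j ω) ∂P = if i = j then σ ^ 2 * ∫ ω, b ω ∂P else 0 := by
  split_ifs with hij
  · subst hij
    simp only [← sq] at hint ⊢
    exact integral_mul_eq_of_condExp_ae_eq_const hm (he.memLp i).integrable_sq
      (he.condExp_sq i) hb.stronglyMeasurable hint
  · rw [← zero_mul (∫ ω, b ω ∂P)]
    exact integral_mul_eq_of_condExp_ae_eq_const hm ((he.memLp i).integrable_mul (he.memLp j))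
      (he.condExp_mul i j hij) hb.stronglyMeasurable hint

variable [Fintype ι] {c : ι → Ω → ℝ} {C : ℝ}

theorem memLp_sum_mul_of_bounded (he : IsWhiteNoise m P e σ) (hm : m ≤ mΩ)
    (hc : ∀ i, Measurable[m] (c i)) (hC : ∀ i ω, |c i ω| ≤ C) :
    MemLp (fun ω => ∑ i, c i ω * e i ω) 2 P :=
  memLp_finsetSum _ fun i _ => (he.memLp i).mul
    (memLp_top_of_bound ((hc i).mono hm le_rfl).aestronglyMeasurable C (ae_of_all _ (hC i)))

variable [IsFiniteMeasure P]

theorem integral_sum_mul_eq_zero_of_bounded (he : IsWhiteNoise m P e σ) (hm : m ≤ mΩ)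
    (hc : ∀ i, Measurable[m] (c i)) (hC : ∀ i ω, |c i ω| ≤ C) :
    ∫ ω, ∑ i, c i ω * e i ω ∂P = 0 := by
  have h_int : ∀ i, Integrable (fun ω => c i ω * e i ω) P := fun i =>
    ((he.memLp i).integrable one_le_two).bdd_mul ((hc i).mono hm le_rfl).aestronglyMeasurable
      (ae_of_all _ (hC i))
  rw [integral_finsetSum _ fun i _ => h_int i]
  refine Finset.sum_eq_zero fun i _ => ?_
  rw [integral_mul_eq_of_condExp_ae_eq_const hm ((he.memLp i).integrable one_le_two)
    (he.condExp_eq_zero i) (hc i).stronglyMeasurable (h_int i), zero_mul]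

theorem integral_sq_sum_mul_of_bounded (he : IsWhiteNoise m P e σ) (hm : m ≤ mΩ)
    (hc : ∀ i, Measurable[m] (c i)) (hC : ∀ i ω, |c i ω| ≤ C) :
    ∫ ω, (∑ i, c i ω * e i ω) ^ 2 ∂P = ∫ ω, σ ^ 2 * ∑ i, c i ω ^ 2 ∂P := by
  classical
  have hcm : ∀ i j, Measurable[m] fun ω => c i ω * c j ω := fun i j => (hc i).mul (hc j)
  have hcC : ∀ i j ω, ‖c i ω * c j ω‖ ≤ C * C := fun i j ω => by
    rw [norm_mul]
    exact mul_le_mul (hC i ω) (hC j ω) (norm_nonneg _) ((abs_nonneg _).trans (hC i ω))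
  have h_int : ∀ i j, Integrable (fun ω => c i ω * c j ω * (e i ω * e j ω)) P := fun i j =>
    ((he.memLp i).integrable_mul (he.memLp j)).bdd_mul
      ((hcm i j).mono hm le_rfl).aestronglyMeasurable (ae_of_all _ (hcC i j))
  have h_int_sq : ∀ i, Integrable (fun ω => c i ω ^ 2) P := fun i =>
    .of_bound (((hc i).mono hm le_rfl).pow_const 2).aestronglyMeasurable (C * C)
      (ae_of_all _ fun ω => by simpa only [sq] using hcC i i ω)
  have h_sq : ∀ ω, (∑ i, c i ω * e i ω) ^ 2 =
      ∑ i, ∑ j, c i ω * c j ω * (e i ω * e j ω) := fun ω => by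
    simp only [sq, Finset.sum_mul_sum, mul_mul_mul_comm]
  simp_rw [h_sq]
  rw [integral_finsetSum _ fun i _ => integrable_finsetSum _ fun j _ => h_int i j,
    integral_const_mul, integral_finsetSum _ fun i _ => h_int_sq i, Finset.mul_sum]
  refine Finset.sum_congr rfl fun i _ => ?_
  rw [integral_finsetSum _ fun j _ => h_int i j]
  simp_rw [he.integral_mul_mul_eq_ite hm (hcm i _) (h_int i _), Finset.sum_ite_eq,
    Finset.mem_univ, if_true, sq]

theorem integral_sum_mul_eq_zero (he : IsWhiteNoise m P e σ) (hm : m ≤ mΩ)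
    (hc : ∀ i, Measurable[m] (c i)) (hint : Integrable (fun ω => ∑ i, c i ω * e i ω) P) :
    ∫ ω, ∑ i, c i ω * e i ω ∂P = 0 := by
  obtain ⟨A, hA, hA_mono, hA_univ, hbd⟩ := exists_truncation hc
  have h_lim := tendsto_setIntegral_of_monotone (fun N => hm _ (hA N)) hA_mono hint.integrableOn
  rw [hA_univ, setIntegral_univ] at h_lim
  refine tendsto_nhds_unique h_lim (tendsto_const_nhds.congr fun N => ?_)
  rw [← he.integral_sum_mul_eq_zero_of_bounded hm
    (fun i => Measurable.indicator (mβ := inferInstance) (hc i) (hA N)) (hbd N),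
    ← integral_indicator (hm _ (hA N))]
  refine integral_congr_ae (ae_of_all _ fun ω => ?_)
  by_cases h : ω ∈ A N <;> simp [h]

theorem lintegral_sq_sum_mul (he : IsWhiteNoise m P e σ) (hm : m ≤ mΩ)
    (hc : ∀ i, Measurable[m] (c i)) :
    ∫⁻ ω, ENNReal.ofReal ((∑ i, c i ω * e i ω) ^ 2) ∂P =
      ∫⁻ ω, ENNReal.ofReal (σ ^ 2 * ∑ i, c i ω ^ 2) ∂P := by
  obtain ⟨A, hA, hA_mono, hA_univ, hbd⟩ := exists_truncation hc
  rw [← setLIntegral_univ, ← hA_univ, setLIntegral_iUnion_of_directed _ hA_mono.directed_le,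
    ← setLIntegral_univ (μ := P) fun ω => ENNReal.ofReal (σ ^ 2 * _), ← hA_univ,
    setLIntegral_iUnion_of_directed _ hA_mono.directed_le]
  refine iSup_congr fun N => ?_
  have hcA : ∀ i, Measurable[m] ((A N).indicator (c i)) := fun i =>
    Measurable.indicator (mβ := inferInstance) (hc i) (hA N)
  have h_int_sq : Integrable (fun ω => σ ^ 2 * ∑ i, (A N).indicator (c i) ω ^ 2) P :=
    (integrable_finsetSum _ fun i _ => (memLp_top_of_bound
      ((hcA i).mono hm le_rfl).aestronglyMeasurable N
      (ae_of_all _ (hbd N i))).mono_exponent le_top |>.integrable_sq).const_mul _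
  have h_trunc := congrArg ENNReal.ofReal (he.integral_sq_sum_mul_of_bounded hm hcA (hbd N))
  rw [ofReal_integral_eq_lintegral_ofReal (he.memLp_sum_mul_of_bounded hm hcA (hbd N)).integrable_sq
      (ae_of_all _ fun ω => sq_nonneg _),
    ofReal_integral_eq_lintegral_ofReal h_int_sq (ae_of_all _ fun ω => by positivity)] at h_trunc
  rw [← lintegral_indicator (hm _ (hA N)), ← lintegral_indicator (hm _ (hA N))]
  convert h_trunc using 2 <;>
  · funext ω
    by_cases h : ω ∈ A N <;> simp [h]

end IsWhiteNoise

/-- The mean is known even when `R` is not integrable, when both sides are infinite. -/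
theorem evariance_eq_lintegral_of_ae_eq_const_add {Ω : Type*} [MeasurableSpace Ω] {P : Measure Ω}
    [IsProbabilityMeasure P] {f R : Ω → ℝ} {c : ℝ} (hf : f =ᵐ[P] fun ω => c + R ω)
    (hR : AEStronglyMeasurable R P) (h0 : Integrable R P → ∫ ω, R ω ∂P = 0) :
    evariance f P = ∫⁻ ω, ENNReal.ofReal (R ω ^ 2) ∂P := by
  rw [evariance_congr hf]
  by_cases hint : Integrable R P
  · have h_mean : ∫ ω, (c + R ω) ∂P = c := by
      rw [integral_add (integrable_const c) hint, h0 hint, add_zero, integral_const, probReal_univ,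
        one_smul]
    rw [evariance, h_mean]
    refine lintegral_congr fun ω => ?_
    rw [add_sub_cancel_left, Real.enorm_eq_ofReal_abs, ← ENNReal.ofReal_pow (abs_nonneg _), sq_abs]
  · have h_add : ¬ MemLp (fun ω => c + R ω) 2 P := fun h => hint <|
      ((h.integrable one_le_two).sub (integrable_const c)).congr
        (ae_of_all _ fun ω => add_sub_cancel_left _ _)
    have h_lt : ¬ ∫⁻ ω, ENNReal.ofReal (R ω ^ 2) ∂P < ⊤ := fun h => hint <|
      ((memLp_two_iff_integrable_sq hR).2 ⟨hR.pow 2, (hasFiniteIntegral_iff_ofReal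
        (ae_of_all _ fun ω => sq_nonneg _)).2 h⟩).integrable one_le_two
    rw [evariance_eq_top (hR.const_add c) h_add, not_lt_top_iff.1 h_lt]

/-! ### Units and residuals of a trial -/

namespace Trial

variable {Ω : Type*} {d K : ℕ} (T : Trial Ω d K)

/-- Everything that is recorded about unit `i`. -/
def unit (i : ℕ) (ω : Ω) : (Fin d → ℝ) × Fin 2 × Fin K × (Fin 2 → ℝ) :=
  (T.X i ω, T.W i ω, T.H i ω, fun w => T.Y i w ω)

/-- Covariates, arm and study of a unit from its record. -/
def designOfUnit (z : (Fin d → ℝ) × Fin 2 × Fin K × (Fin 2 → ℝ)) :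
    (Fin d → ℝ) × Fin 2 × Fin K :=
  (z.1, z.2.1, z.2.2.1)

/-- Residual of the observed outcome of a unit from its record. -/
def residualOfUnit (θ : Fin 2 → Fin (d + 1) → ℝ)
    (z : (Fin d → ℝ) × Fin 2 × Fin K × (Fin 2 → ℝ)) : ℝ :=
  z.2.2.2 z.2.1 - augment z.1 ⬝ᵥ θ z.2.1

/-- Residual of the observed outcome of unit `i`. -/
def residual (θ : Fin 2 → Fin (d + 1) → ℝ) (i : ℕ) (ω : Ω) : ℝ :=
  residualOfUnit θ (T.unit i ω)

theorem measurable_designOfUnit : Measurable (designOfUnit (d := d) (K := K)) := by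
  unfold designOfUnit
  fun_prop

theorem measurable_residualOfUnit (θ : Fin 2 → Fin (d + 1) → ℝ) :
    Measurable (residualOfUnit (K := K) θ) :=
  measurable_apply_apply_of_countable
    (f := fun w (z : (Fin d → ℝ) × Fin 2 × Fin K × (Fin 2 → ℝ)) =>
      z.2.2.2 w - augment z.1 ⬝ᵥ θ w) (g := fun z => z.2.1)
    (fun w => .sub (by fun_prop) (measurable_dotProduct (measurable_augment.comp measurable_fst)
        measurable_const)) measurable_snd.fst

theorem residual_eq_of_W_eq (θ : Fin 2 → Fin (d + 1) → ℝ) {w : Fin 2} {ω : Ω}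
    (hω : T.W 0 ω = w) : T.residual θ 0 ω = T.noise θ w ω := by
  subst hω
  rfl

namespace IsCovariateShiftRCT

variable [MeasurableSpace Ω] {P : Measure Ω} {θ : Fin 2 → Fin (d + 1) → ℝ} {σ : ℝ} {T}
  (hT : T.IsCovariateShiftRCT P θ σ)

include hT

theorem measurable_unit (i : ℕ) : Measurable (T.unit i) :=
  (hT.measurable_X i).prodMk ((hT.measurable_W i).prodMk ((hT.measurable_H i).prodMk
    (measurable_pi_lambda _ fun w => hT.measurable_Y i w)))

theorem measurable_augment_X (i : ℕ) : Measurable fun ω => augment (T.X i ω) :=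
  measurable_augment.comp (hT.measurable_X i)

theorem iIndepFun_comp_unit {β : Type*} [MeasurableSpace β]
    {g : (Fin d → ℝ) × Fin 2 × Fin K × (Fin 2 → ℝ) → β} (hg : Measurable g) :
    iIndepFun (fun i ω => g (T.unit i ω)) P :=
  hT.indep.comp (fun _ => g) fun _ => hg

theorem identDistrib_comp_unit {β : Type*} [MeasurableSpace β]
    {g : (Fin d → ℝ) × Fin 2 × Fin K × (Fin 2 → ℝ) → β} (hg : Measurable g) (i : ℕ) :
    IdentDistrib (fun ω => g (T.unit i ω)) (fun ω => g (T.unit 0 ω)) P P :=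
  (hT.identDistrib i).comp hg

theorem measurable_residual (i : ℕ) : Measurable (T.residual θ i) :=
  (measurable_residualOfUnit θ).comp (hT.measurable_unit i)

section CentredFunctionOfNoise

variable {g : ℝ → ℝ} (hint : ∀ w, Integrable (fun ω => g (T.noise θ w ω)) P)

include hint

theorem integrable_comp_residual_zero : Integrable (fun ω => g (T.residual θ 0 ω)) P :=
  integrable_of_forall_integrableOn_fiber (Z := T.W 0) fun w =>
    (hint w).integrableOn.congr_fun (fun ω hω => by rw [T.residual_eq_of_W_eq θ hω])
      (hT.measurable_W 0 (measurableSet_singleton w))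

variable (hg : Measurable g)
  (h0 : ∀ k w, (P[|T.H 0 ⁻¹' {k}])[fun ω => g (T.noise θ w ω) |
    MeasurableSpace.comap (T.X 0) inferInstance] =ᵐ[P[|T.H 0 ⁻¹' {k}]] fun _ => 0)

include hg h0

/-- Within a study, randomization separates the arm from the noise, which is centred given `X`. -/
theorem setIntegral_comp_noise_eq_zero (k : Fin K) (w : Fin 2) {B : Set (Fin d → ℝ)}
    (hB : MeasurableSet B) :
    ∫ ω in T.W 0 ⁻¹' {w}, (T.X 0 ⁻¹' B).indicator (fun ω => g (T.noise θ w ω)) ω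
      ∂P[|T.H 0 ⁻¹' {k}] = 0 := by
  have hk : P (T.H 0 ⁻¹' {k}) ≠ 0 := (hT.study_pos k).ne'
  let f : (Fin d → ℝ) × (Fin 2 → ℝ) → ℝ :=
    (Prod.fst ⁻¹' B).indicator fun z => g (z.2 w - augment z.1 ⬝ᵥ θ w)
  have hf : Measurable f := by
    refine Measurable.indicator (hg.comp (.sub (by fun_prop) ?_)) (measurable_fst hB)
    exact measurable_dotProduct (measurable_augment.comp measurable_fst) measurable_const
  have hXY : Measurable fun ω => (T.X 0 ω, fun w => T.Y 0 w ω) :=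
    (hT.measurable_X 0).prodMk (measurable_pi_lambda _ fun w => hT.measurable_Y 0 w)
  have h_given_X : ∫ ω in T.X 0 ⁻¹' B, g (T.noise θ w ω) ∂P[|T.H 0 ⁻¹' {k}] = 0 := by
    rw [setIntegral_eq_of_condExp_ae_eq_const (hT.measurable_X 0).comap_le
      (integrable_cond_of_ne_zero (hint w) hk) (h0 k w) ⟨B, hB, rfl⟩, mul_zero]
  rw [← integral_indicator (hT.measurable_X 0 hB)] at h_given_X
  have h_indep := Indep.setIntegral_eq_mul (hT.measurable_W 0).comap_le (hT.randomized k)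
    hXY.aemeasurable ⟨{w}, measurableSet_singleton w, rfl⟩ hf.aestronglyMeasurable
  exact h_indep.trans (mul_eq_zero_of_right _ h_given_X)

variable [IsFiniteMeasure P]

theorem setIntegral_comp_residual_zero {B : Set ((Fin d → ℝ) × Fin 2 × Fin K)}
    (hB : MeasurableSet B) :
    ∫ ω in T.unit 0 ⁻¹' (designOfUnit ⁻¹' B), g (T.residual θ 0 ω) ∂P = 0 := by
  refine setIntegral_eq_zero_of_forall_fiber ((hT.measurable_W 0).prodMk (hT.measurable_H 0))
    (hT.measurable_unit 0 (measurable_designOfUnit hB))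
    (hT.integrable_comp_residual_zero hint).integrableOn ?_
  rintro ⟨w, k⟩
  have hk : P (T.H 0 ⁻¹' {k}) ≠ 0 := (hT.study_pos k).ne'
  have hW := hT.measurable_W 0 (measurableSet_singleton w)
  have hBm : MeasurableSet {x : Fin d → ℝ | (x, w, k) ∈ B} :=
    (measurable_id.prodMk measurable_const) hB
  have h_cell := hT.setIntegral_comp_noise_eq_zero hint hg h0 k w hBm
  rw [setIntegral_indicator (hT.measurable_X 0 hBm), ← integral_indicator
    (hW.inter (hT.measurable_X 0 hBm)), integral_cond, mul_eq_zero_iff_left, setIntegral_indicator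
    (hW.inter (hT.measurable_X 0 hBm))] at h_cell
  · rw [← h_cell]
    have h_set : T.unit 0 ⁻¹' (designOfUnit ⁻¹' B) ∩ (fun ω => (T.W 0 ω, T.H 0 ω)) ⁻¹' {(w, k)} =
        T.H 0 ⁻¹' {k} ∩ (T.W 0 ⁻¹' {w} ∩ T.X 0 ⁻¹' {x | (x, w, k) ∈ B}) := by
      ext ω
      simp only [Set.mem_inter_iff, Set.mem_preimage, Set.mem_singleton_iff, Prod.mk.injEq,
        Set.mem_ofPred_eq, designOfUnit, unit]
      grind
    rw [h_set]
    exact setIntegral_congr_fun ((hT.measurable_H 0 (measurableSet_singleton k)).inter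
      (hW.inter (hT.measurable_X 0 hBm))) fun ω hω => by
        simp only [T.residual_eq_of_W_eq θ hω.2.1]
  · exact inv_ne_zero ((measureReal_ne_zero_iff).2 hk)

theorem setIntegral_comp_residual {B : Set ((Fin d → ℝ) × Fin 2 × Fin K)} (hB : MeasurableSet B)
    (i : ℕ) : ∫ ω in T.unit i ⁻¹' (designOfUnit ⁻¹' B), g (T.residual θ i ω) ∂P = 0 := by
  have h_ident := hT.identDistrib_comp_unit ((hg.comp (measurable_residualOfUnit θ)).indicator
    (measurable_designOfUnit hB)) i
  rw [← hT.setIntegral_comp_residual_zero hint hg h0 hB,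
    ← integral_indicator (hT.measurable_unit 0 (measurable_designOfUnit hB)),
    ← integral_indicator (hT.measurable_unit i (measurable_designOfUnit hB))]
  exact h_ident.integral_eq

end CentredFunctionOfNoise

theorem memLp_residual (i : ℕ) : MemLp (T.residual θ i) 2 P := by
  refine ((hT.identDistrib_comp_unit (measurable_residualOfUnit θ) i).memLp_iff).2 ?_
  refine (memLp_two_iff_integrable_sq (hT.measurable_residual 0).aestronglyMeasurable).2 ?_
  exact hT.integrable_comp_residual_zero (g := fun x => x ^ 2)
    fun w => (hT.memLp_noise w).integrable_sq

theorem condExp_noise_sq_sub (k : Fin K) (w : Fin 2) :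
    (P[|T.H 0 ⁻¹' {k}])[fun ω => T.noise θ w ω ^ 2 - σ ^ 2 |
      MeasurableSpace.comap (T.X 0) inferInstance] =ᵐ[P[|T.H 0 ⁻¹' {k}]] fun _ => 0 := by
  have hk : P (T.H 0 ⁻¹' {k}) ≠ 0 := (hT.study_pos k).ne'
  refine (condExp_sub (integrable_cond_of_ne_zero (hT.memLp_noise w).integrable_sq hk)
    (integrable_const (σ ^ 2)) _).trans ?_
  filter_upwards [hT.noise_var k w] with ω hω
  rw [Pi.sub_apply, hω, condExp_const (hT.measurable_X 0).comap_le, sub_self]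

variable [IsProbabilityMeasure P] {n : ℕ}

theorem setIntegral_prod_residual (i : Fin n) {r : Fin n → ℝ → ℝ} (hr : ∀ l, Measurable (r l))
    (hint : ∀ w, Integrable (fun ω => r i (T.noise θ w ω)) P)
    (h0 : ∀ k w, (P[|T.H 0 ⁻¹' {k}])[fun ω => r i (T.noise θ w ω) |
      MeasurableSpace.comap (T.X 0) inferInstance] =ᵐ[P[|T.H 0 ⁻¹' {k}]] fun _ => 0)
    (hprod : Integrable (fun ω => ∏ l, r l (T.residual θ l ω)) P)
    {A : Set Ω} (hA : MeasurableSet[T.design n] A) :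
    ∫ ω in A, ∏ l, r l (T.residual θ l ω) ∂P = 0 :=
  setIntegral_prod_comp_eq_zero (Z := fun l : Fin n => T.unit l) (u := designOfUnit)
    (f := fun l z => r l (residualOfUnit θ z)) (hT.indep.precomp Fin.val_injective)
    (fun l => hT.measurable_unit l) measurable_designOfUnit
    (fun l => (hr l).comp (measurable_residualOfUnit θ)) hprod i
    (fun _ hB => hT.setIntegral_comp_residual hint (hr i) h0 hB i) hA

theorem setIntegral_residual (i : Fin n) {A : Set Ω} (hA : MeasurableSet[T.design n] A) :
    ∫ ω in A, T.residual θ i ω ∂P = 0 := by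
  have h_prod : ∀ ω, ∏ l : Fin n, (if l = i then id else fun _ => (1 : ℝ)) (T.residual θ l ω) =
      T.residual θ i ω := fun ω => by
    rw [Finset.prod_eq_single i (fun l _ hl => by simp [hl]) (by simp), if_pos rfl, id]
  simpa only [h_prod] using hT.setIntegral_prod_residual i
    (r := fun l => if l = i then id else fun _ => 1) (fun l => by split_ifs <;> fun_prop)
    (fun w => by simpa using (hT.memLp_noise w).integrable one_le_two)
    (fun k w => by simpa using hT.noise_mean k w)
    (by simpa only [h_prod] using (hT.memLp_residual i).integrable one_le_two) hA

theorem setIntegral_residual_mul {i j : Fin n} (hij : i ≠ j) {A : Set Ω}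
    (hA : MeasurableSet[T.design n] A) :
    ∫ ω in A, T.residual θ i ω * T.residual θ j ω ∂P = 0 := by
  have h_prod : ∀ ω, ∏ l : Fin n, (if l = i ∨ l = j then id else fun _ => (1 : ℝ))
      (T.residual θ l ω) = T.residual θ i ω * T.residual θ j ω := fun ω => by
    rw [Finset.prod_eq_mul i j hij (fun l _ hl => by simp [hl.1, hl.2]) (by simp) (by simp),
      if_pos (.inl rfl), if_pos (.inr rfl), id, id]
  have hint : Integrable (fun ω => T.residual θ i ω * T.residual θ j ω) P :=
    (hT.memLp_residual i).integrable_mul (hT.memLp_residual j)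
  simpa only [h_prod] using hT.setIntegral_prod_residual i
    (r := fun l => if l = i ∨ l = j then id else fun _ => 1)
    (fun l => by split_ifs <;> fun_prop)
    (fun w => by simpa using (hT.memLp_noise w).integrable one_le_two)
    (fun k w => by simpa using hT.noise_mean k w) (by simpa only [h_prod] using hint) hA

theorem setIntegral_residual_sq (i : Fin n) {A : Set Ω} (hA : MeasurableSet[T.design n] A) :
    ∫ ω in A, T.residual θ i ω ^ 2 ∂P = P.real A * σ ^ 2 := by
  have h_prod : ∀ ω, ∏ l : Fin n, (if l = i then fun x => x ^ 2 - σ ^ 2 else fun _ => (1 : ℝ))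
      (T.residual θ l ω) = T.residual θ i ω ^ 2 - σ ^ 2 := fun ω => by
    rw [Finset.prod_eq_single i (fun l _ hl => by simp [hl]) (by simp), if_pos rfl]
  have hint := (hT.memLp_residual i).integrable_sq
  have hint_sub : Integrable (fun ω => T.residual θ i ω ^ 2 - σ ^ 2) P :=
    hint.sub (integrable_const _)
  have hint_noise : ∀ w, Integrable (fun ω => T.noise θ w ω ^ 2 - σ ^ 2) P := fun w =>
    (hT.memLp_noise w).integrable_sq.sub (integrable_const _)
  have h_centred := hT.setIntegral_prod_residual i
    (r := fun l => if l = i then fun x => x ^ 2 - σ ^ 2 else fun _ => 1)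
    (fun l => by split_ifs <;> fun_prop) (fun w => by simpa using hint_noise w)
    (fun k w => by simpa using hT.condExp_noise_sq_sub k w)
    (by simpa only [h_prod] using hint_sub) hA
  simp only [h_prod] at h_centred
  rwa [integral_sub hint.integrableOn integrableOn_const, sub_eq_zero, setIntegral_const,
    smul_eq_mul] at h_centred

theorem isWhiteNoise_residual (n : ℕ) :
    IsWhiteNoise (T.design n) P (fun i : Fin n => T.residual θ i) σ where
  memLp i := hT.memLp_residual i
  condExp_eq_zero i := condExp_ae_eq_const_of_setIntegral_eq (hT.design_le n)
    ((hT.memLp_residual i).integrable one_le_two)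
    fun A hA => by rw [hT.setIntegral_residual i hA, mul_zero]
  condExp_mul i j hij := condExp_ae_eq_const_of_setIntegral_eq (hT.design_le n)
    ((hT.memLp_residual i).integrable_mul (hT.memLp_residual j))
    fun A hA => by simpa only [mul_zero] using hT.setIntegral_residual_mul hij hA
  condExp_sq i := condExp_ae_eq_const_of_setIntegral_eq (hT.design_le n)
    (hT.memLp_residual i).integrable_sq fun A hA => hT.setIntegral_residual_sq i hA

end IsCovariateShiftRCT

end Trial

/-! ### Outcome parameters given the design -/

namespace Trial

variable {Ω : Type*} {d K : ℕ} (T : Trial Ω d K)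

/-- Coefficient of the residual of unit `i` in the one-shot estimate of `v ⬝ᵥ θ w`. -/
noncomputable def residualCoeff (n : ℕ) (agg : Federation) (w : Fin 2) (v : Fin (d + 1) → ℝ)
    (i : Fin n) (ω : Ω) : ℝ :=
  if T.W i ω = w then (T.sample n ω).weight agg w (T.H i ω) v ⬝ᵥ augment (T.X i ω) else 0

/-- Average of the augmented covariates of the first `n` units. -/
noncomputable def meanX (n : ℕ) (ω : Ω) : Fin (d + 1) → ℝ :=
  (1 / (n : ℝ)) • ∑ i : Fin n, augment (T.X i ω)

theorem sum_residualCoeff_mul (n : ℕ) (agg : Federation) (w : Fin 2) (v : Fin (d + 1) → ℝ)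
    (θ : Fin 2 → Fin (d + 1) → ℝ) (ω : Ω) :
    ∑ i : Fin n, T.residualCoeff n agg w v i ω * T.residual θ i ω =
      ∑ i ∈ (T.sample n ω).inArm w, ((T.sample n ω).weight agg w ((T.sample n ω).study i) v ⬝ᵥ
        augment ((T.sample n ω).x i)) *
          ((T.sample n ω).y i - augment ((T.sample n ω).x i) ⬝ᵥ θ w) := by
  rw [Sample.inArm, Finset.sum_filter]
  refine Finset.sum_congr rfl fun i _ => ?_
  by_cases hi : T.W i ω = w
  · subst hi
    rw [residualCoeff, if_pos rfl]
    exact (if_pos rfl).symm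
  · rw [residualCoeff, if_neg hi, zero_mul]
    exact (if_neg hi).symm

theorem sum_sq_residualCoeff (n : ℕ) (agg : Federation) (w : Fin 2) (v : Fin (d + 1) → ℝ)
    (ω : Ω) :
    ∑ i : Fin n, T.residualCoeff n agg w v i ω ^ 2 =
      ∑ i ∈ (T.sample n ω).inArm w, ((T.sample n ω).weight agg w ((T.sample n ω).study i) v ⬝ᵥ
        augment ((T.sample n ω).x i)) ^ 2 := by
  simp only [Sample.inArm, Finset.sum_filter, residualCoeff, ite_pow, zero_pow two_ne_zero]
  rfl

theorem measurable_residualCoeff (n : ℕ) (agg : Federation) (w : Fin 2)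
    {v : Ω → Fin (d + 1) → ℝ} (hv : Measurable[T.design n] v) (i : Fin n) :
    Measurable[T.design n] fun ω => T.residualCoeff n agg w (v ω) i ω := by
  let : MeasurableSpace Ω := T.design n
  have hD : MeasurableDesign (T.sample n) := measurableDesign_sample_design n
  exact Measurable.ite (hD.arm i (measurableSet_singleton w))
    (measurable_dotProduct (hD.measurable_weight_study agg w i hv) (hD.measurable_augment_x i))
    measurable_const

theorem measurable_meanX (n : ℕ) : Measurable[T.design n] (T.meanX n) := by
  let : MeasurableSpace Ω := T.design n
  have hD : MeasurableDesign (T.sample n) := measurableDesign_sample_design n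
  exact (Finset.measurable_fun_sum _ fun i _ => hD.measurable_augment_x i).const_smul (1 / (n : ℝ))

theorem tauFed_sample (n : ℕ) (ω : Ω) (t : Fin 2 → Fin (d + 1) → ℝ) :
    (T.sample n ω).tauFed t = T.meanX n ω ⬝ᵥ t 1 - T.meanX n ω ⬝ᵥ t 0 := by
  rw [Sample.tauFed_eq, ← dotProduct_sub, meanX, smul_dotProduct, sum_dotProduct, smul_eq_mul]
  rfl

theorem sampleATE_eq (θ : Fin 2 → Fin (d + 1) → ℝ) (n : ℕ) (ω : Ω) :
    T.sampleATE θ n ω = T.meanX n ω ⬝ᵥ θ 1 - T.meanX n ω ⬝ᵥ θ 0 := by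
  rw [sampleATE, ← dotProduct_sub, meanX, smul_dotProduct, sum_dotProduct, smul_eq_mul]

variable {T} {θ : Fin 2 → Fin (d + 1) → ℝ} {σ : ℝ} {n : ℕ} {ω : Ω}

theorem dotProduct_thetaOneShot (hω : ω ∈ T.fullRank n) (hσ : σ ≠ 0) (agg : Federation)
    (w : Fin 2) (v : Fin (d + 1) → ℝ) :
    v ⬝ᵥ (T.sample n ω).thetaOneShot σ agg w = v ⬝ᵥ θ w +
      ∑ i : Fin n, T.residualCoeff n agg w v i ω * T.residual θ i ω := by
  have : NeZero K := .of_pos (T.H 0 ω).pos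
  rw [sum_residualCoeff_mul]
  exact Sample.LocalFullRank.dotProduct_thetaOneShot hω hσ agg w v (θ w)

theorem tauOneShot_eq (hω : ω ∈ T.fullRank n) (hσ : σ ≠ 0) (agg : Federation) :
    (T.sample n ω).tauOneShot σ agg = T.sampleATE θ n ω +
      ∑ i : Fin n, (T.residualCoeff n agg 1 (T.meanX n ω) i ω -
        T.residualCoeff n agg 0 (T.meanX n ω) i ω) * T.residual θ i ω := by
  simp_rw [sub_mul]
  rw [Sample.tauOneShot, tauFed_sample, sampleATE_eq, dotProduct_thetaOneShot hω hσ agg 1,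
    dotProduct_thetaOneShot hω hσ agg 0, Finset.sum_sub_distrib]
  ring

theorem thetaOneShot_IVW_eq_thetaPool (hω : ω ∈ T.fullRank n) (hσ : σ ≠ 0) (w : Fin 2) :
    (T.sample n ω).thetaOneShot σ .IVW w = (T.sample n ω).thetaPool w :=
  Sample.LocalFullRank.thetaOneShot_IVW hω hσ w

theorem thetaGD_eq_thetaPool (hω : ω ∈ T.fullRank n) {η : Fin 2 → ℝ} {w : Fin 2}
    (hη : (T.sample n ω).IsLearningRate w (η w)) (θ₀ : Fin (d + 1) → ℝ) :
    (T.sample n ω).thetaGD η θ₀ w = (T.sample n ω).thetaPool w := by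
  have : NeZero K := .of_pos (T.H 0 ω).pos
  exact Sample.LocalFullRank.thetaGD_eq hω hη θ₀

variable [MeasurableSpace Ω] {P : Measure Ω}

theorem IsCovariateShiftRCT.measurable_sum_mul_residual (hT : T.IsCovariateShiftRCT P θ σ)
    {c : Fin n → Ω → ℝ} (hc : ∀ i, Measurable[T.design n] (c i)) :
    Measurable fun ω => ∑ i, c i ω * T.residual θ i ω :=
  Finset.measurable_fun_sum _ fun i _ =>
    ((hc i).mono (hT.design_le n) le_rfl).mul (hT.measurable_residual i)

namespace IsFullRankDesignEvent

variable {S : Set Ω} (hS : T.IsFullRankDesignEvent P n S) (hT : T.IsCovariateShiftRCT P θ σ)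

include hS hT

theorem ae_mem_fullRank : ∀ᵐ ω ∂P[|S], ω ∈ T.fullRank n :=
  Measure.ae_smul_measure ((ae_restrict_iff' (hT.design_le n _ hS.measurableSet)).2 hS.fullRank) _

variable [IsProbabilityMeasure P]

theorem isWhiteNoise_residual :
    IsWhiteNoise (T.design n) P[|S] (fun i : Fin n => T.residual θ i) σ :=
  (hT.isWhiteNoise_residual n).cond (hT.design_le n) hS.measurableSet hS.pos

theorem integral_thetaOneShot (agg : Federation) (w : Fin 2) (j : Fin (d + 1))
    (hint : Integrable (fun ω => (T.sample n ω).thetaOneShot σ agg w j) P[|S]) :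
    ∫ ω, (T.sample n ω).thetaOneShot σ agg w j ∂P[|S] = θ w j := by
  have := cond_isProbabilityMeasure hS.pos
  have h_eq : (fun ω => (T.sample n ω).thetaOneShot σ agg w j) =ᵐ[P[|S]] fun ω => θ w j +
      ∑ i : Fin n, T.residualCoeff n agg w (Pi.single j 1) i ω * T.residual θ i ω := by
    filter_upwards [hS.ae_mem_fullRank hT] with ω hω
    simpa only [single_dotProduct, one_mul] using
      dotProduct_thetaOneShot hω hT.sigma_pos.ne' agg w (Pi.single j 1)
  have h_res : Integrable (fun ω => ∑ i : Fin n,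
      T.residualCoeff n agg w (Pi.single j 1) i ω * T.residual θ i ω) P[|S] :=
    ((hint.congr h_eq).sub (integrable_const (θ w j))).congr
      (ae_of_all _ fun ω => add_sub_cancel_left _ _)
  rw [integral_congr_ae h_eq, integral_add (integrable_const _) h_res,
    (hS.isWhiteNoise_residual hT).integral_sum_mul_eq_zero (hT.design_le n)
      (T.measurable_residualCoeff n agg w measurable_const) h_res,
    integral_const, probReal_univ, one_smul, add_zero]

theorem evariance_dotProduct_thetaOneShot (agg : Federation) (w : Fin 2) (v : Fin (d + 1) → ℝ) :
    evariance (fun ω => v ⬝ᵥ (T.sample n ω).thetaOneShot σ agg w) P[|S] =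
      ∫⁻ ω, ENNReal.ofReal (σ ^ 2 * ∑ i : Fin n, T.residualCoeff n agg w v i ω ^ 2) ∂P[|S] := by
  have := cond_isProbabilityMeasure hS.pos
  have h_noise := hS.isWhiteNoise_residual hT
  have hc := T.measurable_residualCoeff n agg w (v := fun _ => v) measurable_const
  rw [← h_noise.lintegral_sq_sum_mul (hT.design_le n) hc]
  refine evariance_eq_lintegral_of_ae_eq_const_add (c := v ⬝ᵥ θ w) ?_
    (hT.measurable_sum_mul_residual hc).aestronglyMeasurable
    (h_noise.integral_sum_mul_eq_zero (hT.design_le n) hc)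
  filter_upwards [hS.ae_mem_fullRank hT] with ω hω
  exact dotProduct_thetaOneShot hω hT.sigma_pos.ne' agg w v

theorem evariance_IVW_le (agg : Federation) (w : Fin 2) (v : Fin (d + 1) → ℝ) :
    evariance (fun ω => v ⬝ᵥ (T.sample n ω).thetaOneShot σ .IVW w) P[|S] ≤
      evariance (fun ω => v ⬝ᵥ (T.sample n ω).thetaOneShot σ agg w) P[|S] := by
  rw [hS.evariance_dotProduct_thetaOneShot hT, hS.evariance_dotProduct_thetaOneShot hT]
  refine lintegral_mono_ae ?_
  filter_upwards [hS.ae_mem_fullRank hT] with ω hω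
  have : NeZero K := .of_pos (T.H 0 ω).pos
  rw [sum_sq_residualCoeff, sum_sq_residualCoeff]
  exact ENNReal.ofReal_le_ofReal (mul_le_mul_of_nonneg_left
    (Sample.LocalFullRank.sum_sq_weight_IVW_le hω agg w v) (sq_nonneg σ))

end IsFullRankDesignEvent

end Trial

/-! ### Covariance matrices and average treatment effects -/

section Covariance

variable {Ω : Type*} [MeasurableSpace Ω] {m : ℕ} {Q : Measure Ω}

theorem covMatrix_congr {s t : Ω → Fin m → ℝ} (h : s =ᵐ[Q] t) : covMatrix s Q = covMatrix t Q := by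
  have h_apply : ∀ j, (fun ω => s ω j) =ᵐ[Q] fun ω => t ω j := fun j =>
    h.mono fun ω hω => congrFun hω j
  ext i j
  simp only [covMatrix, Matrix.of_apply, covariance]
  rw [integral_congr_ae (h_apply i), integral_congr_ae (h_apply j)]
  refine integral_congr_ae ?_
  filter_upwards [h_apply i, h_apply j] with ω hi hj
  rw [hi, hj]

theorem covMatrix_isHermitian (t : Ω → Fin m → ℝ) : (covMatrix t Q).IsHermitian := by
  ext i j
  simp only [covMatrix, conjTranspose_apply, Matrix.of_apply, star_trivial, covariance_comm]

theorem memLp_dotProduct {p : ℝ≥0∞} {t : Ω → Fin m → ℝ} (ht : ∀ j, MemLp (fun ω => t ω j) p Q)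
    (v : Fin m → ℝ) : MemLp (fun ω => v ⬝ᵥ t ω) p Q :=
  memLp_finsetSum _ fun j _ => (ht j).const_mul _

variable [IsProbabilityMeasure Q]

theorem dotProduct_covMatrix_mulVec {t : Ω → Fin m → ℝ}
    (ht : ∀ j, MemLp (fun ω => t ω j) 2 Q) (v : Fin m → ℝ) :
    v ⬝ᵥ covMatrix t Q *ᵥ v = Var[fun ω => v ⬝ᵥ t ω; Q] := by
  have hv : ∀ j, MemLp (fun ω => v j * t ω j) 2 Q := fun j => (ht j).const_mul _
  rw [← covariance_self (memLp_dotProduct ht v).aestronglyMeasurable.aemeasurable]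
  simp only [dotProduct]
  rw [covariance_fun_sum_fun_sum hv hv]
  refine Finset.sum_congr rfl fun i _ => ?_
  simp only [mulVec, dotProduct, Finset.mul_sum]
  refine Finset.sum_congr rfl fun j _ => ?_
  rw [covariance_const_mul_left, covariance_const_mul_right, covMatrix, Matrix.of_apply]
  ring

theorem posSemidef_covMatrix_sub {s t : Ω → Fin m → ℝ}
    (hs : ∀ j, MemLp (fun ω => s ω j) 2 Q) (ht : ∀ j, MemLp (fun ω => t ω j) 2 Q)
    (h : ∀ v : Fin m → ℝ, evariance (fun ω => v ⬝ᵥ s ω) Q ≤ evariance (fun ω => v ⬝ᵥ t ω) Q) :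
    (covMatrix t Q - covMatrix s Q).PosSemidef := by
  refine Matrix.PosSemidef.of_dotProduct_mulVec_nonneg
    ((covMatrix_isHermitian t).sub (covMatrix_isHermitian s)) fun v => ?_
  rw [star_trivial, Matrix.sub_mulVec, dotProduct_sub, dotProduct_covMatrix_mulVec hs,
    dotProduct_covMatrix_mulVec ht, sub_nonneg]
  exact ENNReal.toReal_mono (memLp_dotProduct ht v).evariance_lt_top.ne (h v)

end Covariance

section ConditionalMean

variable {Ω α β : Type*} [MeasurableSpace Ω] [MeasurableSpace α] [MeasurableSpace β]
  {P : Measure Ω}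

theorem setIntegral_eq_measureReal_mul_integral_cond [IsFiniteMeasure P] (S : Set Ω) (f : Ω → ℝ) :
    ∫ ω in S, f ω ∂P = P.real S * ∫ ω, f ω ∂P[|S] := by
  by_cases hS : P.real S = 0
  · rw [setIntegral_measure_zero f ((measureReal_eq_zero_iff).1 hS), hS, zero_mul]
  · rw [integral_cond, mul_inv_cancel_left₀ hS]

theorem integral_eq_sum_measureReal_mul_integral_cond [IsFiniteMeasure P] [Fintype α]
    [MeasurableSingletonClass α] {Z : Ω → α} (hZ : Measurable Z) {f : Ω → ℝ}
    (hf : Integrable f P) :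
    ∫ ω, f ω ∂P = ∑ z, P.real (Z ⁻¹' {z}) * ∫ ω, f ω ∂P[|Z ⁻¹' {z}] := by
  simp_rw [← setIntegral_eq_measureReal_mul_integral_cond]
  rw [← integral_iUnion_fintype (fun z => hZ (measurableSet_singleton z))
    (fun i j hij => (Set.disjoint_singleton.2 hij).preimage Z) (fun z => hf.integrableOn),
    ← Set.preimage_iUnion, Set.iUnion_of_singleton, Set.preimage_univ, setIntegral_univ]

theorem integral_cond_inter_comp_of_indepFun {Z : Ω → α} {U : Ω → β} (hind : IndepFun Z U P)
    (hZ : Measurable Z) (hU : Measurable U) {B : Set α} (hB : MeasurableSet B) {C : Set β}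
    (hC : MeasurableSet C) (h_pos : P.real (Z ⁻¹' B) ≠ 0) {f : β → ℝ} (hf : Measurable f) :
    ∫ ω, f (U ω) ∂P[|Z ⁻¹' B ∩ U ⁻¹' C] = ∫ ω, f (U ω) ∂P[|U ⁻¹' C] := by
  have h_set : ∫ ω in Z ⁻¹' B ∩ U ⁻¹' C, f (U ω) ∂P =
      P.real (Z ⁻¹' B) * ∫ ω in U ⁻¹' C, f (U ω) ∂P := by
    rw [← setIntegral_indicator (hU hC), ← integral_indicator (hU hC)]
    exact Indep.setIntegral_eq_mul (X := U) hZ.comap_le hind hU.aemeasurable ⟨B, hB, rfl⟩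
      (f := C.indicator f) (hf.indicator hC).aestronglyMeasurable
  have h_prob : P.real (Z ⁻¹' B ∩ U ⁻¹' C) = P.real (Z ⁻¹' B) * P.real (U ⁻¹' C) := by
    simp only [Measure.real, hind.measure_inter_preimage_eq_mul _ _ hB hC, ENNReal.toReal_mul]
  rw [integral_cond, integral_cond, h_set, h_prob, mul_inv, mul_comm (P.real (Z ⁻¹' B))⁻¹,
    mul_assoc, inv_mul_cancel_left₀ h_pos]

theorem integral_cond_comp_of_identDistrib {U V : Ω → β} (h : IdentDistrib U V P P)
    (hU : Measurable U) (hV : Measurable V) {C : Set β} (hC : MeasurableSet C) {f : β → ℝ}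
    (hf : Measurable f) :
    ∫ ω, f (U ω) ∂P[|U ⁻¹' C] = ∫ ω, f (V ω) ∂P[|V ⁻¹' C] := by
  rw [integral_cond, integral_cond, ← integral_indicator (hU hC), ← integral_indicator (hV hC),
    Measure.real, Measure.real, h.measure_mem_eq hC]
  congr 1
  exact (h.comp (hf.indicator hC)).integral_eq

theorem integral_cond_iInter_comp_of_iIndepFun [IsFiniteMeasure P] {n : ℕ} {Z : Fin n → Ω → β}
    (hind : iIndepFun Z P) (hZ : ∀ l, Measurable (Z l)) {C : Fin n → Set β}
    (hC : ∀ l, MeasurableSet (C l)) (h_pos : P (⋂ l, Z l ⁻¹' C l) ≠ 0) (i : Fin n) {f : β → ℝ}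
    (hf : Measurable f) :
    ∫ ω, f (Z i ω) ∂P[|⋂ l, Z l ⁻¹' C l] = ∫ ω, f (Z i ω) ∂P[|Z i ⁻¹' C i] := by
  let others : Ω → ({i}ᶜ : Finset (Fin n)) → β := fun ω l => Z l ω
  let B : Set (({i}ᶜ : Finset (Fin n)) → β) := Set.univ.pi fun l => C l
  have hB : MeasurableSet B := .univ_pi fun l => hC l
  have h_others : Measurable others := measurable_pi_lambda _ fun l => hZ l
  have h_indep : IndepFun others (Z i) P :=
    (hind.indepFun_finset {i}ᶜ {i} disjoint_compl_left hZ).comp (φ := id)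
      (ψ := fun z : ({i} : Finset (Fin n)) → β => z ⟨i, Finset.mem_singleton_self i⟩)
      measurable_id (measurable_pi_apply _)
  have h_inter : ⋂ l, Z l ⁻¹' C l = others ⁻¹' B ∩ Z i ⁻¹' C i := by
    ext ω
    simp only [others, B, Set.mem_iInter, Set.mem_inter_iff, Set.mem_preimage, Set.mem_univ_pi,
      Subtype.forall, Finset.mem_compl, Finset.mem_singleton]
    exact ⟨fun h => ⟨fun l _ => h l, h i⟩, fun h l => if hl : l = i then hl ▸ h.2 else h.1 l hl⟩
  rw [h_inter] at h_pos ⊢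
  refine integral_cond_inter_comp_of_indepFun h_indep h_others (hZ i) hB (hC i) ?_ hf
  exact (measureReal_ne_zero_iff).2 fun h0 => h_pos (measure_mono_null Set.inter_subset_left h0)

end ConditionalMean

theorem sum_card_fiber_div_mul {ι κ : Type*} [Fintype ι] [Fintype κ] [DecidableEq κ] (g : ι → κ)
    (c : κ → ℝ) (r : ℝ) :
    ∑ k, ((Finset.univ.filter fun i => g i = k).card : ℝ) / r * c k = 1 / r * ∑ i, c (g i) := by
  rw [← Finset.sum_fiberwise Finset.univ g, Finset.mul_sum]
  refine Finset.sum_congr rfl fun k _ => ?_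
  rw [Finset.sum_congr rfl fun i hi => by rw [(Finset.mem_filter.1 hi).2], Finset.sum_const,
    nsmul_eq_mul]
  ring

namespace Trial

variable {Ω : Type*} {d K n : ℕ} {T : Trial Ω d K}

theorem effect_eq (θ : Fin 2 → Fin (d + 1) → ℝ) (ω : Ω) : T.Y 0 1 ω - T.Y 0 0 ω =
    augment (T.X 0 ω) ⬝ᵥ (θ 1 - θ 0) + (T.noise θ 1 ω - T.noise θ 0 ω) := by
  rw [noise, noise, dotProduct_sub]
  ring

theorem allocation_eq_iInter (h : Fin n → Fin K) (a : Fin n → Fin 2) :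
    T.allocation n h a = ⋂ l : Fin n, T.unit l ⁻¹' {z | z.2.2.1 = h l ∧ z.2.1 = a l} := by
  ext ω
  simp only [allocation, unit, Set.mem_ofPred_eq, Set.mem_iInter, Set.mem_preimage]

theorem measurable_augment_dotProduct_of_unit (v : Fin (d + 1) → ℝ) :
    Measurable fun z : (Fin d → ℝ) × Fin 2 × Fin K × (Fin 2 → ℝ) => augment z.1 ⬝ᵥ v :=
  measurable_dotProduct (measurable_augment.comp measurable_fst) measurable_const

variable [MeasurableSpace Ω] {P : Measure Ω} {θ : Fin 2 → Fin (d + 1) → ℝ} {σ : ℝ}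

namespace IsCovariateShiftRCT

variable (hT : T.IsCovariateShiftRCT P θ σ)

include hT

section IsFiniteMeasure

variable [IsFiniteMeasure P]

theorem integral_augment_cond_cell (k : Fin K) (w : Fin 2) (v : Fin (d + 1) → ℝ) :
    ∫ ω, augment (T.X 0 ω) ⬝ᵥ v ∂P[|T.H 0 ⁻¹' {k} ∩ T.W 0 ⁻¹' {w}] =
      ∫ ω, augment (T.X 0 ω) ⬝ᵥ v ∂P[|T.H 0 ⁻¹' {k}] := by
  have hk : MeasurableSet (T.H 0 ⁻¹' {k}) := hT.measurable_H 0 (measurableSet_singleton k)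
  have hw : MeasurableSet (T.W 0 ⁻¹' {w}) := hT.measurable_W 0 (measurableSet_singleton w)
  have h_randomized := integral_cond_inter_comp_of_indepFun (hT.randomized k) (hT.measurable_W 0)
    ((hT.measurable_X 0).prodMk (measurable_pi_lambda _ fun w => hT.measurable_Y 0 w))
    (measurableSet_singleton w) .univ ((measureReal_ne_zero_iff).2 (hT.arm_pos k w).ne')
    (f := fun z => augment z.1 ⬝ᵥ v)
    (measurable_dotProduct (measurable_augment.comp measurable_fst) measurable_const)
  have := cond_isProbabilityMeasure (hT.study_pos k).ne'
  rwa [Set.preimage_univ, Set.inter_univ, cond_univ, cond_cond_eq_cond_inter hk hw] at h_randomized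

theorem integral_noise_study (k : Fin K) (w : Fin 2) :
    ∫ ω, T.noise θ w ω ∂P[|T.H 0 ⁻¹' {k}] = 0 := by
  have := cond_isProbabilityMeasure (hT.study_pos k).ne'
  rw [← integral_condExp (hT.measurable_X 0).comap_le, integral_congr_ae (hT.noise_mean k w),
    integral_zero]

end IsFiniteMeasure

variable [IsProbabilityMeasure P]

theorem memLp_augment (j : Fin (d + 1)) : MemLp (fun ω => augment (T.X 0 ω) j) 2 P := by
  refine Fin.cases ?_ (fun j => ?_) j
  · simpa only [augment, Fin.cons_zero] using memLp_const (1 : ℝ)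
  · simp only [augment, Fin.cons_succ]
    exact (ContinuousLinearMap.proj (R := ℝ) (φ := fun _ : Fin d => ℝ) j).comp_memLp' hT.memLp_X

theorem memLp_augment_dotProduct (v : Fin (d + 1) → ℝ) :
    MemLp (fun ω => augment (T.X 0 ω) ⬝ᵥ v) 2 P := by
  simpa only [dotProduct_comm _ v] using memLp_dotProduct hT.memLp_augment v

theorem integrable_augment_dotProduct (i : ℕ) (v : Fin (d + 1) → ℝ) :
    Integrable (fun ω => augment (T.X i ω) ⬝ᵥ v) P :=
  (hT.identDistrib_comp_unit (measurable_augment_dotProduct_of_unit v) i).integrable_iff.2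
    ((hT.memLp_augment_dotProduct v).integrable one_le_two)

theorem studyATE_eq (k : Fin K) :
    T.studyATE P k = ∫ ω, augment (T.X 0 ω) ⬝ᵥ (θ 1 - θ 0) ∂P[|T.H 0 ⁻¹' {k}] := by
  have hk := (hT.study_pos k).ne'
  have h_noise : ∀ w, Integrable (T.noise θ w) P[|T.H 0 ⁻¹' {k}] := fun w =>
    integrable_cond_of_ne_zero ((hT.memLp_noise w).integrable one_le_two) hk
  have h_diff : Integrable (fun ω => T.noise θ 1 ω - T.noise θ 0 ω) P[|T.H 0 ⁻¹' {k}] :=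
    (h_noise 1).sub (h_noise 0)
  simp_rw [studyATE, effect_eq θ]
  rw [integral_add (integrable_cond_of_ne_zero (hT.integrable_augment_dotProduct 0 _) hk) h_diff,
    integral_sub (h_noise 1) (h_noise 0), hT.integral_noise_study, hT.integral_noise_study,
    sub_zero, add_zero]

theorem ate_eq_sum : T.ate P = ∑ k, P.real (T.H 0 ⁻¹' {k}) * T.studyATE P k := by
  have h_noise : ∀ w, Integrable (T.noise θ w) P := fun w =>
    (hT.memLp_noise w).integrable one_le_two
  have h_effect : Integrable (fun ω => T.Y 0 1 ω - T.Y 0 0 ω) P :=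
    ((hT.integrable_augment_dotProduct 0 _).add ((h_noise 1).sub (h_noise 0))).congr
      (ae_of_all _ fun ω => (effect_eq θ ω).symm)
  exact integral_eq_sum_measureReal_mul_integral_cond (hT.measurable_H 0) h_effect

theorem ate_eq : T.ate P = ∫ ω, augment (T.X 0 ω) ⬝ᵥ (θ 1 - θ 0) ∂P := by
  rw [hT.ate_eq_sum, integral_eq_sum_measureReal_mul_integral_cond (hT.measurable_H 0)
    (hT.integrable_augment_dotProduct 0 _)]
  simp_rw [hT.studyATE_eq]

theorem integral_augment_unit (i : ℕ) :
    ∫ ω, augment (T.X i ω) ⬝ᵥ (θ 1 - θ 0) ∂P = T.ate P := by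
  rw [hT.ate_eq]
  exact (hT.identDistrib_comp_unit
    (measurable_augment_dotProduct_of_unit (θ 1 - θ 0)) i).integral_eq

theorem integral_studyATE_unit (i : ℕ) : ∫ ω, T.studyATE P (T.H i ω) ∂P = T.ate P := by
  have h_ident : IdentDistrib (T.H i) (T.H 0) P P :=
    hT.identDistrib_comp_unit (g := fun z => z.2.2.1) measurable_snd.snd.fst i
  calc ∫ ω, T.studyATE P (T.H i ω) ∂P
    _ = ∫ k, T.studyATE P k ∂P.map (T.H i) :=
      (integral_map (hT.measurable_H i).aemeasurable
        (measurable_of_countable _).aestronglyMeasurable).symm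
    _ = ∑ k, (P.map (T.H 0)).real {k} * T.studyATE P k := by
      rw [h_ident.map_eq, integral_fintype .of_finite]
      rfl
    _ = T.ate P := by
      simp_rw [hT.ate_eq_sum, map_measureReal_apply (hT.measurable_H 0) (measurableSet_singleton _)]

theorem integrable_sampleATE (n : ℕ) : Integrable (T.sampleATE θ n) P :=
  (integrable_finsetSum Finset.univ fun (i : Fin n) _ =>
    hT.integrable_augment_dotProduct i (θ 1 - θ 0)).const_mul (1 / (n : ℝ))

theorem integral_sampleATE (hn : n ≠ 0) : ∫ ω, T.sampleATE θ n ω ∂P = T.ate P := by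
  simp_rw [sampleATE]
  rw [integral_const_mul, integral_finsetSum _ fun (i : Fin n) _ =>
    hT.integrable_augment_dotProduct i (θ 1 - θ 0)]
  simp_rw [hT.integral_augment_unit]
  rw [Finset.sum_const, Finset.card_fin, nsmul_eq_mul, one_div,
    inv_mul_cancel_left₀ (Nat.cast_ne_zero.2 hn)]

theorem integral_sum_studyATE (hn : n ≠ 0) :
    ∫ ω, ∑ k, (((T.sample n ω).inStudy k).card : ℝ) / n * T.studyATE P k ∂P = T.ate P := by
  have h_int : ∀ i : Fin n, Integrable (fun ω => T.studyATE P (T.H i ω)) P := fun i =>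
    (Integrable.of_finite (f := T.studyATE P) (μ := P.map (T.H i))).comp_measurable
      (hT.measurable_H i)
  have h_avg : ∀ ω, ∑ k, (((T.sample n ω).inStudy k).card : ℝ) / n * T.studyATE P k =
      1 / (n : ℝ) * ∑ i : Fin n, T.studyATE P (T.H i ω) := fun ω =>
    sum_card_fiber_div_mul (fun i : Fin n => T.H i ω) _ _
  simp_rw [h_avg]
  rw [integral_const_mul, integral_finsetSum _ fun i _ => h_int i]
  simp_rw [hT.integral_studyATE_unit]
  rw [Finset.sum_const, Finset.card_fin, nsmul_eq_mul, one_div,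
    inv_mul_cancel_left₀ (Nat.cast_ne_zero.2 hn)]

section Allocation

variable {h : Fin n → Fin K} {a : Fin n → Fin 2} (h_pos : P (T.allocation n h a) ≠ 0)

include h_pos

theorem integral_augment_allocation (i : Fin n) :
    ∫ ω, augment (T.X i ω) ⬝ᵥ (θ 1 - θ 0) ∂P[|T.allocation n h a] = T.studyATE P (h i) := by
  let cell (l : Fin n) : Set ((Fin d → ℝ) × Fin 2 × Fin K × (Fin 2 → ℝ)) :=
    {z | z.2.2.1 = h l ∧ z.2.1 = a l}
  have h_cell : ∀ l, MeasurableSet (cell l) := fun l =>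
    (measurable_snd.snd.fst (measurableSet_singleton (h l))).inter
      (measurable_snd.fst (measurableSet_singleton (a l)))
  have h_meas := measurable_augment_dotProduct_of_unit (K := K) (θ 1 - θ 0)
  rw [allocation_eq_iInter] at h_pos ⊢
  calc ∫ ω, augment (T.X i ω) ⬝ᵥ (θ 1 - θ 0) ∂P[|⋂ l : Fin n, T.unit l ⁻¹' cell l]
    _ = ∫ ω, augment (T.X i ω) ⬝ᵥ (θ 1 - θ 0) ∂P[|T.unit i ⁻¹' cell i] :=
      integral_cond_iInter_comp_of_iIndepFun (Z := fun l : Fin n => T.unit l)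
        (hT.indep.precomp Fin.val_injective) (fun l => hT.measurable_unit l) h_cell h_pos i h_meas
    _ = ∫ ω, augment (T.X 0 ω) ⬝ᵥ (θ 1 - θ 0) ∂P[|T.unit 0 ⁻¹' cell i] :=
      integral_cond_comp_of_identDistrib (hT.identDistrib i) (hT.measurable_unit i)
        (hT.measurable_unit 0) (h_cell i) h_meas
    _ = ∫ ω, augment (T.X 0 ω) ⬝ᵥ (θ 1 - θ 0) ∂P[|T.H 0 ⁻¹' {h i}] :=
      hT.integral_augment_cond_cell (h i) (a i) (θ 1 - θ 0)
    _ = T.studyATE P (h i) := (hT.studyATE_eq (h i)).symm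

theorem integral_sampleATE_allocation :
    ∫ ω, T.sampleATE θ n ω ∂P[|T.allocation n h a] =
      ∑ k, ((Finset.univ.filter fun i => h i = k).card : ℝ) / n * T.studyATE P k := by
  simp_rw [sampleATE]
  rw [integral_const_mul, integral_finsetSum _ fun (i : Fin n) _ =>
    integrable_cond_of_ne_zero (hT.integrable_augment_dotProduct i (θ 1 - θ 0)) h_pos]
  simp_rw [hT.integral_augment_allocation h_pos]
  exact (sum_card_fiber_div_mul h _ _).symm

end Allocation

end IsCovariateShiftRCT

theorem IsFullRankDesignEvent.integral_tauOneShot [IsProbabilityMeasure P] {S : Set Ω}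
    (hS : T.IsFullRankDesignEvent P n S) (hT : T.IsCovariateShiftRCT P θ σ) (agg : Federation)
    (hint : Integrable (fun ω => (T.sample n ω).tauOneShot σ agg) P[|S]) :
    ∫ ω, (T.sample n ω).tauOneShot σ agg ∂P[|S] = ∫ ω, T.sampleATE θ n ω ∂P[|S] := by
  let c (i : Fin n) (ω : Ω) : ℝ := T.residualCoeff n agg 1 (T.meanX n ω) i ω -
    T.residualCoeff n agg 0 (T.meanX n ω) i ω
  have hc : ∀ i, Measurable[T.design n] (c i) := fun i =>
    (T.measurable_residualCoeff n agg 1 (T.measurable_meanX n) i).sub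
      (T.measurable_residualCoeff n agg 0 (T.measurable_meanX n) i)
  have h_eq : (fun ω => (T.sample n ω).tauOneShot σ agg) =ᵐ[P[|S]] fun ω =>
      T.sampleATE θ n ω + ∑ i, c i ω * T.residual θ i ω := by
    filter_upwards [hS.ae_mem_fullRank hT] with ω hω
    exact tauOneShot_eq hω hT.sigma_pos.ne' agg
  have h_mean := integrable_cond_of_ne_zero (hT.integrable_sampleATE n) hS.pos
  have h_res : Integrable (fun ω => ∑ i, c i ω * T.residual θ i ω) P[|S] :=
    ((hint.congr h_eq).sub h_mean).congr (ae_of_all _ fun ω => add_sub_cancel_left _ _)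
  rw [integral_congr_ae h_eq, integral_add h_mean h_res,
    (hS.isWhiteNoise_residual hT).integral_sum_mul_eq_zero (hT.design_le n) hc h_res, add_zero]

end Trial

/-! ### Laws of large numbers for the design -/

theorem tendsto_integral_cond_of_tendsto_integral_abs_sub {Ω : Type*} [MeasurableSpace Ω]
    {P : Measure Ω} [IsProbabilityMeasure P] {f : ℕ → Ω → ℝ} {c : ℝ} {S : ℕ → Set Ω}
    (hf : ∀ n, Integrable (f n) P)
    (h : Tendsto (fun n => ∫ ω, |f n ω - c| ∂P) atTop (𝓝 0))
    (hS : Tendsto (fun n => P (S n)) atTop (𝓝 1)) :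
    Tendsto (fun n => ∫ ω, f n ω ∂P[|S n]) atTop (𝓝 c) := by
  have hr : Tendsto (fun n => P.real (S n)) atTop (𝓝 1) :=
    (ENNReal.tendsto_toReal ENNReal.one_ne_top).comp hS
  have h_bound : Tendsto (fun n => (P.real (S n))⁻¹ * ∫ ω, |f n ω - c| ∂P) atTop (𝓝 0) := by
    simpa using (hr.inv₀ one_ne_zero).mul h
  refine tendsto_iff_norm_sub_tendsto_zero.2 (squeeze_zero' (Eventually.of_forall fun n =>
    norm_nonneg _) ?_ h_bound)
  filter_upwards [hr.eventually_ne one_ne_zero] with n hn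
  have h_pos : P (S n) ≠ 0 := (measureReal_ne_zero_iff).1 hn
  have := cond_isProbabilityMeasure h_pos
  have h_sub : Integrable (fun ω => f n ω - c) P := (hf n).sub (integrable_const c)
  calc ‖∫ ω, f n ω ∂P[|S n] - c‖
    _ = ‖∫ ω, (f n ω - c) ∂P[|S n]‖ := by
      rw [integral_sub (integrable_cond_of_ne_zero (hf n) h_pos) (integrable_const c),
        integral_const, probReal_univ, one_smul]
    _ ≤ ∫ ω, |f n ω - c| ∂P[|S n] := norm_integral_le_integral_norm _
    _ = (P.real (S n))⁻¹ * ∫ ω in S n, |f n ω - c| ∂P := integral_cond _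
    _ ≤ (P.real (S n))⁻¹ * ∫ ω, |f n ω - c| ∂P :=
      mul_le_mul_of_nonneg_left (setIntegral_le_integral h_sub.abs
        (ae_of_all _ fun ω => abs_nonneg _)) (inv_nonneg.2 measureReal_nonneg)

theorem Sample.LocalFullRank.of_det_ne_zero {n d K : ℕ} {D : Sample n d K}
    (h : ∀ k w, (D.gram (D.inCell k w)).det ≠ 0) : D.LocalFullRank := fun k w => by
  rw [Matrix.rank_of_isUnit _ ((Matrix.isUnit_iff_isUnit_det _).2 (h k w).isUnit),
    Fintype.card_fin]

namespace Trial

variable {Ω : Type*} {d K : ℕ} (T : Trial Ω d K)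

/-- The event that a unit, represented by unit `0`, is allocated to study `k` and arm `w`. -/
def cell (k : Fin K) (w : Fin 2) : Set Ω := T.H 0 ⁻¹' {k} ∩ T.W 0 ⁻¹' {w}

/-- The records of the units allocated to study `k` and arm `w`. -/
def cellOfUnit (k : Fin K) (w : Fin 2) : Set ((Fin d → ℝ) × Fin 2 × Fin K × (Fin 2 → ℝ)) :=
  {z | z.2.2.1 = k ∧ z.2.1 = w}

theorem measurableSet_cellOfUnit (k : Fin K) (w : Fin 2) :
    MeasurableSet (cellOfUnit (d := d) k w) :=
  (measurable_snd.snd.fst (measurableSet_singleton k)).inter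
    (measurable_snd.fst (measurableSet_singleton w))

variable [MeasurableSpace Ω] (P : Measure Ω)

/-- Probability that a unit is allocated to study `k` and arm `w`. -/
noncomputable def cellProb (k : Fin K) (w : Fin 2) : ℝ := P.real (T.cell k w)

/-- Contribution of study `k` and arm `w` to the second moment matrix of the augmented covariates;
the almost sure limit of the Gram matrix of that cell divided by the total sample size. -/
noncomputable def cellGram (k : Fin K) (w : Fin 2) : Matrix (Fin (d + 1)) (Fin (d + 1)) ℝ :=
  Matrix.of fun a b => ∫ ω in T.cell k w, augment (T.X 0 ω) a * augment (T.X 0 ω) b ∂P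

/-- Expected augmented covariates. -/
noncomputable def expectedX (j : Fin (d + 1)) : ℝ := ∫ ω, augment (T.X 0 ω) j ∂P

/-- Almost sure limit of `n` times the vector `Sample.weight agg w k v`. -/
noncomputable def limitWeight :
    Federation → Fin 2 → Fin K → (Fin (d + 1) → ℝ) → Fin (d + 1) → ℝ
  | .SW, w, k, v => (T.cellProb P k w / ∑ l, T.cellProb P l w) • (T.cellGram P k w)⁻¹ *ᵥ v
  | .IVW, w, _, v => (∑ l, T.cellGram P l w)⁻¹ *ᵥ v

namespace IsCovariateShiftRCT

variable {T P} {θ : Fin 2 → Fin (d + 1) → ℝ} {σ : ℝ} (hT : T.IsCovariateShiftRCT P θ σ)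

include hT

theorem measurableSet_cell (k : Fin K) (w : Fin 2) : MeasurableSet (T.cell k w) :=
  (hT.measurable_H 0 (measurableSet_singleton k)).inter
    (hT.measurable_W 0 (measurableSet_singleton w))

theorem cellProb_pos [IsFiniteMeasure P] (k : Fin K) (w : Fin 2) : 0 < T.cellProb P k w := by
  refine ENNReal.toReal_pos (fun h0 => (hT.arm_pos k w).ne' ?_) (measure_ne_top P _)
  rw [cond_apply (hT.measurable_H 0 (measurableSet_singleton k)),
    show P (T.H 0 ⁻¹' {k} ∩ T.W 0 ⁻¹' {w}) = 0 from h0, mul_zero]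

theorem measurableSet_fullRank (n : ℕ) : MeasurableSet (T.fullRank n) := by
  have h_det : T.fullRank n = ⋂ k, ⋂ w,
      {ω | ((T.sample n ω).gram ((T.sample n ω).inCell k w)).det ≠ 0} := by
    ext ω
    simp only [Set.mem_iInter, Set.mem_ofPred_eq]
    exact ⟨fun h k w => (Sample.LocalFullRank.isUnit_det_inCell h k w).ne_zero,
      fun h => .of_det_ne_zero h⟩
  rw [h_det]
  exact MeasurableSet.iInter fun k => MeasurableSet.iInter fun w =>
    (measurable_matrix_det ((hT.measurableDesign_sample n).measurable_gram_inCell_apply k w))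
      (measurableSet_singleton 0).compl

theorem ae_tendsto_mean {g : (Fin d → ℝ) × Fin 2 × Fin K × (Fin 2 → ℝ) → ℝ} (hg : Measurable g)
    (hint : Integrable (fun ω => g (T.unit 0 ω)) P) :
    ∀ᵐ ω ∂P, Tendsto (fun n : ℕ => (n : ℝ)⁻¹ * ∑ i : Fin n, g (T.unit i ω)) atTop
      (𝓝 (∫ ω, g (T.unit 0 ω) ∂P)) := by
  filter_upwards [strong_law_ae (fun i ω => g (T.unit i ω)) hint
    (fun i j hij => (hT.iIndepFun_comp_unit hg).indepFun hij) (hT.identDistrib_comp_unit hg)]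
    with ω hω
  simpa only [Finset.sum_range, smul_eq_mul] using hω

theorem ae_tendsto_mean_inCell {φ : (Fin d → ℝ) → ℝ} (hφ : Measurable φ)
    (hint : Integrable (fun ω => φ (T.X 0 ω)) P) (k : Fin K) (w : Fin 2) :
    ∀ᵐ ω ∂P, Tendsto (fun n : ℕ => (n : ℝ)⁻¹ *
      ∑ i ∈ (T.sample n ω).inCell k w, φ ((T.sample n ω).x i)) atTop
      (𝓝 (∫ ω in T.cell k w, φ (T.X 0 ω) ∂P)) := by
  have h_cell := hT.measurableSet_cell k w
  rw [← integral_indicator h_cell]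
  filter_upwards [hT.ae_tendsto_mean (g := (cellOfUnit k w).indicator fun z => φ z.1)
    ((hφ.comp measurable_fst).indicator (measurableSet_cellOfUnit k w)) (hint.indicator h_cell)]
    with ω hω
  refine hω.congr fun n => ?_
  rw [Sample.inCell, Finset.sum_filter]
  refine congrArg _ (Finset.sum_congr rfl fun i _ => ?_)
  split_ifs with hi
  exacts [Set.indicator_of_mem (s := cellOfUnit k w) hi _,
    Set.indicator_of_notMem (s := cellOfUnit k w) hi _]

section IsFiniteMeasure

variable [IsFiniteMeasure P]

theorem ae_tendsto_card_inCell (k : Fin K) (w : Fin 2) :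
    ∀ᵐ ω ∂P, Tendsto (fun n : ℕ => (n : ℝ)⁻¹ * (((T.sample n ω).inCell k w).card : ℝ)) atTop
      (𝓝 (T.cellProb P k w)) := by
  have h := hT.ae_tendsto_mean_inCell (φ := fun _ => 1) measurable_const (integrable_const 1) k w
  simpa only [cellProb, Finset.sum_const, nsmul_eq_mul, mul_one, setIntegral_const,
    smul_eq_mul] using h

end IsFiniteMeasure

variable [IsProbabilityMeasure P]

theorem integrable_augment_mul (a b : Fin (d + 1)) :
    Integrable (fun ω => augment (T.X 0 ω) a * augment (T.X 0 ω) b) P :=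
  (hT.memLp_augment a).integrable_mul (hT.memLp_augment b)

theorem ae_tendsto_gram_inCell (k : Fin K) (w : Fin 2) :
    ∀ᵐ ω ∂P, Tendsto (fun n : ℕ => (n : ℝ)⁻¹ • (T.sample n ω).gram ((T.sample n ω).inCell k w))
      atTop (𝓝 (T.cellGram P k w)) := by
  have h_apply : ∀ a b, ∀ᵐ ω ∂P, Tendsto (fun n : ℕ => ((n : ℝ)⁻¹ •
      (T.sample n ω).gram ((T.sample n ω).inCell k w)) a b) atTop (𝓝 (T.cellGram P k w a b)) := by
    intro a b
    have h_meas : ∀ j, Measurable fun x : Fin d → ℝ => augment x j := measurable_pi_iff.1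
      measurable_augment
    filter_upwards [hT.ae_tendsto_mean_inCell (φ := fun x => augment x a * augment x b)
      ((h_meas a).mul (h_meas b)) (hT.integrable_augment_mul a b) k w] with ω hω
    simpa only [Matrix.smul_apply, Sample.gram, Matrix.sum_apply, vecMulVec_apply,
      smul_eq_mul, cellGram, Matrix.of_apply] using hω
  filter_upwards [ae_all_iff.2 fun a => ae_all_iff.2 (h_apply a)] with ω hω
  exact tendsto_pi_nhds.2 fun a => tendsto_pi_nhds.2 (hω a)

theorem ae_tendsto_meanX :
    ∀ᵐ ω ∂P, Tendsto (fun n : ℕ => T.meanX n ω) atTop (𝓝 (T.expectedX P)) := by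
  have h_apply : ∀ j, ∀ᵐ ω ∂P,
      Tendsto (fun n : ℕ => T.meanX n ω j) atTop (𝓝 (T.expectedX P j)) := by
    intro j
    filter_upwards [hT.ae_tendsto_mean (g := fun z => augment z.1 j)
      ((measurable_pi_iff.1 measurable_augment j).comp measurable_fst)
      ((hT.memLp_augment j).integrable one_le_two)] with ω hω
    simp only [meanX, one_div, Pi.smul_apply, Finset.sum_apply, smul_eq_mul]
    exact hω
  filter_upwards [ae_all_iff.2 h_apply] with ω hω
  exact tendsto_pi_nhds.2 hω

theorem dotProduct_cellGram_mulVec (k : Fin K) (w : Fin 2) (v : Fin (d + 1) → ℝ) :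
    v ⬝ᵥ T.cellGram P k w *ᵥ v = ∫ ω in T.cell k w, (augment (T.X 0 ω) ⬝ᵥ v) ^ 2 ∂P := by
  have hi : ∀ a b, IntegrableOn
      (fun ω => v a * (augment (T.X 0 ω) a * augment (T.X 0 ω) b * v b)) (T.cell k w) P :=
    fun a b => (((hT.integrable_augment_mul a b).mul_const _).const_mul _).integrableOn
  have h_sq : ∀ ω, (augment (T.X 0 ω) ⬝ᵥ v) ^ 2 =
      ∑ a, ∑ b, v a * (augment (T.X 0 ω) a * augment (T.X 0 ω) b * v b) := fun ω => by
    rw [sq, dotProduct, Finset.sum_mul_sum]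
    exact Finset.sum_congr rfl fun a _ => Finset.sum_congr rfl fun b _ => by ring
  simp_rw [h_sq]
  rw [integral_finsetSum _ fun a _ => integrable_finsetSum _ fun b _ => hi a b, dotProduct]
  refine Finset.sum_congr rfl fun a _ => ?_
  rw [integral_finsetSum _ fun b _ => hi a b, mulVec, dotProduct, Finset.mul_sum]
  refine Finset.sum_congr rfl fun b _ => ?_
  rw [integral_const_mul, integral_mul_const, cellGram, Matrix.of_apply]

theorem tendsto_integral_abs_sampleATE_sub :
    Tendsto (fun n => ∫ ω, |T.sampleATE θ n ω - T.ate P| ∂P) atTop (𝓝 0) := by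
  have hg := measurable_augment_dotProduct_of_unit (d := d) (K := K) (θ 1 - θ 0)
  have h_lln := (ENNReal.tendsto_toReal ENNReal.zero_ne_top).comp <|
    strong_law_Lp le_rfl ENNReal.one_ne_top (fun i ω => augment (T.X i ω) ⬝ᵥ (θ 1 - θ 0))
      (memLp_one_iff_integrable.2 (hT.integrable_augment_dotProduct 0 _))
      (fun i j hij => (hT.iIndepFun_comp_unit hg).indepFun hij) (hT.identDistrib_comp_unit hg)
  rw [ENNReal.toReal_zero] at h_lln
  refine h_lln.congr fun n => ?_
  have h_sub : Integrable (fun ω => T.sampleATE θ n ω - T.ate P) P :=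
    (hT.integrable_sampleATE n).sub (integrable_const _)
  have h_eq : (fun ω => (n : ℝ)⁻¹ • ∑ i ∈ Finset.range n, augment (T.X i ω) ⬝ᵥ (θ 1 - θ 0) -
      ∫ ω, augment (T.X 0 ω) ⬝ᵥ (θ 1 - θ 0) ∂P) = fun ω => T.sampleATE θ n ω - T.ate P := by
    funext ω
    rw [hT.ate_eq, sampleATE, Finset.sum_range, one_div, smul_eq_mul]
  rw [Function.comp_apply, h_eq, eLpNorm_one_eq_lintegral_enorm,
    ← integral_norm_eq_lintegral_enorm h_sub.aestronglyMeasurable]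
  rfl

theorem tendsto_integral_sampleATE_cond {S : ℕ → Set Ω}
    (hS : Tendsto (fun n => P (S n)) atTop (𝓝 1)) :
    Tendsto (fun n => ∫ ω, T.sampleATE θ n ω ∂P[|S n]) atTop (𝓝 (T.ate P)) :=
  tendsto_integral_cond_of_tendsto_integral_abs_sub hT.integrable_sampleATE
    hT.tendsto_integral_abs_sampleATE_sub hS

section FullRankWithPositiveProbability

variable (hfull : ∃ n, P (T.fullRank n) ≠ 0)

include hfull

/-- If the quadratic form of `cellGram` vanished at `v`, almost surely every unit of the cell would
have augmented covariates orthogonal to `v`, and no sample could have full rank. -/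
theorem cellGram_posDef (k : Fin K) (w : Fin 2) : (T.cellGram P k w).PosDef := by
  refine Matrix.PosDef.of_dotProduct_mulVec_pos ?_ fun v hv => ?_
  · ext a b
    simp only [cellGram, conjTranspose_apply, Matrix.of_apply, star_trivial, mul_comm]
  rw [star_trivial, hT.dotProduct_cellGram_mulVec]
  refine (integral_nonneg fun ω => sq_nonneg _).lt_of_ne fun h0 => ?_
  rw [eq_comm, integral_eq_zero_iff_of_nonneg (fun ω => sq_nonneg _)
    (hT.memLp_augment_dotProduct v).integrable_sq.integrableOn,
    EventuallyEq, ae_restrict_iff' (hT.measurableSet_cell k w)] at h0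
  let g : (Fin d → ℝ) × Fin 2 × Fin K × (Fin 2 → ℝ) → ℝ :=
    (cellOfUnit k w).indicator fun z => (augment z.1 ⬝ᵥ v) ^ 2
  have hg : Measurable g := ((measurable_augment_dotProduct_of_unit v).pow_const 2).indicator
    (measurableSet_cellOfUnit k w)
  have h_zero : ∀ᵐ ω ∂P, g (T.unit 0 ω) = 0 := by
    filter_upwards [h0] with ω hω
    exact Set.indicator_apply_eq_zero.2 hω
  have h_unit : ∀ i : ℕ, ∀ᵐ ω ∂P, g (T.unit i ω) = 0 := fun i =>
    (hT.identDistrib_comp_unit hg i).symm.ae_snd (p := fun x => x = 0)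
      (measurableSet_singleton 0) h_zero
  obtain ⟨n, hn⟩ := hfull
  obtain ⟨ω, hω, h_all⟩ :=
    ((frequently_ae_mem_iff.2 hn).and_eventually (ae_all_iff.2 h_unit)).exists
  have h_pos := (Sample.LocalFullRank.posDef_inCell (show (T.sample n ω).LocalFullRank from hω)
    k w).dotProduct_mulVec_pos hv
  rw [star_trivial, Sample.dotProduct_gram_mulVec] at h_pos
  refine h_pos.ne' (Finset.sum_eq_zero fun i hi => ?_)
  have h_orth : (augment (T.X i ω) ⬝ᵥ v) ^ 2 = 0 :=
    (Set.indicator_of_mem (s := cellOfUnit k w) (Finset.mem_filter.1 hi).2 _).symm.trans (h_all i)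
  rw [sq, dotProduct_comm] at h_orth
  exact h_orth

theorem ae_eventually_mem_fullRank : ∀ᵐ ω ∂P, ∀ᶠ n in atTop, ω ∈ T.fullRank n := by
  filter_upwards [ae_all_iff.2 fun k => ae_all_iff.2 fun w => hT.ae_tendsto_gram_inCell k w]
    with ω hω
  have h_det : ∀ k w, ∀ᶠ n in atTop, ((T.sample n ω).gram ((T.sample n ω).inCell k w)).det ≠ 0 := by
    intro k w
    filter_upwards [((continuous_id.matrix_det.tendsto _).comp (hω k w)).eventually_ne
      (isUnit_det_of_posDef (hT.cellGram_posDef hfull k w)).ne_zero] with n hn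
    rw [Function.comp_apply, id, Matrix.det_smul] at hn
    exact right_ne_zero_of_mul hn
  filter_upwards [eventually_all.2 fun k => eventually_all.2 (h_det k)] with n hn
  exact .of_det_ne_zero hn

theorem tendsto_measure_fullRank : Tendsto (fun n => P (T.fullRank n)) atTop (𝓝 1) := by
  rw [← measure_univ (μ := P)]
  refine tendsto_measure_of_ae_tendsto_indicator_of_isFiniteMeasure atTop MeasurableSet.univ
    hT.measurableSet_fullRank ?_
  filter_upwards [hT.ae_eventually_mem_fullRank hfull] with ω hω
  filter_upwards [hω] with n hn
  simp only [hn, Set.mem_univ]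

end FullRankWithPositiveProbability

end IsCovariateShiftRCT

end Trial

/-! ### Asymptotic normality -/

theorem tendstoInMeasure_zero_of_tendsto_div {Ω : Type*} [MeasurableSpace Ω] {P : Measure Ω}
    [IsFiniteMeasure P] {D B : ℕ → Ω → ℝ} (hD : ∀ n, Measurable (D n))
    (hB : ∀ n, Measurable (B n)) (h_pos : ∀ n ω, 0 < B n ω)
    (h : ∀ᵐ ω ∂P, Tendsto (fun n => D n ω / B n ω) atTop (𝓝 0)) {C : ℝ≥0∞} (hC : C ≠ ∞)
    (h_le : ∀ n, ∫⁻ ω, ENNReal.ofReal (B n ω) ∂P ≤ C) :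
    TendstoInMeasure P D atTop 0 := by
  have h_div : TendstoInMeasure P (fun n ω => D n ω / B n ω) atTop 0 :=
    tendstoInMeasure_of_tendsto_ae (fun n => ((hD n).div (hB n)).aestronglyMeasurable) h
  rw [tendstoInMeasure_iff_norm] at h_div ⊢
  simp only [Pi.zero_apply, sub_zero, Real.norm_eq_abs] at h_div ⊢
  intro ε hε
  refine ENNReal.tendsto_nhds_zero.2 fun η hη => ?_
  obtain ⟨M, hM, hM_pos⟩ : ∃ M : ℝ, C / ENNReal.ofReal M ≤ η / 2 ∧ 0 < M := by
    have h_lim := ENNReal.Tendsto.const_div ENNReal.tendsto_ofReal_atTop (Or.inr hC)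
    rw [ENNReal.div_top] at h_lim
    exact ((ENNReal.tendsto_nhds_zero.1 h_lim _ (ENNReal.half_pos hη.ne')).and
      (eventually_gt_atTop 0)).exists
  filter_upwards [ENNReal.tendsto_nhds_zero.1 (h_div (ε / M) (div_pos hε hM_pos)) _
    (ENNReal.half_pos hη.ne')] with n hn
  have h_subset : {ω | ε ≤ |D n ω|} ⊆
      {ω | ε / M ≤ |D n ω / B n ω|} ∪ {ω | ENNReal.ofReal M ≤ ENNReal.ofReal (B n ω)} := by
    intro ω hω
    by_contra! h_lt
    simp only [Set.mem_union, Set.mem_ofPred_eq, not_or, not_le] at h_lt hω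
    refine hω.not_gt ?_
    calc |D n ω| = |D n ω / B n ω| * B n ω := by
          rw [abs_div, abs_of_pos (h_pos n ω), div_mul_cancel₀ _ (h_pos n ω).ne']
      _ < ε / M * M := mul_lt_mul'' h_lt.1 ((ENNReal.ofReal_lt_ofReal_iff hM_pos).1 h_lt.2)
          (abs_nonneg _) (h_pos n ω).le
      _ = ε := div_mul_cancel₀ _ hM_pos.ne'
  calc P {ω | ε ≤ |D n ω|}
    _ ≤ P {ω | ε / M ≤ |D n ω / B n ω|} + P {ω | ENNReal.ofReal M ≤ ENNReal.ofReal (B n ω)} :=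
      (measure_mono h_subset).trans (measure_union_le _ _)
    _ ≤ η / 2 + C / ENNReal.ofReal M :=
      add_le_add hn ((meas_ge_le_lintegral_div (hB n).ennreal_ofReal.aemeasurable
        (ENNReal.ofReal_pos.2 hM_pos).ne' ENNReal.ofReal_ne_top).trans
          (ENNReal.div_le_div_right (h_le n) _))
    _ ≤ η / 2 + η / 2 := by gcongr
    _ = η := ENNReal.add_halves η

namespace Trial

variable {Ω : Type*} {d K : ℕ}

section Score

variable (T : Trial Ω d K)

/-- Inner product of the augmented covariates of unit `i` with coefficients that depend on its arm
and study. -/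
def score (α : Fin 2 → Fin K → Fin (d + 1) → ℝ) (i : ℕ) (ω : Ω) : ℝ :=
  augment (T.X i ω) ⬝ᵥ α (T.W i ω) (T.H i ω)

/-- Contribution of unit `i` to the linearization of a treatment effect estimator whose residuals
have the coefficients `T.score α i`. -/
noncomputable def influence [MeasurableSpace Ω] (P : Measure Ω) (θ : Fin 2 → Fin (d + 1) → ℝ)
    (α : Fin 2 → Fin K → Fin (d + 1) → ℝ) (i : ℕ) (ω : Ω) : ℝ :=
  augment (T.X i ω) ⬝ᵥ (θ 1 - θ 0) - T.ate P + T.score α i ω * T.residual θ i ω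

theorem iUnion_cell : ⋃ p : Fin 2 × Fin K, T.cell p.2 p.1 = Set.univ :=
  Set.eq_univ_of_forall fun ω => Set.mem_iUnion.2 ⟨(T.W 0 ω, T.H 0 ω), rfl, rfl⟩

theorem pairwise_disjoint_cell :
    Pairwise (Function.onFun Disjoint fun p : Fin 2 × Fin K => T.cell p.2 p.1) := by
  refine fun p q hpq => Set.disjoint_left.2 fun ω hp hq => hpq ?_
  exact Prod.ext (Eq.trans (Eq.symm hp.2) hq.2) (Eq.trans (Eq.symm hp.1) hq.1)

end Score

variable {T : Trial Ω d K} (α : Fin 2 → Fin K → Fin (d + 1) → ℝ)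

theorem measurable_score_of_unit :
    Measurable fun z : (Fin d → ℝ) × Fin 2 × Fin K × (Fin 2 → ℝ) =>
      augment z.1 ⬝ᵥ α z.2.1 z.2.2.1 :=
  measurable_dotProduct (measurable_augment.comp measurable_fst)
    ((measurable_of_countable fun p : Fin 2 × Fin K => α p.1 p.2).comp
      (measurable_snd.fst.prodMk measurable_snd.snd.fst))

theorem measurable_score_design {n : ℕ} (i : Fin n) : Measurable[T.design n] (T.score α i) := by
  let : MeasurableSpace Ω := T.design n
  have hD : MeasurableDesign (T.sample n) := measurableDesign_sample_design n
  exact measurable_dotProduct (hD.measurable_augment_x i)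
    ((measurable_of_countable fun p : Fin 2 × Fin K => α p.1 p.2).comp
      ((hD.arm i).prodMk (hD.study i)))

variable [MeasurableSpace Ω] {P : Measure Ω} {θ : Fin 2 → Fin (d + 1) → ℝ} {σ : ℝ}

theorem measurable_influence_of_unit (c : ℝ) :
    Measurable fun z : (Fin d → ℝ) × Fin 2 × Fin K × (Fin 2 → ℝ) =>
      augment z.1 ⬝ᵥ (θ 1 - θ 0) - c + (augment z.1 ⬝ᵥ α z.2.1 z.2.2.1) * residualOfUnit θ z :=
  ((measurable_augment_dotProduct_of_unit _).sub_const _).add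
    ((measurable_score_of_unit α).mul (measurable_residualOfUnit θ))

namespace IsCovariateShiftRCT

variable (hT : T.IsCovariateShiftRCT P θ σ)

include hT

theorem measurable_score (i : ℕ) : Measurable (T.score α i) :=
  (measurable_score_of_unit α).comp (hT.measurable_unit i)

theorem measurable_influence (i : ℕ) : Measurable (T.influence P θ α i) :=
  ((measurable_dotProduct (hT.measurable_augment_X i) measurable_const).sub_const _).add
    ((hT.measurable_score α i).mul (hT.measurable_residual i))

variable [IsProbabilityMeasure P]

theorem integrableOn_cell_score_sq (k : Fin K) (w : Fin 2) :
    IntegrableOn (fun ω => T.score α 0 ω ^ 2) (T.cell k w) P :=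
  (hT.memLp_augment_dotProduct (α w k)).integrable_sq.integrableOn.congr_fun
    (fun ω hω => by rw [score, show T.H 0 ω = k from hω.1, show T.W 0 ω = w from hω.2])
    (hT.measurableSet_cell k w)

theorem integrable_score_sq : Integrable (fun ω => T.score α 0 ω ^ 2) P :=
  integrable_of_forall_integrableOn_fiber (Z := fun ω => (T.H 0 ω, T.W 0 ω)) fun p => by
    rw [← Set.singleton_prod_singleton, Set.mk_preimage_prod]
    exact hT.integrableOn_cell_score_sq α p.1 p.2

theorem integral_score_sq :
    ∫ ω, T.score α 0 ω ^ 2 ∂P = ∑ w, ∑ k, α w k ⬝ᵥ T.cellGram P k w *ᵥ α w k := by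
  rw [← setIntegral_univ, ← T.iUnion_cell, integral_iUnion_fintype
    (fun p : Fin 2 × Fin K => hT.measurableSet_cell p.2 p.1) T.pairwise_disjoint_cell
    (fun p => (hT.integrable_score_sq α).integrableOn), Fintype.sum_prod_type]
  refine Finset.sum_congr rfl fun w _ => Finset.sum_congr rfl fun k _ => ?_
  rw [hT.dotProduct_cellGram_mulVec]
  refine setIntegral_congr_fun (hT.measurableSet_cell k w) fun ω hω => ?_
  simp only [score, show T.H 0 ω = k from hω.1, show T.W 0 ω = w from hω.2]

theorem lintegral_score_mul_residual_sq :
    ∫⁻ ω, ENNReal.ofReal ((T.score α 0 ω * T.residual θ 0 ω) ^ 2) ∂P =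
      ENNReal.ofReal (σ ^ 2 * ∫ ω, T.score α 0 ω ^ 2 ∂P) := by
  have h := (hT.isWhiteNoise_residual 1).lintegral_sq_sum_mul (hT.design_le 1)
    (measurable_score_design α)
  simp only [Finset.univ_unique, Fin.default_eq_zero, Finset.sum_singleton, Fin.val_zero] at h
  rw [h, ← ofReal_integral_eq_lintegral_ofReal ((hT.integrable_score_sq α).const_mul _)
    (ae_of_all _ fun ω => by positivity), integral_const_mul]

theorem memLp_score_mul_residual :
    MemLp (fun ω => T.score α 0 ω * T.residual θ 0 ω) 2 P := by
  have h_meas : Measurable fun ω => T.score α 0 ω * T.residual θ 0 ω :=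
    (hT.measurable_score α 0).mul (hT.measurable_residual 0)
  refine (memLp_two_iff_integrable_sq h_meas.aestronglyMeasurable).2
    ⟨(h_meas.pow_const 2).aestronglyMeasurable, ?_⟩
  rw [hasFiniteIntegral_iff_ofReal (ae_of_all _ fun ω => sq_nonneg _),
    hT.lintegral_score_mul_residual_sq]
  exact ENNReal.ofReal_lt_top

theorem integral_score_mul_residual_sq :
    ∫ ω, (T.score α 0 ω * T.residual θ 0 ω) ^ 2 ∂P = σ ^ 2 * ∫ ω, T.score α 0 ω ^ 2 ∂P := by
  rw [integral_eq_lintegral_of_nonneg_ae (ae_of_all _ fun ω => sq_nonneg _)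
    (hT.memLp_score_mul_residual α).integrable_sq.aestronglyMeasurable,
    hT.lintegral_score_mul_residual_sq, ENNReal.toReal_ofReal]
  exact mul_nonneg (sq_nonneg σ) (integral_nonneg fun ω => sq_nonneg _)

theorem integral_mul_residual_eq_zero {c : Ω → ℝ} (hc : Measurable[T.design 1] c)
    (hint : Integrable (fun ω => c ω * T.residual θ 0 ω) P) :
    ∫ ω, c ω * T.residual θ 0 ω ∂P = 0 := by
  have h := (hT.isWhiteNoise_residual 1).integral_sum_mul_eq_zero (c := fun _ => c)
    (hT.design_le 1) fun _ => hc
  simp only [Finset.univ_unique, Fin.default_eq_zero, Finset.sum_singleton, Fin.val_zero] at h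
  exact h hint

theorem memLp_centred :
    MemLp (fun ω => augment (T.X 0 ω) ⬝ᵥ (θ 1 - θ 0) - T.ate P) 2 P :=
  (hT.memLp_augment_dotProduct _).sub (memLp_const _)

theorem memLp_influence : MemLp (T.influence P θ α 0) 2 P :=
  hT.memLp_centred.add (hT.memLp_score_mul_residual α)

theorem integral_influence : ∫ ω, T.influence P θ α 0 ω ∂P = 0 := by
  have h_noise := (hT.memLp_score_mul_residual α).integrable one_le_two
  simp_rw [influence]
  rw [integral_add (hT.memLp_centred.integrable one_le_two) h_noise,
    integral_sub (hT.integrable_augment_dotProduct 0 _) (integrable_const _), ← hT.ate_eq,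
    hT.integral_mul_residual_eq_zero (c := T.score α 0)
      (measurable_score_design α (0 : Fin 1)) h_noise,
    integral_const, probReal_univ, one_smul, sub_self, add_zero]

theorem integrable_centred_mul_score_mul_residual :
    Integrable (fun ω => (augment (T.X 0 ω) ⬝ᵥ (θ 1 - θ 0) - T.ate P) *
      (T.score α 0 ω * T.residual θ 0 ω)) P :=
  hT.memLp_centred.integrable_mul (hT.memLp_score_mul_residual α)

theorem integral_centred_mul_score_mul_residual :
    ∫ ω, (augment (T.X 0 ω) ⬝ᵥ (θ 1 - θ 0) - T.ate P) *
      (T.score α 0 ω * T.residual θ 0 ω) ∂P = 0 := by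
  have hint := hT.integrable_centred_mul_score_mul_residual α
  have h_augment : Measurable[T.design 1] fun ω => augment (T.X 0 ω) := by
    let : MeasurableSpace Ω := T.design 1
    exact (measurableDesign_sample_design (T := T) 1).measurable_augment_x 0
  simp_rw [← mul_assoc] at hint ⊢
  refine hT.integral_mul_residual_eq_zero ?_ hint
  let : MeasurableSpace Ω := T.design 1
  exact ((measurable_dotProduct h_augment measurable_const).sub_const _).mul
    (measurable_score_design α (0 : Fin 1))

theorem variance_influence :
    Var[T.influence P θ α 0; P] =
      ∫ ω, (augment (T.X 0 ω) ⬝ᵥ (θ 1 - θ 0) - T.ate P) ^ 2 ∂P +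
        σ ^ 2 * ∑ w, ∑ k, α w k ⬝ᵥ T.cellGram P k w *ᵥ α w k := by
  have h_centred := hT.memLp_centred
  have h_noise := hT.memLp_score_mul_residual α
  have h_cross := (hT.integrable_centred_mul_score_mul_residual α).const_mul 2
  have h_sq : ∀ ω, T.influence P θ α 0 ω ^ 2 =
      (augment (T.X 0 ω) ⬝ᵥ (θ 1 - θ 0) - T.ate P) ^ 2 +
        2 * ((augment (T.X 0 ω) ⬝ᵥ (θ 1 - θ 0) - T.ate P) *
          (T.score α 0 ω * T.residual θ 0 ω)) + (T.score α 0 ω * T.residual θ 0 ω) ^ 2 :=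
    fun ω => by
      rw [influence]
      ring
  rw [variance_of_integral_eq_zero (hT.measurable_influence α 0).aemeasurable
    (hT.integral_influence α), ← hT.integral_score_sq, ← hT.integral_score_mul_residual_sq]
  simp_rw [h_sq]
  rw [integral_add (by exact h_centred.integrable_sq.add h_cross) h_noise.integrable_sq,
    integral_add h_centred.integrable_sq h_cross, integral_const_mul,
    hT.integral_centred_mul_score_mul_residual, mul_zero, add_zero]

theorem tendstoInDistribution_sum_influence :
    TendstoInDistribution
      (fun (n : ℕ) ω => (√(n : ℝ))⁻¹ * ∑ i : Fin n, T.influence P θ α i ω) atTop (id : ℝ → ℝ)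
      (fun _ => P) (gaussianReal 0 Var[T.influence P θ α 0; P].toNNReal) := by
  have h_meas := measurable_influence_of_unit (θ := θ) α (T.ate P)
  have h_clt := tendstoInDistribution_inv_sqrt_mul_sum_sub
    (P' := gaussianReal 0 Var[T.influence P θ α 0; P].toNNReal) (Y := id)
    (X := T.influence P θ α) ⟨aemeasurable_id, Measure.map_id⟩ (hT.memLp_influence α)
    (hT.iIndepFun_comp_unit h_meas) (hT.identDistrib_comp_unit h_meas)
  simp only [hT.integral_influence, mul_zero, sub_zero, Finset.sum_range] at h_clt
  exact h_clt

end IsCovariateShiftRCT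

end Trial

theorem tendsto_matrix_inv_mulVec {ι m : Type*} [Fintype m] [DecidableEq m] {l : Filter ι}
    {A : ι → Matrix m m ℝ} {M : Matrix m m ℝ} {v : ι → m → ℝ} {u : m → ℝ}
    (hA : Tendsto A l (𝓝 M)) (hM : IsUnit M.det) (hv : Tendsto v l (𝓝 u)) :
    Tendsto (fun i => (A i)⁻¹ *ᵥ v i) l (𝓝 (M⁻¹ *ᵥ u)) := by
  have h_inv : Tendsto (fun i => (A i)⁻¹) l (𝓝 M⁻¹) := by
    refine (continuousAt_matrix_inv M ?_).tendsto.comp hA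
    rw [Ring.inverse_eq_inv']
    exact continuousAt_inv₀ hM.ne_zero
  refine tendsto_pi_nhds.2 fun a => tendsto_finsetSum _ fun b _ => ?_
  exact ((h_inv.apply_nhds a).apply_nhds b).mul (hv.apply_nhds b)

/-- Sign with which the outcome parameters of an arm enter the treatment effect. -/
def armSign (w : Fin 2) : ℝ := if w = 1 then 1 else -1

theorem armSign_mul_self (w : Fin 2) : armSign w * armSign w = 1 := by
  unfold armSign
  split_ifs <;> norm_num

/-- Coefficients that single out one covariate of one arm and study. -/
def basisCoeff {d K : ℕ} (p : Fin 2 × Fin K × Fin (d + 1)) (w : Fin 2) (k : Fin K) :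
    Fin (d + 1) → ℝ :=
  if w = p.1 ∧ k = p.2.1 then Pi.single p.2.2 1 else 0

namespace Trial

variable {Ω : Type*} {d K : ℕ} (T : Trial Ω d K) (θ : Fin 2 → Fin (d + 1) → ℝ)
  (α β : Fin 2 → Fin K → Fin (d + 1) → ℝ) (n : ℕ) (ω : Ω)

theorem score_basisCoeff (p : Fin 2 × Fin K × Fin (d + 1)) (i : ℕ) :
    T.score (basisCoeff p) i ω =
      if T.W i ω = p.1 ∧ T.H i ω = p.2.1 then augment (T.X i ω) p.2.2 else 0 := by
  rw [score, basisCoeff]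
  split_ifs with h
  · exact dotProduct_single_one _ _
  · exact dotProduct_zero _

theorem score_eq_sum (i : ℕ) :
    T.score α i ω = ∑ p : Fin 2 × Fin K × Fin (d + 1),
      α p.1 p.2.1 p.2.2 * T.score (basisCoeff p) i ω := by
  simp only [score_basisCoeff, mul_ite, mul_zero, Fintype.sum_prod_type, ite_and,
    Finset.sum_ite_irrel, Finset.sum_const_zero, Finset.sum_ite_eq, Finset.mem_univ, if_true]
  exact dotProduct_comm _ _

/-- Normalized sum of the residuals of the first `n` units with coefficients `T.score α i`. -/
noncomputable def noiseSum : ℝ := (√(n : ℝ))⁻¹ * ∑ i : Fin n, T.score α i ω * T.residual θ i ω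

theorem noiseSum_eq_sum :
    T.noiseSum θ α n ω = ∑ p : Fin 2 × Fin K × Fin (d + 1),
      α p.1 p.2.1 p.2.2 * T.noiseSum θ (basisCoeff p) n ω := by
  simp_rw [noiseSum, T.score_eq_sum α, Finset.mul_sum, Finset.sum_mul, Finset.mul_sum]
  rw [Finset.sum_comm]
  exact Finset.sum_congr rfl fun p _ => Finset.sum_congr rfl fun i _ => by ring

/-- Random scale that dominates every `T.noiseSum θ α n` up to a constant depending on `α` only,
so that `α` may be replaced by data-dependent coefficients. -/
noncomputable def noiseScale : ℝ :=
  1 + ∑ p : Fin 2 × Fin K × Fin (d + 1), T.noiseSum θ (basisCoeff p) n ω ^ 2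

theorem noiseScale_pos : 0 < T.noiseScale θ n ω :=
  add_pos_of_pos_of_nonneg one_pos (Finset.sum_nonneg fun _ _ => sq_nonneg _)

theorem abs_noiseSum_basisCoeff_le (p : Fin 2 × Fin K × Fin (d + 1)) :
    |T.noiseSum θ (basisCoeff p) n ω| ≤ T.noiseScale θ n ω := by
  calc |T.noiseSum θ (basisCoeff p) n ω|
    _ ≤ 1 + T.noiseSum θ (basisCoeff p) n ω ^ 2 := by
      rw [← sq_abs (T.noiseSum θ (basisCoeff p) n ω)]
      nlinarith [sq_nonneg (|T.noiseSum θ (basisCoeff p) n ω| - 1)]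
    _ ≤ T.noiseScale θ n ω := by
      rw [noiseScale]
      gcongr
      exact Finset.single_le_sum (f := fun q => T.noiseSum θ (basisCoeff q) n ω ^ 2)
        (fun q _ => sq_nonneg _) (Finset.mem_univ p)

theorem abs_noiseSum_le :
    |T.noiseSum θ α n ω| ≤
      (∑ p : Fin 2 × Fin K × Fin (d + 1), |α p.1 p.2.1 p.2.2|) * T.noiseScale θ n ω := by
  rw [noiseSum_eq_sum, Finset.sum_mul]
  refine (Finset.abs_sum_le_sum_abs _ _).trans (Finset.sum_le_sum fun p _ => ?_)
  rw [abs_mul]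
  exact mul_le_mul_of_nonneg_left (T.abs_noiseSum_basisCoeff_le θ n ω p) (abs_nonneg _)

variable {T} [MeasurableSpace Ω] {P : Measure Ω} {θ} {σ : ℝ}

theorem inv_sqrt_mul_sum_influence_sub :
    (√(n : ℝ))⁻¹ * ∑ i : Fin n, T.influence P θ α i ω -
      (√(n : ℝ))⁻¹ * ∑ i : Fin n, T.influence P θ β i ω = T.noiseSum θ (α - β) n ω := by
  rw [noiseSum, ← mul_sub, ← Finset.sum_sub_distrib]
  congr 1
  refine Finset.sum_congr rfl fun i _ => ?_
  rw [influence, influence, add_sub_add_left_eq_sub, ← sub_mul, score, score, ← dotProduct_sub]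
  rfl

variable {n} in
theorem inv_mul_sum_influence (hn : n ≠ 0) :
    (n : ℝ)⁻¹ * ∑ i : Fin n, T.influence P θ α i ω = T.sampleATE θ n ω - T.ate P +
      (n : ℝ)⁻¹ * ∑ i : Fin n, T.score α i ω * T.residual θ i ω := by
  simp_rw [influence]
  rw [Finset.sum_add_distrib, Finset.sum_sub_distrib, Finset.sum_const, Finset.card_univ,
    Fintype.card_fin, nsmul_eq_mul, mul_add, mul_sub, inv_mul_cancel_left₀ (Nat.cast_ne_zero.2 hn),
    sampleATE, one_div]

namespace IsCovariateShiftRCT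

variable (hT : T.IsCovariateShiftRCT P θ σ)

include hT

theorem measurable_noiseSum : Measurable (T.noiseSum θ α n) :=
  (Finset.measurable_fun_sum _ fun (i : Fin n) _ =>
    (hT.measurable_score α i).mul (hT.measurable_residual i)).const_mul _

theorem measurable_noiseScale : Measurable (T.noiseScale θ n) :=
  (Finset.measurable_fun_sum _ fun p _ =>
    (hT.measurable_noiseSum (basisCoeff p) n).pow_const 2).const_add 1

theorem identDistrib_score_sq (i : ℕ) :
    IdentDistrib (fun ω => T.score α i ω ^ 2) (fun ω => T.score α 0 ω ^ 2) P P :=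
  hT.identDistrib_comp_unit ((measurable_score_of_unit α).pow_const 2) i

variable [IsProbabilityMeasure P]

theorem lintegral_noiseSum_sq_le :
    ∫⁻ ω, ENNReal.ofReal (T.noiseSum θ α n ω ^ 2) ∂P ≤
      ENNReal.ofReal (σ ^ 2 * ∫ ω, T.score α 0 ω ^ 2 ∂P) := by
  have h_int : ∀ i : ℕ, Integrable (fun ω => T.score α i ω ^ 2) P := fun i =>
    (hT.identDistrib_score_sq α i).integrable_iff.2 (hT.integrable_score_sq α)
  have h_noise := (hT.isWhiteNoise_residual n).lintegral_sq_sum_mul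
    (c := fun (i : Fin n) ω => (√(n : ℝ))⁻¹ * T.score α i ω) (hT.design_le n)
    fun i => (measurable_score_design α i).const_mul _
  simp only [mul_assoc, ← Finset.mul_sum, mul_pow _ (T.score α _ _)] at h_noise
  simp_rw [noiseSum]
  rw [h_noise, ← ofReal_integral_eq_lintegral_ofReal
    (((integrable_finsetSum _ fun (i : Fin n) _ => h_int i).const_mul _).const_mul _)
    (ae_of_all _ fun ω => by positivity), integral_const_mul, integral_const_mul,
    integral_finsetSum _ fun (i : Fin n) _ => h_int i]
  simp_rw [fun i : Fin n => (hT.identDistrib_score_sq α i).integral_eq]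
  rw [Finset.sum_const, Finset.card_univ, Fintype.card_fin, nsmul_eq_mul, inv_pow,
    Real.sq_sqrt n.cast_nonneg, ← mul_assoc (n : ℝ)⁻¹]
  gcongr
  exact mul_le_of_le_one_left (integral_nonneg fun ω => sq_nonneg _) inv_mul_le_one

theorem lintegral_noiseScale_le :
    ∫⁻ ω, ENNReal.ofReal (T.noiseScale θ n ω) ∂P ≤
      1 + ∑ p : Fin 2 × Fin K × Fin (d + 1),
        ENNReal.ofReal (σ ^ 2 * ∫ ω, T.score (basisCoeff p) 0 ω ^ 2 ∂P) := by
  have h_scale : ∀ ω, ENNReal.ofReal (T.noiseScale θ n ω) =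
      1 + ∑ p : Fin 2 × Fin K × Fin (d + 1),
        ENNReal.ofReal (T.noiseSum θ (basisCoeff p) n ω ^ 2) := fun ω => by
    rw [noiseScale, ENNReal.ofReal_add zero_le_one (Finset.sum_nonneg fun p _ => sq_nonneg _),
      ENNReal.ofReal_one, ENNReal.ofReal_sum_of_nonneg fun p _ => sq_nonneg _]
  simp_rw [h_scale]
  rw [lintegral_add_left measurable_const, lintegral_const, measure_univ, mul_one,
    lintegral_finsetSum _ fun p _ =>
      ((hT.measurable_noiseSum (basisCoeff p) n).pow_const 2).ennreal_ofReal]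
  gcongr with p
  exact hT.lintegral_noiseSum_sq_le _ n

variable {α}

theorem hasAsymptoticVariance_of_tendsto_coeff {a : ℕ → Ω → Fin 2 → Fin K → Fin (d + 1) → ℝ}
    (ha : ∀ᵐ ω ∂P, Tendsto (fun n => a n ω) atTop (𝓝 α)) {t : ℕ → Ω → ℝ}
    (ht : ∀ n, Measurable (t n))
    (h_eq : ∀ᵐ ω ∂P, ∀ᶠ n : ℕ in atTop,
      t n ω - T.ate P = (n : ℝ)⁻¹ * ∑ i : Fin n, T.influence P θ (a n ω) i ω) :
    HasAsymptoticVariance P t (T.ate P) Var[T.influence P θ α 0; P].toNNReal := by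
  have h_meas : ∀ n : ℕ, Measurable fun ω => √(n : ℝ) * (t n ω - T.ate P) := fun n =>
    ((ht n).sub_const _).const_mul _
  have h_meas_lim : ∀ n : ℕ,
      Measurable fun ω => (√(n : ℝ))⁻¹ * ∑ i : Fin n, T.influence P θ α i ω := fun n =>
    (Finset.measurable_fun_sum _ fun (i : Fin n) _ => hT.measurable_influence α i).const_mul _
  have h_top : 1 + ∑ p : Fin 2 × Fin K × Fin (d + 1),
      ENNReal.ofReal (σ ^ 2 * ∫ ω, T.score (basisCoeff p) 0 ω ^ 2 ∂P) ≠ ∞ :=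
    ENNReal.add_ne_top.2 ⟨ENNReal.one_ne_top, ENNReal.sum_ne_top.2 fun p _ => ENNReal.ofReal_ne_top⟩
  refine tendstoInDistribution_of_tendstoInMeasure_sub _ _
    (hT.tendstoInDistribution_sum_influence α)
    (tendstoInMeasure_zero_of_tendsto_div (B := T.noiseScale θ)
      (fun n => (h_meas n).sub (h_meas_lim n)) hT.measurable_noiseScale (T.noiseScale_pos θ) ?_
      h_top hT.lintegral_noiseScale_le) fun n => (h_meas n).aemeasurable
  filter_upwards [ha, h_eq] with ω hω h_eqω
  have h_coeff : Tendsto (fun n => ∑ p : Fin 2 × Fin K × Fin (d + 1),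
      |(a n ω - α) p.1 p.2.1 p.2.2|) atTop (𝓝 0) := by
    have h_cont : Continuous fun γ : Fin 2 → Fin K → Fin (d + 1) → ℝ =>
        ∑ p : Fin 2 × Fin K × Fin (d + 1), |(γ - α) p.1 p.2.1 p.2.2| := by fun_prop
    simpa only [Function.comp_def, sub_self, Pi.zero_apply, abs_zero, Finset.sum_const_zero]
      using (h_cont.tendsto α).comp hω
  refine squeeze_zero_norm' ?_ h_coeff
  filter_upwards [h_eqω] with n hn
  have h_sqrt : √(n : ℝ) * (n : ℝ)⁻¹ = (√(n : ℝ))⁻¹ := by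
    rw [← div_eq_mul_inv, Real.sqrt_div_self]
  rw [norm_div, Real.norm_eq_abs, Real.norm_eq_abs, abs_of_pos (T.noiseScale_pos θ n ω),
    div_le_iff₀ (T.noiseScale_pos θ n ω), Pi.sub_apply, Pi.sub_apply, hn, ← mul_assoc, h_sqrt,
    inv_sqrt_mul_sum_influence_sub]
  exact T.abs_noiseSum_le θ (a n ω - α) n ω

end IsCovariateShiftRCT

end Trial

namespace Trial

variable {Ω : Type*} {d K : ℕ} (T : Trial Ω d K)

/-- Coefficients of the one-shot treatment effect estimator, scaled by the sample size. -/
noncomputable def tauCoeff (agg : Federation) (n : ℕ) (ω : Ω) (w : Fin 2) (k : Fin K) :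
    Fin (d + 1) → ℝ :=
  armSign w • (n : ℝ) • (T.sample n ω).weight agg w k (T.meanX n ω)

/-- Almost sure limit of the coefficients `T.tauCoeff agg n`. -/
noncomputable def limitTauCoeff [MeasurableSpace Ω] (P : Measure Ω) (agg : Federation) (w : Fin 2)
    (k : Fin K) : Fin (d + 1) → ℝ :=
  armSign w • T.limitWeight P agg w k (T.expectedX P)

theorem score_tauCoeff (agg : Federation) {n : ℕ} (i : Fin n) (ω : Ω) :
    T.score (T.tauCoeff agg n ω) i ω =
      n * (T.residualCoeff n agg 1 (T.meanX n ω) i ω -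
        T.residualCoeff n agg 0 (T.meanX n ω) i ω) := by
  rw [score, tauCoeff, dotProduct_smul, dotProduct_smul, dotProduct_comm, residualCoeff,
    residualCoeff, armSign]
  rcases (by omega : T.W i ω = 0 ∨ T.W i ω = 1) with hw | hw <;>
    simp [hw]

variable {T}

theorem tauOneShot_sub_ate [MeasurableSpace Ω] {P : Measure Ω} {θ : Fin 2 → Fin (d + 1) → ℝ}
    {σ : ℝ} {n : ℕ} (hn : n ≠ 0) {ω : Ω} (hω : ω ∈ T.fullRank n) (hσ : σ ≠ 0) (agg : Federation) :
    (T.sample n ω).tauOneShot σ agg - T.ate P =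
      (n : ℝ)⁻¹ * ∑ i : Fin n, T.influence P θ (T.tauCoeff agg n ω) i ω := by
  rw [inv_mul_sum_influence _ _ hn, tauOneShot_eq (θ := θ) hω hσ, Finset.mul_sum]
  simp_rw [score_tauCoeff, mul_assoc, inv_mul_cancel_left₀ (Nat.cast_ne_zero (R := ℝ).2 hn)]
  rw [sub_add_eq_add_sub]

variable [MeasurableSpace Ω] {P : Measure Ω} {θ : Fin 2 → Fin (d + 1) → ℝ} {σ : ℝ}

namespace IsCovariateShiftRCT

variable (hT : T.IsCovariateShiftRCT P θ σ)

include hT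

theorem ae_tendsto_gram_inArm [IsProbabilityMeasure P] (w : Fin 2) :
    ∀ᵐ ω ∂P, Tendsto (fun n : ℕ => (n : ℝ)⁻¹ • (T.sample n ω).gram ((T.sample n ω).inArm w)) atTop
      (𝓝 (∑ k, T.cellGram P k w)) := by
  filter_upwards [ae_all_iff.2 fun k => hT.ae_tendsto_gram_inCell k w] with ω h_gram
  simp_rw [Sample.gram_inArm, Finset.smul_sum]
  exact tendsto_finsetSum _ fun k _ => h_gram k

theorem ae_tendsto_card_inArm [IsProbabilityMeasure P] (w : Fin 2) :
    ∀ᵐ ω ∂P, Tendsto (fun n : ℕ => (n : ℝ)⁻¹ * (((T.sample n ω).inArm w).card : ℝ)) atTop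
      (𝓝 (∑ k, T.cellProb P k w)) := by
  filter_upwards [ae_all_iff.2 fun k => hT.ae_tendsto_card_inCell k w] with ω h_card
  simp_rw [Sample.card_inArm, Finset.mul_sum]
  exact tendsto_finsetSum _ fun k _ => h_card k

theorem sum_cellProb_pos [IsProbabilityMeasure P] (w : Fin 2) : 0 < ∑ k, T.cellProb P k w := by
  have : Nonempty (Fin K) := P.nonempty_of_neZero.map (T.H 0)
  exact Finset.sum_pos (fun k _ => hT.cellProb_pos k w) Finset.univ_nonempty

variable [IsProbabilityMeasure P]

theorem ae_tendsto_card_inCell_div_card_inArm (k : Fin K) (w : Fin 2) :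
    ∀ᵐ ω ∂P, Tendsto (fun n : ℕ =>
      (((T.sample n ω).inCell k w).card : ℝ) / ((T.sample n ω).inArm w).card) atTop
      (𝓝 (T.cellProb P k w / ∑ l, T.cellProb P l w)) := by
  filter_upwards [hT.ae_tendsto_card_inCell k w, hT.ae_tendsto_card_inArm w] with ω h_cell h_arm
  refine (h_cell.div h_arm (hT.sum_cellProb_pos w).ne').congr' ?_
  filter_upwards [eventually_ne_atTop 0] with n hn
  exact mul_div_mul_left _ _ (inv_ne_zero (Nat.cast_ne_zero.2 hn))

variable (hfull : ∃ n, P (T.fullRank n) ≠ 0)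

include hfull

theorem sum_cellGram_posDef (w : Fin 2) : (∑ k, T.cellGram P k w).PosDef := by
  have : Nonempty (Fin K) := P.nonempty_of_neZero.map (T.H 0)
  exact Matrix.posDef_sum Finset.univ_nonempty fun k _ => hT.cellGram_posDef hfull k w

theorem ae_tendsto_smul_weight (agg : Federation) (w : Fin 2) (k : Fin K) :
    ∀ᵐ ω ∂P, Tendsto (fun n : ℕ => (n : ℝ) • (T.sample n ω).weight agg w k (T.meanX n ω)) atTop
      (𝓝 (T.limitWeight P agg w k (T.expectedX P))) := by
  have h_inv : ∀ (n : ℕ) (A : Matrix (Fin (d + 1)) (Fin (d + 1)) ℝ) v,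
      ((n : ℝ)⁻¹ • A)⁻¹ *ᵥ v = (n : ℝ) • A⁻¹ *ᵥ v := fun n A v => by
    rw [inv_smul_matrix, inv_inv, smul_mulVec]
  cases agg with
  | IVW =>
    filter_upwards [hT.ae_tendsto_gram_inArm w, hT.ae_tendsto_meanX] with ω h_gram h_mean
    simpa only [h_inv, Sample.weight, limitWeight] using tendsto_matrix_inv_mulVec h_gram
      (isUnit_det_of_posDef (hT.sum_cellGram_posDef hfull w)) h_mean
  | SW =>
    filter_upwards [hT.ae_tendsto_gram_inCell k w, hT.ae_tendsto_meanX,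
      hT.ae_tendsto_card_inCell_div_card_inArm k w] with ω h_gram h_mean h_card
    have h_lim := h_card.smul (tendsto_matrix_inv_mulVec h_gram
      (isUnit_det_of_posDef (hT.cellGram_posDef hfull k w)) h_mean)
    simpa only [h_inv, Sample.weight, limitWeight, smul_comm (_ / _ : ℝ)] using h_lim

theorem ae_tendsto_tauCoeff (agg : Federation) :
    ∀ᵐ ω ∂P, Tendsto (fun n => T.tauCoeff agg n ω) atTop (𝓝 (T.limitTauCoeff P agg)) := by
  filter_upwards [ae_all_iff.2 fun w => ae_all_iff.2 fun k =>
    hT.ae_tendsto_smul_weight hfull agg w k] with ω hω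
  exact tendsto_pi_nhds.2 fun w => tendsto_pi_nhds.2 fun k => (hω w k).const_smul (armSign w)

theorem hasAsymptoticVariance_of_eq_tauOneShot (agg : Federation) {t : ℕ → Ω → ℝ}
    (ht : ∀ n, Measurable (t n))
    (h_eq : ∀ n, ∀ ω ∈ T.fullRank n, t n ω = (T.sample n ω).tauOneShot σ agg) :
    HasAsymptoticVariance P t (T.ate P)
      Var[T.influence P θ (T.limitTauCoeff P agg) 0; P].toNNReal := by
  refine hT.hasAsymptoticVariance_of_tendsto_coeff (hT.ae_tendsto_tauCoeff hfull agg) ht ?_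
  filter_upwards [hT.ae_eventually_mem_fullRank hfull] with ω hω
  filter_upwards [hω, eventually_ne_atTop 0] with n hωn hn
  rw [h_eq n ω hωn, tauOneShot_sub_ate hn hωn hT.sigma_pos.ne']

theorem sum_limitWeight_IVW_le (w : Fin 2) (v : Fin (d + 1) → ℝ) :
    ∑ k, T.limitWeight P .IVW w k v ⬝ᵥ T.cellGram P k w *ᵥ T.limitWeight P .IVW w k v ≤
      ∑ k, T.limitWeight P .SW w k v ⬝ᵥ T.cellGram P k w *ᵥ T.limitWeight P .SW w k v := by
  refine sum_dotProduct_mulVec_le_of_sum_mulVec_eq (u := (∑ l, T.cellGram P l w)⁻¹ *ᵥ v)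
    (fun k => (hT.cellGram_posDef hfull k w).posSemidef) ?_
  have h_SW : ∀ k, T.cellGram P k w *ᵥ T.limitWeight P .SW w k v =
      (T.cellProb P k w / ∑ l, T.cellProb P l w) • v := fun k => by
    rw [limitWeight, mulVec_smul,
      mulVec_inv_mulVec (isUnit_det_of_posDef (hT.cellGram_posDef hfull k w))]
  simp_rw [h_SW]
  rw [← Finset.sum_smul, ← Finset.sum_div, div_self (hT.sum_cellProb_pos w).ne', one_smul,
    mulVec_inv_mulVec (isUnit_det_of_posDef (hT.sum_cellGram_posDef hfull w))]

theorem variance_influence_IVW_le_SW :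
    Var[T.influence P θ (T.limitTauCoeff P .IVW) 0; P] ≤
      Var[T.influence P θ (T.limitTauCoeff P .SW) 0; P] := by
  have h_sign : ∀ agg w k, T.limitTauCoeff P agg w k ⬝ᵥ
      T.cellGram P k w *ᵥ T.limitTauCoeff P agg w k =
      T.limitWeight P agg w k (T.expectedX P) ⬝ᵥ
        T.cellGram P k w *ᵥ T.limitWeight P agg w k (T.expectedX P) := fun agg w k => by
    rw [limitTauCoeff, mulVec_smul, smul_dotProduct, dotProduct_smul, smul_smul,
      armSign_mul_self, one_smul]
  rw [hT.variance_influence, hT.variance_influence]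
  simp_rw [h_sign]
  refine add_le_add le_rfl (mul_le_mul_of_nonneg_left (Finset.sum_le_sum fun w _ => ?_)
    (sq_nonneg σ))
  exact hT.sum_limitWeight_IVW_le hfull w _

theorem hasAsymptoticVariance_tauOneShot (agg : Federation) :
    HasAsymptoticVariance P (fun n ω => (T.sample n ω).tauOneShot σ agg) (T.ate P)
      Var[T.influence P θ (T.limitTauCoeff P agg) 0; P].toNNReal :=
  hT.hasAsymptoticVariance_of_eq_tauOneShot hfull agg
    (fun n => (hT.measurableDesign_sample n).measurable_tauFed fun w =>
      (hT.measurableDesign_sample n).measurable_thetaOneShot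
        (fun i => hT.measurable_observed i) σ agg w)
    fun _ _ _ => rfl

theorem hasAsymptoticVariance_tauPool :
    HasAsymptoticVariance P (fun n ω => (T.sample n ω).tauPool) (T.ate P)
      Var[T.influence P θ (T.limitTauCoeff P .IVW) 0; P].toNNReal := by
  simp_rw [Sample.tauPool_eq]
  refine hT.hasAsymptoticVariance_of_eq_tauOneShot hfull .IVW
    (fun n => (hT.measurableDesign_sample n).measurable_tauFed fun w =>
      (hT.measurableDesign_sample n).measurable_thetaPool
        (fun i => hT.measurable_observed i) w) fun n ω hω => ?_
  rw [Sample.tauOneShot, funext fun w => thetaOneShot_IVW_eq_thetaPool hω hT.sigma_pos.ne' w]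

theorem hasAsymptoticVariance_tauGD {η : ℕ → Ω → Fin 2 → ℝ} (hη_meas : ∀ n, Measurable (η n))
    (hη : ∀ n ω w, (T.sample n ω).IsLearningRate w (η n ω w)) (θ₀ : Fin (d + 1) → ℝ) :
    HasAsymptoticVariance P (fun n ω => (T.sample n ω).tauGD (η n ω) θ₀) (T.ate P)
      Var[T.influence P θ (T.limitTauCoeff P .IVW) 0; P].toNNReal := by
  refine hT.hasAsymptoticVariance_of_eq_tauOneShot hfull .IVW
    (fun n => (hT.measurableDesign_sample n).measurable_tauFed fun w =>
      (hT.measurableDesign_sample n).measurable_thetaGD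
        (fun i => hT.measurable_observed i) (hη_meas n) θ₀ w) fun n ω hω => ?_
  rw [Sample.tauGD, Sample.tauOneShot, funext fun w =>
    (thetaGD_eq_thetaPool hω (hη n ω w) θ₀).trans
      (thetaOneShot_IVW_eq_thetaPool hω hT.sigma_pos.ne' w).symm]

end IsCovariateShiftRCT

end Trial

namespace Trial

variable {Ω : Type*} {d K : ℕ} {T : Trial Ω d K} [MeasurableSpace Ω] {P : Measure Ω}
  {θ : Fin 2 → Fin (d + 1) → ℝ} {σ : ℝ}

namespace IsFullRankDesignEvent

variable {n : ℕ} {S : Set Ω} (hS : T.IsFullRankDesignEvent P n S)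
  (hT : T.IsCovariateShiftRCT P θ σ)

include hS hT

theorem thetaGD_ae_eq_thetaPool {η : Ω → Fin 2 → ℝ}
    (hη : ∀ ω w, (T.sample n ω).IsLearningRate w (η ω w)) (θ₀ : Fin (d + 1) → ℝ) (w : Fin 2) :
    (fun ω => (T.sample n ω).thetaGD (η ω) θ₀ w) =ᵐ[P[|S]]
      fun ω => (T.sample n ω).thetaPool w := by
  filter_upwards [hS.ae_mem_fullRank hT] with ω hω
  exact thetaGD_eq_thetaPool hω (hη ω w) θ₀

theorem thetaOneShot_IVW_ae_eq_thetaPool (w : Fin 2) :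
    (fun ω => (T.sample n ω).thetaOneShot σ .IVW w) =ᵐ[P[|S]]
      fun ω => (T.sample n ω).thetaPool w := by
  filter_upwards [hS.ae_mem_fullRank hT] with ω hω
  exact thetaOneShot_IVW_eq_thetaPool hω hT.sigma_pos.ne' w

variable [IsProbabilityMeasure P]

theorem memLp_thetaOneShot_IVW (agg : Federation) (w : Fin 2)
    (h : ∀ j, MemLp (fun ω => (T.sample n ω).thetaOneShot σ agg w j) 2 P[|S]) (j : Fin (d + 1)) :
    MemLp (fun ω => (T.sample n ω).thetaOneShot σ .IVW w j) 2 P[|S] := by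
  have := cond_isProbabilityMeasure hS.pos
  have h_le := hS.evariance_IVW_le hT agg w (Pi.single j 1)
  simp only [single_one_dotProduct] at h_le
  have h_meas : Measurable fun ω => (T.sample n ω).thetaOneShot σ .IVW w :=
    (hT.measurableDesign_sample n).measurable_thetaOneShot (fun i => hT.measurable_observed i) σ _ w
  exact (evariance_lt_top_iff_memLp
    ((measurable_pi_apply j).comp h_meas).aestronglyMeasurable).1
      (h_le.trans_lt (h j).evariance_lt_top)

theorem posSemidef_covMatrix_sub_IVW (agg : Federation) (w : Fin 2)
    (h : ∀ j, MemLp (fun ω => (T.sample n ω).thetaOneShot σ agg w j) 2 P[|S]) :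
    (covMatrix (fun ω => (T.sample n ω).thetaOneShot σ agg w) P[|S] -
      covMatrix (fun ω => (T.sample n ω).thetaOneShot σ .IVW w) P[|S]).PosSemidef := by
  have := cond_isProbabilityMeasure hS.pos
  exact posSemidef_covMatrix_sub (hS.memLp_thetaOneShot_IVW hT agg w h) h
    (hS.evariance_IVW_le hT agg w)

end IsFullRankDesignEvent

theorem IsCovariateShiftRCT.tendsto_integral_tauOneShot_cond [IsProbabilityMeasure P]
    (hT : T.IsCovariateShiftRCT P θ σ) {S : ℕ → Set Ω} (agg : Federation)
    (hS : ∀ᶠ n in atTop, T.IsFullRankDesignEvent P n (S n))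
    (hP : Tendsto (fun n => P (S n)) atTop (𝓝 1))
    (hint : ∀ᶠ n in atTop, Integrable (fun ω => (T.sample n ω).tauOneShot σ agg) P[|S n]) :
    Tendsto (fun n => ∫ ω, (T.sample n ω).tauOneShot σ agg ∂P[|S n]) atTop (𝓝 (T.ate P)) := by
  refine (hT.tendsto_integral_sampleATE_cond hP).congr' ?_
  filter_upwards [hS, hint] with n hn hi using (hn.integral_tauOneShot hT agg hi).symm

end Trial

theorem mainTheorem5 {Ω : Type*} [MeasurableSpace Ω] (P : Measure Ω) [IsProbabilityMeasure P]
    {d K : ℕ} (T : Trial Ω d K) (θ : Fin 2 → Fin (d + 1) → ℝ) (σ : ℝ)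
    (hT : T.IsCovariateShiftRCT P θ σ)
    (hfull : ∃ n, P (T.fullRank n) ≠ 0)
    (η : ℕ → Ω → Fin 2 → ℝ) (θ₀ : Fin (d + 1) → ℝ)
    (hη_meas : ∀ n, Measurable (η n))
    (hη : ∀ n ω w, (T.sample n ω).IsLearningRate w (η n ω w)) :
    -- local full rank holds with probability tending to one
    Tendsto (fun n => P (T.fullRank n)) atTop (𝓝 1) ∧
    -- unbiasedness of the one-shot outcome parameters
    (∀ n S, T.IsFullRankDesignEvent P n S → ∀ (agg : Federation) (w : Fin 2) (j : Fin (d + 1)),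
      Integrable (fun ω => (T.sample n ω).thetaOneShot σ agg w j) P[|S] →
      ∫ ω, (T.sample n ω).thetaOneShot σ agg w j ∂(P[|S]) = θ w j) ∧
    -- unbiasedness of the one-shot treatment effect estimators, given the design
    (∀ n S, T.IsFullRankDesignEvent P n S → ∀ agg : Federation,
      Integrable (fun ω => (T.sample n ω).tauOneShot σ agg) P[|S] →
      ∫ ω, (T.sample n ω).tauOneShot σ agg ∂(P[|S]) = ∫ ω, T.sampleATE θ n ω ∂(P[|S])) ∧
    (∀ n : ℕ, n ≠ 0 →
      Integrable (T.sampleATE θ n) P ∧ ∫ ω, T.sampleATE θ n ω ∂P = T.ate P) ∧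
    -- the same, given the allocation to studies and arms
    (∀ (n : ℕ) (h : Fin n → Fin K) (a : Fin n → Fin 2),
      T.IsFullRankDesignEvent P n (T.allocation n h a) → ∀ agg : Federation,
      Integrable (fun ω => (T.sample n ω).tauOneShot σ agg) P[|T.allocation n h a] →
      ∫ ω, (T.sample n ω).tauOneShot σ agg ∂(P[|T.allocation n h a]) =
        ∑ k, ((Finset.univ.filter fun i => h i = k).card : ℝ) / n * T.studyATE P k) ∧
    (∀ n : ℕ, n ≠ 0 →
      ∫ ω, ∑ k, (((T.sample n ω).inStudy k).card : ℝ) / n * T.studyATE P k ∂P = T.ate P) ∧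
    -- the same, for the average treatment effect itself, as the sample grows
    (∀ (S : ℕ → Set Ω) (agg : Federation),
      (∀ᶠ n in atTop, T.IsFullRankDesignEvent P n (S n)) →
      Tendsto (fun n => P (S n)) atTop (𝓝 1) →
      (∀ᶠ n in atTop, Integrable (fun ω => (T.sample n ω).tauOneShot σ agg) P[|S n]) →
      Tendsto (fun n => ∫ ω, (T.sample n ω).tauOneShot σ agg ∂(P[|S n])) atTop (𝓝 (T.ate P))) ∧
    -- variances of the outcome parameters in every direction, possibly infinite
    (∀ n S, T.IsFullRankDesignEvent P n S → ∀ (w : Fin 2) (v : Fin (d + 1) → ℝ),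
      evariance (fun ω => v ⬝ᵥ (T.sample n ω).thetaPool w) P[|S] =
        evariance (fun ω => v ⬝ᵥ (T.sample n ω).thetaGD (η n ω) θ₀ w) P[|S] ∧
      evariance (fun ω => v ⬝ᵥ (T.sample n ω).thetaGD (η n ω) θ₀ w) P[|S] =
        evariance (fun ω => v ⬝ᵥ (T.sample n ω).thetaOneShot σ .IVW w) P[|S] ∧
      evariance (fun ω => v ⬝ᵥ (T.sample n ω).thetaOneShot σ .IVW w) P[|S] ≤
        evariance (fun ω => v ⬝ᵥ (T.sample n ω).thetaOneShot σ .SW w) P[|S]) ∧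
    -- covariance matrices of the outcome parameters in the Loewner order
    (∀ n S, T.IsFullRankDesignEvent P n S → ∀ w : Fin 2,
      (∀ j, MemLp (fun ω => (T.sample n ω).thetaOneShot σ .SW w j) 2 P[|S]) →
      (∀ j, MemLp (fun ω => (T.sample n ω).thetaPool w j) 2 P[|S] ∧
        MemLp (fun ω => (T.sample n ω).thetaGD (η n ω) θ₀ w j) 2 P[|S] ∧
        MemLp (fun ω => (T.sample n ω).thetaOneShot σ .IVW w j) 2 P[|S]) ∧
      covMatrix (fun ω => (T.sample n ω).thetaPool w) P[|S] =
        covMatrix (fun ω => (T.sample n ω).thetaGD (η n ω) θ₀ w) P[|S] ∧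
      covMatrix (fun ω => (T.sample n ω).thetaGD (η n ω) θ₀ w) P[|S] =
        covMatrix (fun ω => (T.sample n ω).thetaOneShot σ .IVW w) P[|S] ∧
      (covMatrix (fun ω => (T.sample n ω).thetaOneShot σ .SW w) P[|S] -
        covMatrix (fun ω => (T.sample n ω).thetaOneShot σ .IVW w) P[|S]).PosSemidef) ∧
    -- asymptotic variances of the treatment effect estimators
    (∃ V V_SW : ℝ≥0,
      HasAsymptoticVariance P (fun n ω => (T.sample n ω).tauPool) (T.ate P) V ∧
      HasAsymptoticVariance P (fun n ω => (T.sample n ω).tauGD (η n ω) θ₀) (T.ate P) V ∧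
      HasAsymptoticVariance P (fun n ω => (T.sample n ω).tauOneShot σ .IVW) (T.ate P) V ∧
      HasAsymptoticVariance P (fun n ω => (T.sample n ω).tauOneShot σ .SW) (T.ate P) V_SW ∧
      V ≤ V_SW) := by
  have hGD {n : ℕ} {S : Set Ω} (hS : T.IsFullRankDesignEvent P n S) :=
    hS.thetaGD_ae_eq_thetaPool hT (hη n) θ₀
  refine ⟨hT.tendsto_measure_fullRank hfull,
    fun n S hS => hS.integral_thetaOneShot hT,
    fun n S hS => hS.integral_tauOneShot hT,
    fun n hn => ⟨hT.integrable_sampleATE n, hT.integral_sampleATE hn⟩,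
    fun n h a hS agg hint =>
      (hS.integral_tauOneShot hT agg hint).trans (hT.integral_sampleATE_allocation hS.pos),
    fun n => hT.integral_sum_studyATE,
    fun S => hT.tendsto_integral_tauOneShot_cond,
    fun n S hS w v => ?_, fun n S hS w hSW => ?_,
    _, _, hT.hasAsymptoticVariance_tauPool hfull,
    hT.hasAsymptoticVariance_tauGD hfull hη_meas hη θ₀,
    hT.hasAsymptoticVariance_tauOneShot hfull .IVW, hT.hasAsymptoticVariance_tauOneShot hfull .SW,
    Real.toNNReal_le_toNNReal (hT.variance_influence_IVW_le_SW hfull)⟩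
  · have hIVW := hS.thetaOneShot_IVW_ae_eq_thetaPool hT w
    exact ⟨evariance_congr ((hGD hS w).symm.fun_comp (v ⬝ᵥ ·)), evariance_congr
      (((hGD hS w).trans hIVW.symm).fun_comp (v ⬝ᵥ ·)), hS.evariance_IVW_le hT .SW w v⟩
  · have hIVW := hS.thetaOneShot_IVW_ae_eq_thetaPool hT w
    have hL2 := hS.memLp_thetaOneShot_IVW hT .SW w hSW
    exact ⟨fun j => ⟨(hL2 j).ae_eq (hIVW.fun_comp (· j)),
        (hL2 j).ae_eq ((hIVW.trans (hGD hS w).symm).fun_comp (· j)), hL2 j⟩,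
      covMatrix_congr (hGD hS w).symm, covMatrix_congr ((hGD hS w).trans hIVW.symm),
      hS.posSemidef_covMatrix_sub_IVW hT .SW w hSW⟩
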